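/- **Source language.** Lazy Racket expressions are $e ::= n \mid s \mid b \mid x \mid \lambda x.e \mid (e\;e) \mid (p^2\;e\;e) \mid (\mathtt{cons}\;e\;e) \mid \mathtt{null} \mid (p^1\;e) \mid (\mathtt{if}\;e\;e\;e)$ with $n\in\mathbb Z$, strings $s$, booleans $b$, $p^2\in\{+,-,*,/\}$ and $p^1\in\{\mathtt{car},\mathtt{cdr}\}$. A program is a closed expression. The partial function $\delta$ interprets $p^2$ on integers ($/$ is integer quotient; division by $0$ is undefined). **Rewriting system $\lambda_{LR}$.** Labeled expressions $\hat e$ extend the grammar by $\ell\langle\hat e\rangle$ for labels $\ell$; $\mathrm{unlabel}$ erases all labels. Values are $n,s,b,\lambda x.\hat e,\mathtt{null}$, $(\mathtt{cons}\;\ell_1\langle\hat e_1\rangle\;\ell_2\langle\hat e_2\rangle)$ and $\ell\langle v\rangle$ for a value $v$. Evaluation contexts are $E ::= [\,] \mid (E\;\hat e) \mid (p^2\;E\;\hat e) \mid (p^2\;v\;E) \mid (p^1\;E) \mid (\mathtt{if}\;E\;\hat e\;\hat e) \mid \ell\langle E\rangle$. Redexes contract as follows, where $\vec\ell\langle\cdot\rangle$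 is a possibly empty sequence of labels and new labels are distinct and fresh for the whole program: $(\vec\ell\langle\lambda x.\hat e_1\rangle\;\hat e_2)\to \hat e_1[x:=\ell_1\langle\hat e_2\rangle]$ with $\ell_1$ new; $(p^2\;\vec\ell\langle n_1\rangle\;\vec\ell{}'\langle n_2\rangle)\to\delta(p^2,n_1,n_2)$; $(\mathtt{cons}\;\hat e_1\;\hat e_2)\to(\mathtt{cons}\;\ell_1\langle\hat e_1\rangle\;\ell_2\langle\hat e_2\rangle)$ with $\ell_1,\ell_2$ new, if $\hat e_1$ or $\hat e_2$ is not labeled; $(\mathtt{car}\;\vec\ell\langle(\mathtt{cons}\;\hat e_1\;\hat e_2)\rangle)\to\hat e_1$ and $(\mathtt{cdr}\;\vec\ell\langle(\mathtt{cons}\;\hat e_1\;\hat e_2)\rangle)\to\hat e_2$ if $\hat e_1$, $\hat e_2$ are labeled; $(\mathtt{if}\;\vec\ell\langle\mathtt{true}\rangle\;\hat e_1\;\hat e_2)\to\hat e_1$ and $(\mathtt{if}\;\vec\ell\langle\mathtt{false}\rangle\;\hat e_1\;\hat e_2)\to\hat e_2$. If $r\to c$, then $E[r]\mapsto_{LR}E[c]$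 if the hole of $E$ is under no label; and if $E=E_1[\ell\langle E_2[\,]\rangle]$ where the hole of $E_2$ is under no label, then $E[r]$ rewrites to the program obtained from it by replacing every expression immediately under the label $\ell$ by $E_2[c]$. $\mapsto_{LR}^{*}$ is the reflexive–transitive closure. **The stepper.** Given a program $e$, the stepper works as follows. 1. *Expansion* of $e$ into call-by-value Racket with $\mathtt{delay}$ and $\mathtt{force}$: $(e_1\;e_2)$ becomes $((\mathtt{force}\;e_1')\;(\mathtt{delay}\;e_2'))$; $\mathtt{cons}$ delays both arguments; $p^2$ and $p^1$ force their arguments; $\mathtt{if}$ forces its test; all other forms are expanded componentwise. 2. *Annotation*: the expanded program is instrumented with continuation marks and output. While a subexpression is evaluated, a mark on the stack describes the frame around it, including frames $(\mathtt{force}\;[\,])$ and, while the computation delayed at location $\ell$ is evaluated, $(\mathtt{force}_\ell\;[\,])$. The result of each reduction, quoted, is output together with all current marks; for $\mathtt{delay}$ and for the completion of a delayed computation the output also contains the location and the delayed expression or its value. 3. *Execution*: the annotated program is run for finitely many transitions on a deterministic abstract machine with control expression, store of delayed computations, stack and mark register. New store locations are chosen by an arbitrary allocation function that returns unused locations; the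 annotation has access to that function. 4. *Reconstruction*: every output value is turned into a pair of a control string (the quoted expression placed in the context described by the marks) and a store (the latest expression recorded for each location in the outputs so far). 5. *Synthesis*: every such pair is turned into a Lazy Racket expression by erasing $\mathtt{delay}$, $\mathtt{force}$ and $\mathtt{force}_\ell$ and replacing each location by the synthesis of its contents, where the contents of a location $\ell$ under evaluation in a context $(\mathtt{force}_\ell\;[\,])$ is the partially evaluated expression in that context. The stepper displays $e$ followed by the synthesized expressions, in order. **Theorem (Stepper Correctness).** Suppose that the stepper displays the sequence $e,d_1,\dots,d_n$ for a Lazy Racket program $e$. Then there are labeled expressions $\hat e_1,\dots,\hat e_n$ with $d_i=\mathrm{unlabel}(\hat e_i)$ for all $i$ and $$e\mapsto_{LR}^{*}\hat e_1\mapsto_{LR}^{*}\cdots\mapsto_{LR}^{*}\hat e_n .$$ -/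

import Mathlib

namespace LazyStepper

/-! ## Primitives shared by all languages -/

/-- Variables are named by strings. -/
abbrev Var := String

/-- Binary primitives `+ - * /`. -/
inductive P2 where
  | add | sub | mul | div

/-- Unary primitives `car`, `cdr`. -/
inductive P1 where
  | car | cdr

/-- The interpretation of binary primitives on integers (`/` is the integer quotient rounding
towards zero; division by `0` is undefined, so that it is a stuck state). -/
def delta : P2 → ℤ → ℤ → Option ℤ
  | .add, m, n => some (m + n)
  | .sub, m, n => some (m - n)
  | .mul, m, n => some (m * n)
  | .div, m, n => if n = 0 then none else some (m.tdiv n)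

/-! ## Source expressions of Lazy Racket -/

inductive Exp where
  | num (n : ℤ)
  | str (s : String)
  | bool (b : Bool)
  | var (x : Var)
  | lam (x : Var) (e : Exp)
  | app (e₁ e₂ : Exp)
  | prim2 (p : P2) (e₁ e₂ : Exp)
  | cons (e₁ e₂ : Exp)
  | null
  | prim1 (p : P1) (e : Exp)
  | ite (e₁ e₂ e₃ : Exp)

namespace Exp

def freeVars : Exp → Finset Var
  | .num _ | .str _ | .bool _ | .null => ∅
  | .var x => {x}
  | .lam x e => e.freeVars.erase x
  | .app e₁ e₂ | .prim2 _ e₁ e₂ | .cons e₁ e₂ => e₁.freeVars ∪ e₂.freeVars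
  | .prim1 _ e => e.freeVars
  | .ite e₁ e₂ e₃ => e₁.freeVars ∪ e₂.freeVars ∪ e₃.freeVars

/-- A program is an expression without free variables. -/
def IsProgram (e : Exp) : Prop := e.freeVars = ∅

end Exp

/-! ## The rewriting system λLR -/

abbrev Label := ℕ

/-- Labeled expressions. -/
inductive LExp where
  | num (n : ℤ)
  | str (s : String)
  | bool (b : Bool)
  | var (x : Var)
  | lam (x : Var) (e : LExp)
  | app (e₁ e₂ : LExp)
  | prim2 (p : P2) (e₁ e₂ : LExp)
  | cons (e₁ e₂ : LExp)
  | null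
  | prim1 (p : P1) (e : LExp)
  | ite (e₁ e₂ e₃ : LExp)
  | lab (l : Label) (e : LExp)

/-- Source expressions are labeled expressions without labels. -/
def Exp.toLExp : Exp → LExp
  | .num n => .num n
  | .str s => .str s
  | .bool b => .bool b
  | .var x => .var x
  | .lam x e => .lam x e.toLExp
  | .app e₁ e₂ => .app e₁.toLExp e₂.toLExp
  | .prim2 p e₁ e₂ => .prim2 p e₁.toLExp e₂.toLExp
  | .cons e₁ e₂ => .cons e₁.toLExp e₂.toLExp
  | .null => .null
  | .prim1 p e => .prim1 p e.toLExp
  | .ite e₁ e₂ e₃ => .ite e₁.toLExp e₂.toLExp e₃.toLExp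

namespace LExp

/-- Erasure of all labels. -/
def unlabel : LExp → Exp
  | .num n => .num n
  | .str s => .str s
  | .bool b => .bool b
  | .var x => .var x
  | .lam x e => .lam x e.unlabel
  | .app e₁ e₂ => .app e₁.unlabel e₂.unlabel
  | .prim2 p e₁ e₂ => .prim2 p e₁.unlabel e₂.unlabel
  | .cons e₁ e₂ => .cons e₁.unlabel e₂.unlabel
  | .null => .null
  | .prim1 p e => .prim1 p e.unlabel
  | .ite e₁ e₂ e₃ => .ite e₁.unlabel e₂.unlabel e₃.unlabel
  | .lab _ e => e.unlabel

/-- The labels that occur in an expression. -/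
def labels : LExp → Finset Label
  | .num _ | .str _ | .bool _ | .var _ | .null => ∅
  | .lam _ e => e.labels
  | .app e₁ e₂ | .prim2 _ e₁ e₂ | .cons e₁ e₂ => e₁.labels ∪ e₂.labels
  | .prim1 _ e => e.labels
  | .ite e₁ e₂ e₃ => e₁.labels ∪ e₂.labels ∪ e₃.labels
  | .lab l e => insert l e.labels

/-- `subst x a e` is `e[x := a]`. In the rewriting of a program `a` is always closed, so bound
variables need no renaming. -/
def subst (x : Var) (a : LExp) : LExp → LExp
  | .num n => .num n
  | .str s => .str s
  | .bool b => .bool b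
  | .var y => if y = x then a else .var y
  | .lam y e => if y = x then .lam y e else .lam y (subst x a e)
  | .app e₁ e₂ => .app (subst x a e₁) (subst x a e₂)
  | .prim2 p e₁ e₂ => .prim2 p (subst x a e₁) (subst x a e₂)
  | .cons e₁ e₂ => .cons (subst x a e₁) (subst x a e₂)
  | .null => .null
  | .prim1 p e => .prim1 p (subst x a e)
  | .ite e₁ e₂ e₃ => .ite (subst x a e₁) (subst x a e₂) (subst x a e₃)
  | .lab l e => .lab l (subst x a e)

/-- The parallel update: every expression immediately under the label `l` is replaced by `a`. -/
def update (l : Label) (a : LExp) : LExp → LExp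
  | .num n => .num n
  | .str s => .str s
  | .bool b => .bool b
  | .var y => .var y
  | .lam y e => .lam y (update l a e)
  | .app e₁ e₂ => .app (update l a e₁) (update l a e₂)
  | .prim2 p e₁ e₂ => .prim2 p (update l a e₁) (update l a e₂)
  | .cons e₁ e₂ => .cons (update l a e₁) (update l a e₂)
  | .null => .null
  | .prim1 p e => .prim1 p (update l a e)
  | .ite e₁ e₂ e₃ => .ite (update l a e₁) (update l a e₂) (update l a e₃)
  | .lab l' e => if l' = l then .lab l' a else .lab l' (update l a e)

def IsLabeled : LExp → Prop
  | .lab _ _ => True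
  | _ => False

inductive IsValue : LExp → Prop
  | num (n) : IsValue (.num n)
  | str (s) : IsValue (.str s)
  | bool (b) : IsValue (.bool b)
  | lam (x e) : IsValue (.lam x e)
  | null : IsValue .null
  | cons (l₁ e₁ l₂ e₂) : IsValue (.cons (.lab l₁ e₁) (.lab l₂ e₂))
  | lab (l v) : IsValue v → IsValue (.lab l v)

/-- An expression wrapped in a (possibly empty) sequence of labels. -/
def wrap (ls : List Label) (e : LExp) : LExp := ls.foldr .lab e

end LExp

/-- Evaluation contexts of λLR. -/
inductive LCtx where
  | hole
  | app (E : LCtx) (e : LExp)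
  | prim2L (p : P2) (E : LCtx) (e : LExp)
  | prim2R (p : P2) (v : LExp) (hv : v.IsValue) (E : LCtx)
  | prim1 (p : P1) (E : LCtx)
  | ite (E : LCtx) (e₂ e₃ : LExp)
  | lab (l : Label) (E : LCtx)

namespace LCtx

def fill : LCtx → LExp → LExp
  | .hole, r => r
  | .app E e, r => .app (E.fill r) e
  | .prim2L p E e, r => .prim2 p (E.fill r) e
  | .prim2R p v _ E, r => .prim2 p v (E.fill r)
  | .prim1 p E, r => .prim1 p (E.fill r)
  | .ite E e₂ e₃, r => .ite (E.fill r) e₂ e₃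
  | .lab l E, r => .lab l (E.fill r)

/-- The hole is not under a label. -/
def NotUnderLabel : LCtx → Prop
  | .hole => True
  | .app E _ | .prim2L _ E _ | .prim2R _ _ _ E | .prim1 _ E | .ite E _ _ => E.NotUnderLabel
  | .lab _ _ => False

end LCtx

open LExp in
/-- `Contract L r c`: the redex `r` contracts to `c`, where the labels that are introduced are
distinct and not in `L`. -/
inductive Contract (L : Finset Label) : LExp → LExp → Prop
  | beta (ls x e₁ e₂ l) : l ∉ L →
      Contract L (.app (wrap ls (.lam x e₁)) e₂) (subst x (.lab l e₂) e₁)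
  | prim (p ls₁ n₁ ls₂ n₂ n) : delta p n₁ n₂ = some n →
      Contract L (.prim2 p (wrap ls₁ (.num n₁)) (wrap ls₂ (.num n₂))) (.num n)
  | cons (e₁ e₂ l₁ l₂) : (¬ e₁.IsLabeled ∨ ¬ e₂.IsLabeled) → l₁ ∉ L → l₂ ∉ L → l₁ ≠ l₂ →
      Contract L (.cons e₁ e₂) (.cons (.lab l₁ e₁) (.lab l₂ e₂))
  | car (ls e₁ e₂) : e₁.IsLabeled → e₂.IsLabeled →
      Contract L (.prim1 .car (wrap ls (.cons e₁ e₂))) e₁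
  | cdr (ls e₁ e₂) : e₁.IsLabeled → e₂.IsLabeled →
      Contract L (.prim1 .cdr (wrap ls (.cons e₁ e₂))) e₂
  | iteTrue (ls e₁ e₂) : Contract L (.ite (wrap ls (.bool true)) e₁ e₂) e₁
  | iteFalse (ls e₁ e₂) : Contract L (.ite (wrap ls (.bool false)) e₁ e₂) e₂

/-- One rewriting step of λLR. If the redex occurs under a label and `l` is the nearest one, all
expressions under `l` in the program are rewritten simultaneously. -/
inductive LRStep : LExp → LExp → Prop
  | plain (E : LCtx) (r c : LExp) : E.NotUnderLabel → Contract (E.fill r).labels r c →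
      LRStep (E.fill r) (E.fill c)
  | shared (E₁ : LCtx) (l : Label) (E₂ : LCtx) (r c : LExp) : E₂.NotUnderLabel →
      Contract (E₁.fill (.lab l (E₂.fill r))).labels r c →
      LRStep (E₁.fill (.lab l (E₂.fill r)))
        (LExp.update l (E₂.fill c) (E₁.fill (.lab l (E₂.fill r))))

/-- Multistep rewriting. -/
abbrev LRSteps : LExp → LExp → Prop := Relation.ReflTransGen LRStep

/-! ## Plain Racket with `delay` and `force`

One type holds the programs (no `loc`, no `forceAt`), the machine expressions (no `forceAt`) and
the control strings, in which `forceAt l C` is the context that evaluates the delayed computation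
at location `l`. -/

abbrev Loc := ℕ

inductive DExp where
  | num (n : ℤ)
  | str (s : String)
  | bool (b : Bool)
  | var (x : Var)
  | lam (x : Var) (e : DExp)
  | app (e₁ e₂ : DExp)
  | prim2 (p : P2) (e₁ e₂ : DExp)
  | cons (e₁ e₂ : DExp)
  | null
  | prim1 (p : P1) (e : DExp)
  | ite (e₁ e₂ e₃ : DExp)
  | delay (e : DExp)
  | force (e : DExp)
  | loc (l : Loc)
  | forceAt (l : Loc) (e : DExp)

/-- Source expressions are plain Racket expressions without `delay`, `force` and locations. -/
def Exp.toDExp : Exp → DExp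
  | .num n => .num n
  | .str s => .str s
  | .bool b => .bool b
  | .var x => .var x
  | .lam x e => .lam x e.toDExp
  | .app e₁ e₂ => .app e₁.toDExp e₂.toDExp
  | .prim2 p e₁ e₂ => .prim2 p e₁.toDExp e₂.toDExp
  | .cons e₁ e₂ => .cons e₁.toDExp e₂.toDExp
  | .null => .null
  | .prim1 p e => .prim1 p e.toDExp
  | .ite e₁ e₂ e₃ => .ite e₁.toDExp e₂.toDExp e₃.toDExp

/-- Values of the machine. -/
def DExp.isValue : DExp → Bool
  | .num _ | .str _ | .bool _ | .lam _ _ | .null | .loc _ => true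
  | .cons v₁ v₂ => v₁.isValue && v₂.isValue
  | _ => false

/-- Stores of the CS machine: association lists in which the first entry for a location counts. -/
abbrev DStore := List (Loc × DExp)

/-- States of the CS machine. -/
structure CSState where
  control : DExp
  store : DStore

/-- Expansion of Lazy Racket into plain Racket. -/
def expand : Exp → DExp
  | .num n => .num n
  | .str s => .str s
  | .bool b => .bool b
  | .var x => .var x
  | .lam x e => .lam x (expand e)
  | .app e₁ e₂ => .app (.force (expand e₁)) (.delay (expand e₂))
  | .prim2 p e₁ e₂ => .prim2 p (.force (expand e₁)) (.force (expand e₂))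
  | .cons e₁ e₂ => .cons (.delay (expand e₁)) (.delay (expand e₂))
  | .null => .null
  | .prim1 p e => .prim1 p (.force (expand e))
  | .ite e₁ e₂ e₃ => .ite (.force (expand e₁)) (expand e₂) (expand e₃)

/-- Synthesis of a Lazy Racket expression, together with an updated store, from a CS state. It
follows locations through the store, so the recursion is bounded by a number `k` of levels; the
result, where there is one, does not depend on `k`. Only `forceAt` changes the
store, and the part of the control string that can contain the redex is synthesized first, so that
the other parts are synthesized in the updated store: in a binary form this is the right part if
the left one is a value, and the left part otherwise. -/
def synthS : ℕ → DExp → DStore → Option (Exp × DStore)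
  | 0, _, _ => none
  | k + 1, C, σ =>
    match C with
    | .num n => some (.num n, σ)
    | .str s => some (.str s, σ)
    | .bool b => some (.bool b, σ)
    | .var x => some (.var x, σ)
    | .null => some (.null, σ)
    | .lam x c => do
        let (e, _) ← synthS k c σ
        some (.lam x e, σ)
    | .app C₁ C₂ =>
        if C₁.isValue then do
          let (e₂, σ') ← synthS k C₂ σ
          let (e₁, σ'') ← synthS k C₁ σ'
          some (.app e₁ e₂, σ'')
        else do
          let (e₁, σ') ← synthS k C₁ σ
          let (e₂, σ'') ← synthS k C₂ σ'
          some (.app e₁ e₂, σ'')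
    | .prim2 p C₁ C₂ =>
        if C₁.isValue then do
          let (e₂, σ') ← synthS k C₂ σ
          let (e₁, σ'') ← synthS k C₁ σ'
          some (.prim2 p e₁ e₂, σ'')
        else do
          let (e₁, σ') ← synthS k C₁ σ
          let (e₂, σ'') ← synthS k C₂ σ'
          some (.prim2 p e₁ e₂, σ'')
    | .cons C₁ C₂ =>
        if C₁.isValue then do
          let (e₂, σ') ← synthS k C₂ σ
          let (e₁, σ'') ← synthS k C₁ σ'
          some (.cons e₁ e₂, σ'')
        else do
          let (e₁, σ') ← synthS k C₁ σ
          let (e₂, σ'') ← synthS k C₂ σ'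
          some (.cons e₁ e₂, σ'')
    | .prim1 p C₁ => do
        let (e, σ') ← synthS k C₁ σ
        some (.prim1 p e, σ')
    | .ite C₁ c₂ c₃ => do
        let (e₁, σ') ← synthS k C₁ σ
        let (e₂, _) ← synthS k c₂ σ'
        let (e₃, _) ← synthS k c₃ σ'
        some (.ite e₁ e₂ e₃, σ')
    | .delay c => synthS k c σ
    | .loc l => do
        let c ← σ.lookup l
        synthS k c σ
    | .force C₁ => synthS k C₁ σ
    | .forceAt l C₁ => do
        let (e, σ') ← synthS k C₁ σ
        some (e, (l, e.toDExp) :: σ')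

/-- `e` is the Lazy Racket expression synthesized from the CS state `s`. -/
def Synth (s : CSState) (e : Exp) : Prop :=
  ∃ (k : ℕ) (σ : DStore), synthS k s.control s.store = some (e, σ)

/-! ## Annotated Racket: continuation marks and output -/

/-- Variables of annotated programs: those of the source program, and names used by the
annotation only. -/
inductive Name where
  | src (x : Var)
  | tmp (k : ℕ)
deriving DecidableEq

/-- Expressions of annotated Racket: plain Racket (with locations), current continuation marks,
with-continuation-mark, output, the location predicate, and `alloc`, which returns the location
that the next evaluation of a `delay` will use. -/
inductive CExp where
  | num (n : ℤ)
  | str (s : String)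
  | bool (b : Bool)
  | var (x : Name)
  | lam (x : Name) (e : CExp)
  | app (e₁ e₂ : CExp)
  | prim2 (p : P2) (e₁ e₂ : CExp)
  | cons (e₁ e₂ : CExp)
  | null
  | prim1 (p : P1) (e : CExp)
  | ite (e₁ e₂ e₃ : CExp)
  | delay (e : CExp)
  | force (e : CExp)
  | loc (l : Loc)
  | ccm
  | wcm (e₁ e₂ : CExp)
  | out (e : CExp)
  | isLoc (e : CExp)
  | alloc

namespace CExp

def isValue : CExp → Bool
  | .num _ | .str _ | .bool _ | .lam _ _ | .null | .loc _ => true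
  | .cons v₁ v₂ => v₁.isValue && v₂.isValue
  | _ => false

/-- `subst x a e` is `e[x := a]`; the machine only substitutes closed values. -/
def subst (x : Name) (a : CExp) : CExp → CExp
  | .num n => .num n
  | .str s => .str s
  | .bool b => .bool b
  | .var y => if y = x then a else .var y
  | .lam y e => if y = x then .lam y e else .lam y (subst x a e)
  | .app e₁ e₂ => .app (subst x a e₁) (subst x a e₂)
  | .prim2 p e₁ e₂ => .prim2 p (subst x a e₁) (subst x a e₂)
  | .cons e₁ e₂ => .cons (subst x a e₁) (subst x a e₂)
  | .null => .null
  | .prim1 p e => .prim1 p (subst x a e)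
  | .ite e₁ e₂ e₃ => .ite (subst x a e₁) (subst x a e₂) (subst x a e₃)
  | .delay e => .delay (subst x a e)
  | .force e => .force (subst x a e)
  | .loc l => .loc l
  | .ccm => .ccm
  | .wcm e₁ e₂ => .wcm (subst x a e₁) (subst x a e₂)
  | .out e => .out (subst x a e)
  | .isLoc e => .isLoc (subst x a e)
  | .alloc => .alloc

/-- `(list e ...)`. -/
def list (es : List CExp) : CExp := es.foldr .cons .null

/-- `(let ([x a]) b)`. -/
def letIn (x : Name) (a b : CExp) : CExp := .app (.lam x b) a

/-- `(not e)`. -/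
def not (e : CExp) : CExp := .ite e (.bool false) (.bool true)

end CExp

/-! ### The CSKM machine -/

/-- Stores: association lists in which the first entry for a location counts. -/
abbrev CStore := List (Loc × CExp)

/-- Mark register: empty or a value. -/
abbrev Mark := Option CExp

/-- A stack frame: an evaluation context of depth one. -/
inductive Frame where
  | app₁ (c : CExp)
  | app₂ (v : CExp)
  | prim2₁ (p : P2) (c : CExp)
  | prim2₂ (p : P2) (v : CExp)
  | cons₁ (c : CExp)
  | cons₂ (v : CExp)
  | prim1 (p : P1)
  | ite (c₂ c₃ : CExp)
  | force
  | forceAt (l : Loc)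
  | wcm (c : CExp)
  | out
  | isLoc

/-- Continuations: a stack of frames, innermost first, each with the continuation mark of the
continuation below it. -/
abbrev Kont := List (Frame × Mark)

/-- All continuation marks of the stack as a list value, innermost first. -/
def marks : Kont → Mark → CExp
  | [], none => .null
  | [], some m => .cons m .null
  | (_, m') :: K, none => marks K m'
  | (_, m') :: K, some m => .cons m (marks K m')

/-- Machine states. -/
structure Config where
  control : CExp
  store : CStore
  kont : Kont
  mark : Mark

/-- Return of the value `v` to the frame `f`, below which are the continuation `K` and its mark
`m`; `m'` is the contents of the mark register. -/
def ret (v : CExp) (σ : CStore) (f : Frame) (K : Kont) (m m' : Mark) :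
    Option (Option CExp × Config) :=
  match f, v with
  | .app₁ c, v => some (none, ⟨c, σ, (.app₂ v, m) :: K, none⟩)
  | .app₂ (.lam x c), v => some (none, ⟨CExp.subst x v c, σ, K, m⟩)
  | .prim2₁ p c, v => some (none, ⟨c, σ, (.prim2₂ p v, m) :: K, none⟩)
  | .prim2₂ p (.num n₁), .num n₂ => (delta p n₁ n₂).map fun n => (none, ⟨.num n, σ, K, m⟩)
  | .cons₁ c, v => some (none, ⟨c, σ, (.cons₂ v, m) :: K, none⟩)
  | .cons₂ v₁, v => some (none, ⟨.cons v₁ v, σ, K, m⟩)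
  | .prim1 .car, .cons v₁ _ => some (none, ⟨v₁, σ, K, m⟩)
  | .prim1 .cdr, .cons _ v₂ => some (none, ⟨v₂, σ, K, m⟩)
  | .ite c₂ _, .bool true => some (none, ⟨c₂, σ, K, m⟩)
  | .ite _ c₃, .bool false => some (none, ⟨c₃, σ, K, m⟩)
  | .force, .loc l =>
      (σ.lookup l).map fun c => (none, ⟨c, σ, (.forceAt l, m') :: (.force, m) :: K, none⟩)
  | .force, v => some (none, ⟨v, σ, K, m⟩)
  | .forceAt l, v => some (none, ⟨v, (l, v) :: σ, K, m⟩)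
  | .wcm c, v => some (none, ⟨c, σ, K, some v⟩)
  | .out, v => some (some v, ⟨.num 42, σ, K, m⟩)
  | .isLoc, .loc _ => some (none, ⟨.bool true, σ, K, m⟩)
  | .isLoc, _ => some (none, ⟨.bool false, σ, K, m⟩)
  | _, _ => none

/-- One transition, with its output if there is one; `none` if the machine has halted or is stuck.
`new` is the location-allocating algorithm of the machine. -/
def step (new : CStore → Loc) : Config → Option (Option CExp × Config)
  | ⟨c, σ, K, m⟩ =>
    if c.isValue then
      match K with
      | [] => none
      | (f, m₀) :: K₀ => ret c σ f K₀ m₀ m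
    else
      match c with
      | .app c₁ c₂ => some (none, ⟨c₁, σ, (.app₁ c₂, m) :: K, none⟩)
      | .prim2 p c₁ c₂ => some (none, ⟨c₁, σ, (.prim2₁ p c₂, m) :: K, none⟩)
      | .cons c₁ c₂ => some (none, ⟨c₁, σ, (.cons₁ c₂, m) :: K, none⟩)
      | .prim1 p c₁ => some (none, ⟨c₁, σ, (.prim1 p, m) :: K, none⟩)
      | .ite c₁ c₂ c₃ => some (none, ⟨c₁, σ, (.ite c₂ c₃, m) :: K, none⟩)
      | .delay c₁ => some (none, ⟨.loc (new σ), (new σ, c₁) :: σ, K, m⟩)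
      | .force c₁ => some (none, ⟨c₁, σ, (.force, m) :: K, none⟩)
      | .ccm => some (none, ⟨marks K m, σ, K, m⟩)
      | .wcm c₁ c₂ => some (none, ⟨c₁, σ, (.wcm c₂, m) :: K, none⟩)
      | .out c₁ => some (none, ⟨c₁, σ, (.out, m) :: K, none⟩)
      | .isLoc c₁ => some (none, ⟨c₁, σ, (.isLoc, m) :: K, none⟩)
      | .alloc => some (none, ⟨.loc (new σ), σ, K, m⟩)
      | _ => none

/-- The starting configuration of a program. -/
def start (c : CExp) : Config := ⟨c, [], [], none⟩

/-- The values output in the first `k` transitions from a configuration (in all transitions, if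
there are fewer than `k`). -/
def trace (new : CStore → Loc) : ℕ → Config → List CExp
  | 0, _ => []
  | k + 1, s =>
    match step new s with
    | none => []
    | some (o, s') => o.toList ++ trace new k s'

/-! ### Annotation -/

/-- Tags in quoted expressions and in continuation marks. -/
inductive Tag where
  | op2 (p : P2) | op1 (p : P1)
  | value | var | lam | app | cons | ite | delay | force
  | app₁ | app₂ | prim2₁ | prim2₂ | cons₁ | cons₂ | prim1
  | val | loc

namespace Tag

/-- The ASCII codes of the tag. -/
def codes : Tag → List ℕ
  | .op2 .add => [43]
  | .op2 .sub => [45]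
  | .op2 .mul => [42]
  | .op2 .div => [47]
  | .op1 .car => [99, 97, 114]
  | .op1 .cdr => [99, 100, 114]
  | .value => [118, 97, 108, 117, 101]
  | .var => [118, 97, 114]
  | .lam => [108, 97, 109]
  | .app => [97, 112, 112]
  | .cons => [99, 111, 110, 115]
  | .ite => [105, 102]
  | .delay => [100, 101, 108, 97, 121]
  | .force => [102, 111, 114, 99, 101]
  | .app₁ => [97, 112, 112, 45, 49]
  | .app₂ => [97, 112, 112, 45, 50]
  | .prim2₁ => [112, 114, 105, 109, 50, 45, 49]
  | .prim2₂ => [112, 114, 105, 109, 50, 45, 50]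
  | .cons₁ => [99, 111, 110, 115, 45, 49]
  | .cons₂ => [99, 111, 110, 115, 45, 50]
  | .prim1 => [112, 114, 105, 109, 49]
  | .val => [118, 97, 108]
  | .loc => [108, 111, 99]

/-- The tag as a string. -/
def string (t : Tag) : String := String.ofList (t.codes.map Char.ofNat)

def all : List Tag :=
  [.op2 .add, .op2 .sub, .op2 .mul, .op2 .div, .op1 .car, .op1 .cdr, .value, .var, .lam, .app,
    .cons, .ite, .delay, .force, .app₁, .app₂, .prim2₁, .prim2₂, .cons₁, .cons₂, .prim1, .val,
    .loc]

/-- The tag with a given string. -/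
def ofString (s : String) : Option Tag := all.find? fun t => t.string = s

/-- The tag as a string constant. -/
def exp (t : Tag) : CExp := .str t.string

end Tag

open CExp (list letIn)

/-- The value of a variable, quoted. -/
def quoVar (x : Name) : CExp := list [Tag.value.exp, .var x]

/-- Quotation: `quo B e` evaluates to a representation of `e` as a list. The variables in `B` are
bound inside the quotation; a variable not in `B` is bound outside, and its value at run time
becomes part of the representation. -/
def quo (B : List Var) : DExp → CExp
  | .num n => .num n
  | .str s => .str s
  | .bool b => .bool b
  | .null => .null
  | .var x => if x ∈ B then list [Tag.var.exp, .str x] else quoVar (.src x)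
  | .lam x e => list [Tag.lam.exp, .str x, quo (x :: B) e]
  | .app e₁ e₂ => list [Tag.app.exp, quo B e₁, quo B e₂]
  | .prim2 p e₁ e₂ => list [(Tag.op2 p).exp, quo B e₁, quo B e₂]
  | .cons e₁ e₂ => list [Tag.cons.exp, quo B e₁, quo B e₂]
  | .prim1 p e => list [(Tag.op1 p).exp, quo B e]
  | .ite e₁ e₂ e₃ => list [Tag.ite.exp, quo B e₁, quo B e₂, quo B e₃]
  | .delay e => list [Tag.delay.exp, quo B e]
  | .force e => list [Tag.force.exp, quo B e]
  | .loc l => list [Tag.value.exp, .loc l]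
  | .forceAt _ e => quo B e -- does not occur in programs

/-- `(let ([t (output (cons q (ccm)))]) b)`, for a variable `t` not used elsewhere: output of the
quoted expression `q` with all current continuation marks. -/
def emit (q b : CExp) : CExp := letIn (.tmp 9) (.out (.cons q .ccm)) b

/-- The names `v0`, `v1`, `v2` used by the annotation, and the name of a location. -/
abbrev v0 : Name := .tmp 0
abbrev v1 : Name := .tmp 1
abbrev v2 : Name := .tmp 2
abbrev vl : Name := .tmp 3

/-- Expressions whose evaluation takes no reduction step. -/
def isAtom : DExp → Bool
  | .num _ | .str _ | .bool _ | .var _ | .lam _ _ | .null => true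
  | _ => false

/-- Output of a redex, if it is not output already by the evaluation of its parts. -/
def emitIf (b : Bool) (q c : CExp) : CExp := if b then emit q c else c

/-- Annotation of plain Racket programs. A mark describes the frame around the expression under
evaluation, and the result of every reduction is output. An abstraction carries its own source,
quoted. -/
def anno : DExp → CExp
  | .num n => .num n
  | .str s => .str s
  | .bool b => .bool b
  | .null => .null
  | .var x => .var (.src x)
  | .lam x e =>
      .lam (.src x) (letIn (.tmp 9) (quo [] (.lam x e)) (emit (quo [] e) (anno e)))
  | .app e₁ e₂ =>
      letIn v0 (.wcm (list [Tag.app₁.exp, quo [] e₂]) (anno e₁)) <|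
      letIn v1 (.wcm (list [Tag.app₂.exp, quoVar v0]) (anno e₂)) <|
      emitIf (isAtom e₁ && isAtom e₂) (quo [] (.app e₁ e₂)) <|
      .app (.var v0) (.var v1)
  | .prim2 p e₁ e₂ =>
      letIn v0 (.wcm (list [Tag.prim2₁.exp, (Tag.op2 p).exp, quo [] e₂]) (anno e₁)) <|
      letIn v1 (.wcm (list [Tag.prim2₂.exp, (Tag.op2 p).exp, quoVar v0]) (anno e₂)) <|
      emitIf (isAtom e₁ && isAtom e₂) (quo [] (.prim2 p e₁ e₂)) <|
      letIn v2 (.prim2 p (.var v0) (.var v1)) <|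
      emit (quoVar v2) (.var v2)
  | .cons e₁ e₂ =>
      letIn v0 (.wcm (list [Tag.cons₁.exp, quo [] e₂]) (anno e₁)) <|
      letIn v1 (.wcm (list [Tag.cons₂.exp, quoVar v0]) (anno e₂)) <|
      .cons (.var v0) (.var v1)
  | .prim1 p e =>
      letIn v0 (.wcm (list [Tag.prim1.exp, (Tag.op1 p).exp]) (anno e)) <|
      emitIf (isAtom e) (quo [] (.prim1 p e)) <|
      letIn v1 (.prim1 p (.var v0)) <|
      emit (quoVar v1) (.var v1)
  | .ite e₁ e₂ e₃ =>
      letIn v0 (.wcm (list [Tag.ite.exp, quo [] e₂, quo [] e₃]) (anno e₁)) <|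
      emitIf (isAtom e₁) (quo [] (.ite e₁ e₂ e₃)) <|
      .ite (.var v0) (emit (quo [] e₂) (anno e₂)) (emit (quo [] e₃) (anno e₃))
  | .force e =>
      letIn v0 (.wcm (list [Tag.force.exp]) (anno e)) <|
      letIn v1 (.ite (CExp.not (.isLoc (.var v0))) (.var v0)
        (.wcm (list [Tag.force.exp]) (.force (.var v0)))) <|
      emit (quoVar v1) (.var v1)
  | .delay e =>
      emit (quo [] (.delay e)) <|
      letIn vl .alloc <|
      emit (list [Tag.loc.exp, .var vl, quo [] e]) <|
      .delay <|
        .wcm (list [Tag.force.exp, .var vl]) <|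
          letIn v2 (anno e) <|
          letIn (.tmp 9) (.out (.cons (list [Tag.val.exp, .var vl, quoVar v2])
            (.prim1 .cdr .ccm))) <|
          .var v2
  | .loc l => .loc l
  | .forceAt _ e => anno e -- does not occur in programs

/-! ### Reconstruction -/

mutual

/-- The expression that a quotation represents. -/
def unquo : CExp → Option DExp
  | .num n => some (.num n)
  | .str s => some (.str s)
  | .bool b => some (.bool b)
  | .null => some .null
  | .cons (.str s) (.cons a .null) =>
    match Tag.ofString s with
    | some .value => unquoValue a
    | some .var => match a with
        | .str x => some (.var x)
        | _ => none
    | some (.op1 p) => do some (.prim1 p (← unquo a))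
    | some .delay => do some (.delay (← unquo a))
    | some .force => do some (.force (← unquo a))
    | _ => none
  | .cons (.str s) (.cons a (.cons b .null)) =>
    match Tag.ofString s with
    | some .lam => match a with
        | .str x => do some (.lam x (← unquo b))
        | _ => none
    | some .app => do some (.app (← unquo a) (← unquo b))
    | some (.op2 p) => do some (.prim2 p (← unquo a) (← unquo b))
    | some .cons => do some (.cons (← unquo a) (← unquo b))
    | _ => none
  | .cons (.str s) (.cons a (.cons b (.cons c .null))) =>
    match Tag.ofString s with
    | some .ite => do some (.ite (← unquo a) (← unquo b) (← unquo c))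
    | _ => none
  | _ => none

/-- The plain Racket value that a value of the annotated program stands for; that of an
abstraction is found in the quotation of its source. -/
def unquoValue : CExp → Option DExp
  | .num n => some (.num n)
  | .str s => some (.str s)
  | .bool b => some (.bool b)
  | .null => some .null
  | .loc l => some (.loc l)
  | .cons a b => do some (.cons (← unquoValue a) (← unquoValue b))
  | .lam _ (.app (.lam _ _) q) => unquo q
  | _ => none

end

/-- The elements of a list value. -/
def listElems : CExp → Option (List CExp)
  | .null => some []
  | .cons a b => do some (a :: (← listElems b))
  | _ => none

/-- The control string `C` placed into the frame that a mark describes. -/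
def reconFrame (mark : CExp) (C : DExp) : Option DExp := do
  match ← listElems mark with
  | .str s :: args =>
    match Tag.ofString s, args with
    | some .app₁, [q] => some (.app C (← unquo q))
    | some .app₂, [q] => some (.app (← unquo q) C)
    | some .prim2₁, [.str t, q] =>
      match Tag.ofString t with
      | some (.op2 p) => some (.prim2 p C (← unquo q))
      | _ => none
    | some .prim2₂, [.str t, q] =>
      match Tag.ofString t with
      | some (.op2 p) => some (.prim2 p (← unquo q) C)
      | _ => none
    | some .cons₁, [q] => some (.cons C (← unquo q))
    | some .cons₂, [q] => some (.cons (← unquo q) C)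
    | some .prim1, [.str t] =>
      match Tag.ofString t with
      | some (.op1 p) => some (.prim1 p C)
      | _ => none
    | some .ite, [q₂, q₃] => some (.ite C (← unquo q₂) (← unquo q₃))
    | some .force, [] => some (.force C)
    | some .force, [.loc l] => some (.forceAt l C)
    | _, _ => none
  | _ => none

/-- The control string `C` placed into the context that a list of marks (innermost first)
describes. -/
def reconE : CExp → DExp → Option DExp
  | .null, C => some C
  | .cons mark ms, C => do reconE ms (← reconFrame mark C)
  | _, _ => none

/-- If `v` has the form `(list tag l q)` with the tag `val` or `loc`: the tag, `l` and `q`. -/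
def storeEntry? : CExp → Option (Tag × Loc × CExp)
  | .cons (.str s) (.cons (.loc l) (.cons q .null)) =>
    match Tag.ofString s with
    | some .val => some (.val, l, q)
    | some .loc => some (.loc, l, q)
    | _ => none
  | _ => none

/-- The machine expression in the focus of an output value. -/
def reconC (v : CExp) : Option DExp :=
  match storeEntry? v with
  | some (.loc, l, _) => some (.loc l)
  | some (_, _, q) => unquo q
  | none => unquo v

/-- The store described by a sequence of output values: for each location its last entry. -/
def reconS : List CExp → Option DStore
  | [] => some []
  | .cons a _ :: vs => do
    let σ ← reconS vs
    match storeEntry? a with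
    | some (_, l, q) =>
      match σ.lookup l with
      | none => some ((l, ← unquo q) :: σ)
      | some _ => some σ
    | none => some σ
  | _ => none

/-- The CS states described by the output values `vs`, which follow the output values `past`. -/
def reconFrom (past : List CExp) : List CExp → Option (List CSState)
  | [] => some []
  | .cons a ms :: vs => do
    let C ← reconE ms (← reconC a)
    let σ ← reconS (past ++ [.cons a ms])
    let rest ← reconFrom (past ++ [.cons a ms]) vs
    some (⟨C, σ⟩ :: rest)
  | _ => none

/-- Reconstruction of a sequence of CS states from a sequence of output values. -/
def recon (vs : List CExp) : Option (List CSState) := reconFrom [] vs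

/-! ## The stepper -/

/-- The stepper displays the sequence `ds` for the program `e`: the program is expanded and
annotated, the annotated program is run for some number `k` of transitions, plain Racket states are
reconstructed from the output, and each is synthesized into a Lazy Racket expression; the program
itself and these expressions are displayed. -/
def Displays (new : CStore → Loc) (e : Exp) (ds : List Exp) : Prop :=
  ∃ (k : ℕ) (states : List CSState) (es : List Exp),
    recon (trace new k (start (anno (expand e)))) = some states ∧
    List.Forall₂ Synth states es ∧
    ds = e :: es

end LazyStepper

namespace LazyStepper

/-! ## Expanded programs with locations -/

-- The locations of the machine serve as labels. A forest `τ` assigns a labeled tree to every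
-- location; `DExp.lift` replaces locations by their trees, and `Stack.tree` turns the stack into an
-- evaluation context around the result. A tree is labeled with its own location or, if the location
-- merely holds another location, it is the tree of that one: the machine allocates at every
-- evaluation of `cons`, whereas λLR leaves a `cons` with labeled components alone. All occurrences
-- of a label carry the same tree (`Consistent`). As trees are finite, none contains its own label
-- properly inside (`Consistent.notMem_labels`), so a location is never forced during its own
-- evaluation.
--
-- Suppose that a redex contracts and that `l` is the nearest label around it. If `a` is the new
-- expression under `l`, the new forest is obtained by applying `LExp.update l a` to every tree, and
-- this is exactly the shared step of λLR (`Forest.lrStep`). Meanwhile the store entries of the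
-- locations under evaluation are stale; their current contents are found in the stack. Synthesis
-- makes up for this in the same way: working outward from the hole, it records the partial result
-- for `l` when it leaves `forceAt l`, before it visits the siblings in the outer frames
-- (`Stack.synthS_ctl`). Hence a reconstructed state is displayed as the program given by stack and
-- forest, with its labels erased (`Forest.synth`).
--
-- The continuation marks determine the control string (`Stack.WF.reconE`), and the outputs
-- determine the store (`reconS_append_entry`, `Sync`). An induction on the number of transitions
-- treats simultaneously the configurations that evaluate an expression, return a value and force a
-- value (`simulation`). Application, primitives, projections, conditionals and the labeling of a
-- `cons` each cost one λLR step; delaying, forcing and completing a delayed computation leave the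
-- labeled program as it is.

/-- Expansions of Lazy Racket expressions with free variables in `B`, in which locations from `D`
may have been substituted for variables. -/
inductive Lazy (D : Set Loc) : List Var → DExp → Prop
  | num {B} (n) : Lazy D B (.num n)
  | str {B} (s) : Lazy D B (.str s)
  | bool {B} (b) : Lazy D B (.bool b)
  | null {B} : Lazy D B .null
  | var {B x} : x ∈ B → Lazy D B (.var x)
  | loc {B l} : l ∈ D → Lazy D B (.loc l)
  | lam {B x d} : Lazy D (x :: B) d → Lazy D B (.lam x d)
  | app {B d₁ d₂} : Lazy D B d₁ → Lazy D B d₂ → Lazy D B (.app (.force d₁) (.delay d₂))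
  | prim2 {B d₁ d₂} (p) : Lazy D B d₁ → Lazy D B d₂ →
      Lazy D B (.prim2 p (.force d₁) (.force d₂))
  | cons {B d₁ d₂} : Lazy D B d₁ → Lazy D B d₂ → Lazy D B (.cons (.delay d₁) (.delay d₂))
  | prim1 {B d} (p) : Lazy D B d → Lazy D B (.prim1 p (.force d))
  | ite {B d₁ d₂ d₃} : Lazy D B d₁ → Lazy D B d₂ → Lazy D B d₃ →
      Lazy D B (.ite (.force d₁) d₂ d₃)

/-- Values of expanded programs. -/
inductive Val (D : Set Loc) : DExp → Prop
  | num (n) : Val D (.num n)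
  | str (s) : Val D (.str s)
  | bool (b) : Val D (.bool b)
  | null : Val D .null
  | loc {l} : l ∈ D → Val D (.loc l)
  | lam {x d} : Lazy D [x] d → Val D (.lam x d)
  | cons {l₁ l₂} : l₁ ∈ D → l₂ ∈ D → Val D (.cons (.loc l₁) (.loc l₂))

/-- Substitution of a location for a variable. -/
def DExp.substLoc (x : Var) (l : Loc) : DExp → DExp
  | .num n => .num n
  | .str s => .str s
  | .bool b => .bool b
  | .null => .null
  | .var y => if y = x then .loc l else .var y
  | .loc l' => .loc l'
  | .lam y e => if y = x then .lam y e else .lam y (substLoc x l e)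
  | .app e₁ e₂ => .app (substLoc x l e₁) (substLoc x l e₂)
  | .prim2 p e₁ e₂ => .prim2 p (substLoc x l e₁) (substLoc x l e₂)
  | .cons e₁ e₂ => .cons (substLoc x l e₁) (substLoc x l e₂)
  | .prim1 p e => .prim1 p (substLoc x l e)
  | .ite e₁ e₂ e₃ => .ite (substLoc x l e₁) (substLoc x l e₂) (substLoc x l e₃)
  | .delay e => .delay (substLoc x l e)
  | .force e => .force (substLoc x l e)
  | .forceAt l' e => .forceAt l' (substLoc x l e)

/-- The expression is not a location. -/
def DExp.NotLoc : DExp → Prop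
  | .loc _ => False
  | _ => True

theorem Lazy.mono {D D' : Set Loc} {B d} (h : Lazy D B d) (hD : D ⊆ D') : Lazy D' B d := by
  induction h with
  | var h => exact .var h
  | loc h => exact .loc (hD h)
  | _ => constructor <;> assumption

theorem Val.mono {D D' : Set Loc} {v} (h : Val D v) (hD : D ⊆ D') : Val D' v := by
  cases h with
  | loc h => exact .loc (hD h)
  | lam h => exact .lam (h.mono hD)
  | cons h₁ h₂ => exact .cons (hD h₁) (hD h₂)
  | _ => constructor

theorem lazy_expand (D : Set Loc) (e : Exp) : ∀ B : List Var, (∀ x ∈ e.freeVars, x ∈ B) →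
    Lazy D B (expand e) := by
  induction e with
  | lam x e ih =>
    intro B h
    refine .lam (ih _ fun y hy => ?_)
    by_cases hyx : y = x
    · simp [hyx]
    · exact List.mem_cons_of_mem _ (h y (by simp [Exp.freeVars, hyx, hy]))
  | var x => intro B h; exact .var (h x (by simp [Exp.freeVars]))
  | app e₁ e₂ ih₁ ih₂ | prim2 p e₁ e₂ ih₁ ih₂ | cons e₁ e₂ ih₁ ih₂ =>
    intro B h
    constructor
    · exact ih₁ _ fun x hx => h x (by simp [Exp.freeVars, hx])
    · exact ih₂ _ fun x hx => h x (by simp [Exp.freeVars, hx])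
  | prim1 p e ih => intro B h; exact .prim1 _ (ih _ h)
  | ite e₁ e₂ e₃ ih₁ ih₂ ih₃ =>
    intro B h
    constructor
    · exact ih₁ _ fun x hx => h x (by simp [Exp.freeVars, hx])
    · exact ih₂ _ fun x hx => h x (by simp [Exp.freeVars, hx])
    · exact ih₃ _ fun x hx => h x (by simp [Exp.freeVars, hx])
  | _ => intros; constructor

theorem Lazy.weaken {D : Set Loc} {B B' d} (h : Lazy D B d) (hB : ∀ x ∈ B, x ∈ B') :
    Lazy D B' d := by
  induction h generalizing B' with
  | var h => exact .var (hB _ h)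
  | loc h => exact .loc h
  | lam _ ih =>
    refine .lam (ih fun y hy => ?_)
    rcases List.mem_cons.1 hy with rfl | hy
    · simp
    · exact List.mem_cons_of_mem _ (hB _ hy)
  | app _ _ ih₁ ih₂ => exact .app (ih₁ hB) (ih₂ hB)
  | prim2 p _ _ ih₁ ih₂ => exact .prim2 p (ih₁ hB) (ih₂ hB)
  | cons _ _ ih₁ ih₂ => exact .cons (ih₁ hB) (ih₂ hB)
  | prim1 p _ ih => exact .prim1 p (ih hB)
  | ite _ _ _ ih₁ ih₂ ih₃ => exact .ite (ih₁ hB) (ih₂ hB) (ih₃ hB)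
  | _ => constructor

/-- Operands are always delayed, so an application of the machine substitutes a location, and the
body stays in `Lazy`. Under a binder for `x` itself the substitution stops, and weakening suffices.
-/
theorem Lazy.substLoc {D : Set Loc} {B d} (h : Lazy D B d) {B' : List Var} {x : Var} {l : Loc}
    (hB : ∀ y ∈ B, y = x ∨ y ∈ B') (hl : l ∈ D) : Lazy D B' (d.substLoc x l) := by
  induction h generalizing B' with
  | @var B y h =>
    by_cases hyx : y = x
    · simpa [DExp.substLoc, hyx] using .loc hl
    · simpa [DExp.substLoc, hyx] using .var ((hB y h).resolve_left hyx)
  | loc h => exact .loc h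
  | @lam B y d hd ih =>
    by_cases hyx : y = x
    · simp only [DExp.substLoc, hyx, if_true]
      subst hyx
      refine .lam (hd.weaken fun z hz => ?_)
      rcases List.mem_cons.1 hz with rfl | hz
      · simp
      · rcases hB z hz with rfl | h <;> simp_all
    · simp only [DExp.substLoc, hyx, if_false]
      refine .lam (ih fun z hz => ?_)
      rcases List.mem_cons.1 hz with rfl | hz
      · simp
      · rcases hB z hz with rfl | h <;> simp_all
  | app _ _ ih₁ ih₂ => exact .app (ih₁ hB) (ih₂ hB)
  | prim2 p _ _ ih₁ ih₂ => exact .prim2 p (ih₁ hB) (ih₂ hB)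
  | cons _ _ ih₁ ih₂ => exact .cons (ih₁ hB) (ih₂ hB)
  | prim1 p _ ih => exact .prim1 p (ih hB)
  | ite _ _ _ ih₁ ih₂ ih₃ => exact .ite (ih₁ hB) (ih₂ hB) (ih₃ hB)
  | _ => constructor

/-! ## Quotation and annotation -/

open CExp (list letIn)

@[simp] theorem Tag.ofString_string (t : Tag) : Tag.ofString t.string = some t := by
  rcases t with p | p | _ | _ | _ | _ | _ | _ | _ | _ | _ | _ | _ | _ | _ | _ | _ | _ | _ <;>
    try cases p
  all_goals rfl

/-- The value of the annotated program that stands for a value of the expanded program. -/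
def valC : DExp → CExp
  | .cons a b => .cons (valC a) (valC b)
  | d => anno d

-- Temporaries and source variables are different constructors of `Name`. Quotations contain no
-- temporaries and annotations bind all of theirs, so nested annotations can reuse the same few
-- names.
@[simp] theorem subst_tmp_quo (k : ℕ) (a : CExp) (B : List Var) (d : DExp) :
    CExp.subst (.tmp k) a (quo B d) = quo B d := by
  induction d generalizing B with
  | var x =>
    by_cases h : x ∈ B <;> simp [quo, h, list, CExp.subst, Tag.exp, quoVar]
  | _ => simp_all [quo, list, CExp.subst, Tag.exp]

@[simp] theorem subst_tmp_anno (k : ℕ) (a : CExp) (d : DExp) :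
    CExp.subst (.tmp k) a (anno d) = anno d := by
  induction d with
  | app e₁ e₂ ih₁ ih₂ | prim2 p e₁ e₂ ih₁ ih₂  | cons e₁ e₂ ih₁ ih₂ =>
    simp only [anno, emitIf]
    try split_ifs
    all_goals (simp [emit, letIn, list, CExp.subst, Tag.exp, quoVar, ih₁, ih₂]; grind)
  | ite e₁ e₂ e₃ ih₁ ih₂ ih₃ =>
    simp only [anno, emitIf]
    split_ifs <;> simp [emit, letIn, list, CExp.subst, Tag.exp, ih₁, ih₂, ih₃] <;> grind
  | prim1 p e ih =>
    simp only [anno, emitIf]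
    split_ifs <;> simp [emit, letIn, list, CExp.subst, Tag.exp, quoVar, ih] <;> grind
  | lam x e ih => simp [anno, emit, letIn, CExp.subst, ih]
  | force e ih => simp [anno, emit, letIn, list, CExp.subst, Tag.exp, quoVar, ih, CExp.not]; grind
  | delay e ih => simp [anno, emit, letIn, list, CExp.subst, Tag.exp, quoVar, ih]; grind
  | forceAt l e ih => simp [anno, ih]
  | _ => simp [anno, CExp.subst]

/-- A variable bound outside the quotation is quoted by its run-time value, so substituting before
or after quoting is the same. A variable in `B` is quoted as a string, which no substitution
reaches. -/
theorem subst_src_quo (x : Var) (l : Loc) (B : List Var) (d : DExp) :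
    CExp.subst (.src x) (.loc l) (quo B d) = quo B (if x ∈ B then d else d.substLoc x l) := by
  induction d generalizing B with
  | var y =>
    by_cases h : y ∈ B <;> by_cases hx : x ∈ B <;> by_cases hy : y = x <;>
      simp_all [quo, list, CExp.subst, Tag.exp, quoVar, DExp.substLoc]
  | lam y d ih =>
    have hy' : x = y ↔ y = x := eq_comm
    by_cases hx : x ∈ B <;> by_cases hy : y = x <;>
      simp [quo, list, CExp.subst, Tag.exp, DExp.substLoc, ih, hx, hy, hy']
  | _ => by_cases hx : x ∈ B <;> simp_all [quo, list, CExp.subst, Tag.exp, DExp.substLoc]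

/-- This depends on `Lazy`: `isAtom` holds for a variable but not for a location put in its place,
so in general a substitution could change which redexes are output. In an expansion the operands
concerned are `force` or `delay` expressions, never atoms. -/
theorem Lazy.subst_src_anno {D : Set Loc} {B d} (h : Lazy D B d) (x : Var) (l : Loc) :
    CExp.subst (.src x) (.loc l) (anno d) = anno (d.substLoc x l) := by
  induction h with
  | @var B y h => by_cases hy : y = x <;> simp [anno, CExp.subst, DExp.substLoc, hy]
  | @lam B y d hd ih =>
    by_cases hy : y = x <;>
      simp [anno, CExp.subst, DExp.substLoc, hy, emit, letIn, ih, subst_src_quo]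
  | app _ _ ih₁ ih₂ | prim2 p _ _ ih₁ ih₂ | cons _ _ ih₁ ih₂ =>
    simp [anno, CExp.subst, DExp.substLoc, emit, letIn, ih₁, ih₂, subst_src_quo, list, Tag.exp,
      quoVar, emitIf, isAtom, CExp.not]
  | prim1 p _ ih =>
    simp [anno, CExp.subst, DExp.substLoc, emit, letIn, ih, list, Tag.exp,
      quoVar, emitIf, isAtom, CExp.not]
  | ite _ _ _ ih₁ ih₂ ih₃ =>
    simp [anno, CExp.subst, DExp.substLoc, emit, letIn, ih₁, ih₂, ih₃, subst_src_quo, list, Tag.exp,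
      quoVar, emitIf, isAtom, CExp.not]
  | _ => simp [anno, CExp.subst, DExp.substLoc]

@[simp] theorem subst_tmp_valC (k : ℕ) (a : CExp) (d : DExp) :
    CExp.subst (.tmp k) a (valC d) = valC d := by
  induction d with
  | cons d₁ d₂ ih₁ ih₂ => simp [valC, CExp.subst, ih₁, ih₂]
  | _ => simp only [valC, subst_tmp_anno]

theorem Lazy.isValue_quo {D : Set Loc} {B d} (h : Lazy D B d) : (quo B d).isValue = true := by
  induction h with
  | _ => simp_all [quo, list, Tag.exp, CExp.isValue]

theorem Lazy.unquo_quo {D : Set Loc} {B d} (h : Lazy D B d) : unquo (quo B d) = some d := by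
  induction h with
  | _ => simp_all [quo, list, Tag.exp, unquo, unquoValue]

theorem Val.isValue_valC {D : Set Loc} {v} (h : Val D v) : (valC v).isValue = true := by
  cases h <;> simp [valC, anno, CExp.isValue]

theorem Val.isValue {D : Set Loc} {v} (h : Val D v) : v.isValue = true := by
  cases h <;> simp [DExp.isValue]

/-- An abstraction can be read back because the outermost `let` in its annotated body binds the
quotation of its own source. -/
theorem Val.unquoValue_valC {D : Set Loc} {v} (h : Val D v) : unquoValue (valC v) = some v := by
  cases h with
  | lam h => simp [valC, anno, letIn, unquoValue, (Lazy.lam h).unquo_quo]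
  | _ => simp [valC, anno, unquoValue]

/-! ## Labeled trees of locations -/

/-- The labeled expression that an expression stands for, if `τ l` is that of the location `l`. -/
def DExp.lift (τ : Loc → LExp) : DExp → LExp
  | .num n => .num n
  | .str s => .str s
  | .bool b => .bool b
  | .null => .null
  | .var x => .var x
  | .loc l => τ l
  | .lam x e => .lam x (e.lift τ)
  | .app e₁ e₂ => .app (e₁.lift τ) (e₂.lift τ)
  | .prim2 p e₁ e₂ => .prim2 p (e₁.lift τ) (e₂.lift τ)
  | .cons e₁ e₂ => .cons (e₁.lift τ) (e₂.lift τ)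
  | .prim1 p e => .prim1 p (e.lift τ)
  | .ite e₁ e₂ e₃ => .ite (e₁.lift τ) (e₂.lift τ) (e₃.lift τ)
  | .delay e => e.lift τ
  | .force e => e.lift τ
  | .forceAt _ e => e.lift τ

/-- All locations are in `D`, and none is under evaluation. -/
def Scoped (D : Set Loc) : DExp → Prop
  | .num _ | .str _ | .bool _ | .null | .var _ => True
  | .loc l => l ∈ D
  | .lam _ e | .prim1 _ e | .delay e | .force e => Scoped D e
  | .app e₁ e₂ | .prim2 _ e₁ e₂ | .cons e₁ e₂ => Scoped D e₁ ∧ Scoped D e₂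
  | .ite e₁ e₂ e₃ => Scoped D e₁ ∧ Scoped D e₂ ∧ Scoped D e₃
  | .forceAt _ _ => False

theorem Lazy.scoped {D : Set Loc} {B d} (h : Lazy D B d) : Scoped D d := by
  induction h <;> simp_all [Scoped]

theorem Val.scoped {D : Set Loc} {v} (h : Val D v) : Scoped D v := by
  cases h with
  | lam h => exact h.scoped
  | _ => simp_all [Scoped]

/-- Every labeled subexpression is the tree of its label. -/
def Consistent (τ : Loc → LExp) (D : Set Loc) : LExp → Prop
  | .num _ | .str _ | .bool _ | .null | .var _ => True
  | .lam _ e | .prim1 _ e => Consistent τ D e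
  | .app e₁ e₂ | .prim2 _ e₁ e₂ | .cons e₁ e₂ => Consistent τ D e₁ ∧ Consistent τ D e₂
  | .ite e₁ e₂ e₃ => Consistent τ D e₁ ∧ Consistent τ D e₂ ∧ Consistent τ D e₃
  | .lab l e => (l ∈ D ∧ τ l = .lab l e) ∧ Consistent τ D e

/-- Substitution has no effect. -/
def LExp.Closed (t : LExp) : Prop := ∀ x a, LExp.subst x a t = t

namespace Consistent

variable {τ τ' : Loc → LExp} {D D' : Set Loc} {t a : LExp} {l : Loc}

/-- Consistency makes `τ l` a subterm wherever `l` occurs. -/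
theorem sizeOf_le (h : Consistent τ D t) (hl : l ∈ t.labels) : sizeOf (τ l) ≤ sizeOf t := by
  induction t with
  | lab l' e ih =>
    simp only [LExp.labels, Finset.mem_insert] at hl
    rcases hl with rfl | hl
    · rw [h.1.2]
    · have := ih h.2 hl
      simp only [LExp.lab.sizeOf_spec]
      omega
  | lam x e ih | prim1 p e ih =>
    have := ih h hl
    simp
    omega
  | app e₁ e₂ ih₁ ih₂ | prim2 p e₁ e₂ ih₁ ih₂ | cons e₁ e₂ ih₁ ih₂ =>
    rcases Finset.mem_union.1 hl with hl | hl
    · have := ih₁ h.1 hl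
      simp
      omega
    · have := ih₂ h.2 hl
      simp
      omega
  | ite e₁ e₂ e₃ ih₁ ih₂ ih₃ =>
    simp only [LExp.labels, Finset.mem_union] at hl
    rcases hl with (hl | hl) | hl
    · have := ih₁ h.1 hl
      simp
      omega
    · have := ih₂ h.2.1 hl
      simp
      omega
    · have := ih₃ h.2.2 hl
      simp
      omega
  | _ => simp [LExp.labels] at hl

/-- Otherwise `.lab l t`, which is `τ l`, would be no larger than `t`. This excludes cyclic sharing.
-/
theorem notMem_labels (h : Consistent τ D (.lab l t)) : l ∉ t.labels := fun hl => by
  have := h.2.sizeOf_le hl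
  rw [h.1.2] at this
  simp at this

theorem mem_dom (h : Consistent τ D t) (hl : l ∈ t.labels) : l ∈ D := by
  induction t with
  | lab l' e ih =>
    simp only [LExp.labels, Finset.mem_insert] at hl
    rcases hl with rfl | hl
    · exact h.1.1
    · exact ih h.2 hl
  | _ => (simp only [LExp.labels, Finset.mem_union, Consistent] at hl h; grind)

theorem congr (h : Consistent τ D t) (hτ : ∀ l ∈ D, τ' l = τ l) (hD : D ⊆ D') :
    Consistent τ' D' t := by
  induction t with
  | lab l e ih => exact ⟨⟨hD h.1.1, (hτ _ h.1.1).trans h.1.2⟩, ih h.2⟩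
  | _ => simp only [Consistent] at h ⊢ <;> grind

theorem lift (hτ : ∀ l ∈ D, Consistent τ D (τ l)) {d : DExp} (hd : Scoped D d) :
    Consistent τ D (d.lift τ) := by
  induction d with
  | loc l => exact hτ l hd
  | forceAt => exact hd.elim
  | _ => simp only [Scoped, DExp.lift, Consistent] at hd ⊢ <;> grind

end Consistent

-- Parallel update and substitution on trees.

theorem update_of_notMem {l : Label} {a t : LExp} (h : l ∉ t.labels) : LExp.update l a t = t := by
  induction t with
  | _ => simp only [LExp.labels, Finset.mem_union, Finset.mem_insert, LExp.update] at h ⊢ <;> grind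

/-- Every label of `d.lift τ` comes from the tree of some location. Updating all copies in a program
therefore amounts to updating the forest. -/
theorem lift_update (τ : Loc → LExp) (l : Label) (a : LExp) (d : DExp) :
    d.lift (fun l' => LExp.update l a (τ l')) = LExp.update l a (d.lift τ) := by
  induction d with
  | _ => simp_all [DExp.lift, LExp.update]

theorem lift_congr {τ τ' : Loc → LExp} {D : Set Loc} (h : ∀ l ∈ D, τ' l = τ l) {d : DExp}
    (hd : Scoped D d) : d.lift τ' = d.lift τ := by
  induction d with
  | loc l => exact h l hd
  | forceAt => exact hd.elim
  | _ => simp_all [DExp.lift, Scoped]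

/-- The trees of the labels in `a` are subterms of `a`; they do not contain `l`, and the update
leaves them alone. -/
theorem Consistent.update_self {τ : Loc → LExp} {D : Set Loc} {a b : LExp} {l : Loc}
    (h : Consistent τ D a) (hl : l ∉ a.labels) :
    Consistent (fun l' => LExp.update l b (τ l')) D a := by
  induction a with
  | lab l' e ih =>
    simp only [LExp.labels, Finset.mem_insert, not_or] at hl
    refine ⟨⟨h.1.1, ?_⟩, ih h.2 hl.2⟩
    simp only [h.1.2]
    exact update_of_notMem (by simpa [LExp.labels] using hl)
  | _ => simp only [Consistent, LExp.labels, Finset.mem_union] at h hl ⊢ <;> grind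

/-- At the label `l` the term and the forest receive the same new subtree `a`, which is consistent
by `ha`; at any other label the update passes below the label on both sides. -/
theorem Consistent.update {τ : Loc → LExp} {D : Set Loc} {a t : LExp} {l : Loc}
    (h : Consistent τ D t) (ha : Consistent (fun l' => LExp.update l a (τ l')) D a) :
    Consistent (fun l' => LExp.update l a (τ l')) D (LExp.update l a t) := by
  induction t with
  | lab l' e ih =>
    by_cases hl : l' = l
    · subst hl
      simp only [LExp.update, if_true]
      refine ⟨⟨h.1.1, ?_⟩, ha⟩
      simp only [h.1.2, LExp.update, if_true]
    · simp only [LExp.update, hl, if_false]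
      refine ⟨⟨h.1.1, ?_⟩, ih h.2⟩
      simp only [h.1.2, LExp.update, hl, if_false]
  | _ => simp only [Consistent, LExp.update] at h ⊢ <;> grind

theorem LExp.Closed.update {t a : LExp} {l : Label} (h : t.Closed) (ha : a.Closed) :
    (LExp.update l a t).Closed := by
  intro x b
  replace h := h x b
  induction t with
  | lab l' e ih =>
    by_cases hl : l' = l
    · simp [LExp.update, hl, LExp.subst, ha x b]
    · simp only [LExp.subst, LExp.lab.injEq, true_and] at h
      simp [LExp.update, hl, LExp.subst, ih h]
  | lam y e ih =>
    by_cases hy : y = x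
    · simp [LExp.update, LExp.subst, hy]
    · simp only [LExp.subst, hy, if_false, LExp.lam.injEq, true_and] at h
      simp [LExp.update, LExp.subst, hy, ih h]
  | var y => simpa [LExp.update] using h
  | _ => simp_all [LExp.update, LExp.subst]

theorem LExp.IsLabeled.update {t a : LExp} {l : Label} (h : t.IsLabeled) :
    (LExp.update l a t).IsLabeled := by
  cases t with
  | lab l' e => by_cases hl : l' = l <;> simp [LExp.update, hl, LExp.IsLabeled]
  | _ => exact h.elim

theorem labels_subst (x : Var) (a t : LExp) : (LExp.subst x a t).labels ⊆ t.labels ∪ a.labels := by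
  intro l
  induction t with
  | var y => by_cases hy : y = x <;> simp [LExp.subst, hy, LExp.labels]
  | lam y e ih =>
    by_cases hy : y = x
    · simp only [LExp.subst, hy, if_true, LExp.labels, Finset.mem_union]
      exact Or.inl
    · simpa only [LExp.subst, hy, if_false, LExp.labels] using ih
  | _ =>
    simp only [LExp.subst, LExp.labels, Finset.mem_union, Finset.mem_insert] at *
    grind

/-- Trees of locations are closed, so substitution acts only on the variables of `d` itself. This
matches β of the machine, which inserts a location, with β of λLR, which inserts a labeled
expression. -/
theorem lift_substLoc {τ : Loc → LExp} {D : Set Loc} (hτ : ∀ l ∈ D, (τ l).Closed) {d : DExp}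
    (hd : Scoped D d) (x : Var) (l : Loc) :
    (d.substLoc x l).lift τ = LExp.subst x (τ l) (d.lift τ) := by
  induction d with
  | var y => by_cases hy : y = x <;> simp [DExp.substLoc, DExp.lift, LExp.subst, hy]
  | lam y e ih =>
    by_cases hy : y = x
    · simp [DExp.substLoc, DExp.lift, LExp.subst, hy]
    · simp [DExp.substLoc, DExp.lift, LExp.subst, hy, ih hd]
  | loc l' => exact (hτ l' hd _ _).symm
  | forceAt => exact hd.elim
  | _ => simp_all [DExp.substLoc, DExp.lift, LExp.subst, Scoped]

theorem Lazy.subst_lift {τ : Loc → LExp} {D : Set Loc} (hτ : ∀ l ∈ D, (τ l).Closed)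
    {B d} (h : Lazy D B d) {x : Var} (hx : x ∉ B) (a : LExp) :
    LExp.subst x a (d.lift τ) = d.lift τ := by
  induction h with
  | @var B y hy =>
    have : y ≠ x := fun h => hx (h ▸ hy)
    simp [DExp.lift, LExp.subst, this]
  | loc h => exact hτ _ h _ _
  | @lam B y d _ ih =>
    by_cases hy : y = x
    · simp [DExp.lift, LExp.subst, hy]
    · simp [DExp.lift, LExp.subst, hy, ih (by simp [hx, Ne.symm hy])]
  | _ => simp_all [DExp.lift, LExp.subst]

theorem Lazy.closed_lift {τ : Loc → LExp} {D : Set Loc} (hτ : ∀ l ∈ D, (τ l).Closed) {d}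
    (h : Lazy D [] d) : (d.lift τ).Closed := fun _ a => h.subst_lift hτ (by simp) a

-- Sequences of labels and values under them.

theorem unlabel_wrap (ls : List Label) (t : LExp) : (LExp.wrap ls t).unlabel = t.unlabel := by
  induction ls with
  | nil => rfl
  | cons l ls ih => exact ih

theorem labels_wrap (ls : List Label) (t : LExp) : t.labels ⊆ (LExp.wrap ls t).labels := by
  induction ls with
  | nil => rfl
  | cons l ls ih => exact ih.trans (Finset.subset_insert _ _)

theorem wrap_append (ls ls' : List Label) (t : LExp) :
    LExp.wrap (ls ++ ls') t = LExp.wrap ls (LExp.wrap ls' t) := by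
  simp [LExp.wrap]

theorem isValue_wrap {t : LExp} (h : t.IsValue) (ls : List Label) : (LExp.wrap ls t).IsValue := by
  induction ls with
  | nil => exact h
  | cons l ls ih => exact .lab _ _ ih

theorem Consistent.of_wrap {τ : Loc → LExp} {D : Set Loc} {ls : List Label} {t : LExp}
    (h : Consistent τ D (LExp.wrap ls t)) : Consistent τ D t := by
  induction ls with
  | nil => exact h
  | cons l ls ih => exact ih h.2

/-- The components of a pair are locations with labeled trees, as λLR demands of a `cons` value. A
bare location is excluded because its tree may be unevaluated. -/
theorem Val.isValue_lift {τ : Loc → LExp} {D : Set Loc} (hτ : ∀ l ∈ D, (τ l).IsLabeled) {v : DExp}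
    (hv : Val D v) (hl : v.NotLoc) : (v.lift τ).IsValue := by
  cases hv with
  | loc => exact hl.elim
  | @cons l₁ l₂ h₁ h₂ =>
    have h₁ := hτ l₁ h₁
    have h₂ := hτ l₂ h₂
    simp only [DExp.lift]
    cases hl₁ : τ l₁ <;> simp only [hl₁, LExp.IsLabeled] at h₁
    cases hl₂ : τ l₂ <;> simp only [hl₂, LExp.IsLabeled] at h₂
    constructor
  | _ => constructor

/-! ## Stacks -/

/-- The frames of a lazy evaluation. The argument of each is being forced. The value in the frame
`prim2R` stands for a tree in which it is under the labels `ls`. -/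
inductive OpFrame where
  | app (d : DExp)
  | prim2L (p : P2) (d : DExp)
  | prim2R (p : P2) (v : DExp) (ls : List Label)
  | prim1 (p : P1)
  | ite (d₂ d₃ : DExp)

namespace OpFrame

/-- The control string in a frame. -/
def ctl : OpFrame → DExp → DExp
  | .app d, C => .app C (.delay d)
  | .prim2L p d, C => .prim2 p C (.force d)
  | .prim2R p v _, C => .prim2 p v C
  | .prim1 p, C => .prim1 p C
  | .ite d₂ d₃, C => .ite C d₂ d₃

/-- The labeled expression in a frame. -/
def tree (τ : Loc → LExp) : OpFrame → LExp → LExp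
  | .app d, t => .app t (d.lift τ)
  | .prim2L p d, t => .prim2 p t (d.lift τ)
  | .prim2R p v ls, t => .prim2 p (LExp.wrap ls (v.lift τ)) t
  | .prim1 p, t => .prim1 p t
  | .ite d₂ d₃, t => .ite t (d₂.lift τ) (d₃.lift τ)

/-- The left operand in `prim2R` has been forced and is not a location; this makes its tree a value,
as an evaluation context of λLR requires. -/
def WF (D : Set Loc) : OpFrame → Prop
  | .app d | .prim2L _ d => Lazy D [] d
  | .prim2R _ v _ => Val D v ∧ v.NotLoc
  | .prim1 _ => True
  | .ite d₂ d₃ => Lazy D [] d₂ ∧ Lazy D [] d₃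

end OpFrame

/-- A stack, innermost frame first. With a frame comes the location under evaluation if its
argument is one, and the labels around that location. -/
abbrev Stack := List (OpFrame × Option (List Label × Loc))

namespace Stack

/-- The control string in a stack. -/
def ctl : Stack → DExp → DExp
  | [], C => C
  | (F, none) :: K, C => ctl K (F.ctl (.force C))
  | (F, some (_, l)) :: K, C => ctl K (F.ctl (.force (.forceAt l C)))

/-- The labeled expression in a stack. -/
def tree (τ : Loc → LExp) : Stack → LExp → LExp
  | [], t => t
  | (F, none) :: K, t => tree τ K (F.tree τ t)
  | (F, some (ls, l)) :: K, t => tree τ K (F.tree τ (LExp.wrap ls (.lab l t)))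

/-- The locations under evaluation. -/
def locs : Stack → Set Loc
  | [] => ∅
  | (_, none) :: K => locs K
  | (_, some (_, l)) :: K => insert l (locs K)

def WF (D : Set Loc) (K : Stack) : Prop := ∀ f ∈ K, f.1.WF D

/-- No location is under evaluation. -/
def Unlabeled (K : Stack) : Prop := ∀ f ∈ K, f.2 = none

end Stack

theorem OpFrame.WF.mono {D D' : Set Loc} {F : OpFrame} (h : F.WF D) (hD : D ⊆ D') : F.WF D' := by
  cases F with
  | app | prim2L => exact Lazy.mono h hD
  | prim2R => exact ⟨h.1.mono hD, h.2⟩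
  | prim1 => trivial
  | ite => exact ⟨h.1.mono hD, h.2.mono hD⟩

theorem Stack.WF.mono {D D' : Set Loc} {K : Stack} (h : K.WF D) (hD : D ⊆ D') : K.WF D' :=
  fun f hf => (h f hf).mono hD

theorem OpFrame.tree_congr {τ τ' : Loc → LExp} {D : Set Loc} (h : ∀ l ∈ D, τ' l = τ l)
    {F : OpFrame} (hF : F.WF D) (t : LExp) : F.tree τ' t = F.tree τ t := by
  cases F with
  | app | prim2L => simp [tree, lift_congr h hF.scoped]
  | prim2R => simp [tree, lift_congr h hF.1.scoped]
  | prim1 => rfl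
  | ite => simp [tree, lift_congr h hF.1.scoped, lift_congr h hF.2.scoped]

theorem Stack.tree_congr {τ τ' : Loc → LExp} {D : Set Loc} (h : ∀ l ∈ D, τ' l = τ l)
    {K : Stack} (hK : K.WF D) (t : LExp) : K.tree τ' t = K.tree τ t := by
  induction K generalizing t with
  | nil => rfl
  | cons f K ih =>
    have hf := OpFrame.tree_congr h (hK f (by simp))
    have hK' : Stack.WF D K := fun g hg => hK g (by simp [hg])
    rcases f with ⟨F, _ | ⟨ls, l⟩⟩ <;> simp only [tree, ih hK', hf]

theorem Stack.tree_append (τ : Loc → LExp) (K K' : Stack) (t : LExp) :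
    Stack.tree τ (K ++ K') t = Stack.tree τ K' (Stack.tree τ K t) := by
  induction K generalizing t with
  | nil => rfl
  | cons f K ih => rcases f with ⟨F, _ | ⟨ls, l⟩⟩ <;> simp [tree, ih]

/-- Predicates that hold for an expression if and only if they hold for its parts. -/
structure Compositional (P : LExp → Prop) : Prop where
  app : ∀ a b, P (.app a b) ↔ P a ∧ P b
  prim2 : ∀ p a b, P (.prim2 p a b) ↔ P a ∧ P b
  prim1 : ∀ p a, P (.prim1 p a) ↔ P a
  ite : ∀ a b c, P (.ite a b c) ↔ P a ∧ P b ∧ P c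

theorem compositional_consistent (τ : Loc → LExp) (D : Set Loc) :
    Compositional (Consistent τ D) := by
  constructor <;> intros <;> rfl

theorem compositional_closed : Compositional LExp.Closed := by
  constructor <;> intros <;> simp only [LExp.Closed, LExp.subst, LExp.app.injEq, LExp.prim2.injEq,
    LExp.prim1.injEq, LExp.ite.injEq, true_and, forall_and]

theorem compositional_notMem (l : Label) : Compositional fun t => l ∉ t.labels := by
  constructor <;> intros <;> simp [LExp.labels]

theorem Compositional.of_frame {P : LExp → Prop} (hP : Compositional P) {τ : Loc → LExp}
    {F : OpFrame} {t : LExp} (h : P (F.tree τ t)) : P t := by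
  cases F <;> simp only [OpFrame.tree, hP.app, hP.prim2, hP.prim1, hP.ite] at h
  all_goals first | exact h | exact h.1 | exact h.2

theorem Compositional.frame {P : LExp → Prop} (hP : Compositional P) {τ : Loc → LExp}
    {F : OpFrame} {t t' : LExp} (h : P (F.tree τ t)) (h' : P t') : P (F.tree τ t') := by
  cases F <;> simp only [OpFrame.tree, hP.app, hP.prim2, hP.prim1, hP.ite] at h ⊢ <;> tauto

theorem Compositional.of_stack {P : LExp → Prop} (hP : Compositional P) {τ : Loc → LExp}
    {K : Stack} (hK : K.Unlabeled) {t : LExp} (h : P (K.tree τ t)) : P t := by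
  induction K generalizing t with
  | nil => exact h
  | cons f K ih =>
    have hf := hK f (by simp)
    have hK' : Stack.Unlabeled K := fun g hg => hK g (by simp [hg])
    rcases f with ⟨F, _ | _⟩
    · exact hP.of_frame (ih hK' h)
    · cases hf

/-- The siblings of the hole do not change. Frames with a location are excluded: at their labels,
consistency would compare the new subtree with the old `τ l`. -/
theorem Compositional.stack {P : LExp → Prop} (hP : Compositional P) {τ : Loc → LExp}
    {K : Stack} (hK : K.Unlabeled) {t t' : LExp} (h : P (K.tree τ t)) (h' : P t') :
    P (K.tree τ t') := by
  induction K generalizing t t' with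
  | nil => exact h'
  | cons f K ih =>
    have hf := hK f (by simp)
    have hK' : Stack.Unlabeled K := fun g hg => hK g (by simp [hg])
    rcases f with ⟨F, _ | _⟩
    · exact ih hK' h (hP.frame (hP.of_stack hK' h) h')
    · cases hf

/-- For each location `l` under evaluation the hole lies strictly below a label `l`, and the subterm
at that label is all of `τ l`; so `notMem_labels` applies. -/
theorem Consistent.of_tree {τ : Loc → LExp} {D : Set Loc} {K : Stack} {t : LExp}
    (h : Consistent τ D (K.tree τ t)) :
    Consistent τ D t ∧ ∀ l ∈ K.locs, l ∉ t.labels ∧ ∃ s, τ l = .lab l s := by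
  induction K generalizing t with
  | nil => exact ⟨h, fun l hl => hl.elim⟩
  | cons f K ih =>
    rcases f with ⟨F, _ | ⟨ls, l⟩⟩
    · obtain ⟨h₁, h₂⟩ := ih h
      refine ⟨(compositional_consistent τ D).of_frame h₁, fun l hl => ⟨?_, (h₂ l hl).2⟩⟩
      exact (compositional_notMem l).of_frame (h₂ l hl).1
    · obtain ⟨h₁, h₂⟩ := ih h
      have h₃ := ((compositional_consistent τ D).of_frame h₁).of_wrap
      refine ⟨h₃.2, fun l' hl' => ?_⟩
      rcases hl' with rfl | hl'
      · exact ⟨h₃.notMem_labels, _, h₃.1.2⟩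
      · refine ⟨fun hm => ?_, (h₂ l' hl').2⟩
        refine (compositional_notMem l').of_frame (h₂ l' hl').1 (labels_wrap _ _ ?_)
        simp [LExp.labels, hm]

theorem OpFrame.labels_tree (τ : Loc → LExp) (F : OpFrame) (t : LExp) :
    t.labels ⊆ (F.tree τ t).labels := by
  intro l hl
  cases F <;> simp [tree, LExp.labels, hl]

theorem Stack.labels_tree (τ : Loc → LExp) (K : Stack) (t : LExp) :
    t.labels ⊆ (K.tree τ t).labels := by
  induction K generalizing t with
  | nil => rfl
  | cons f K ih =>
    rcases f with ⟨F, _ | ⟨ls, l⟩⟩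
    · exact (F.labels_tree τ t).trans (ih _)
    · refine Finset.Subset.trans ?_ ((labels_wrap ls _).trans ((F.labels_tree τ _).trans (ih _)))
      exact Finset.subset_insert _ _

theorem Stack.locs_subset_labels (τ : Loc → LExp) (K : Stack) (t : LExp) {l : Loc}
    (hl : l ∈ K.locs) : l ∈ (K.tree τ t).labels := by
  induction K generalizing t with
  | nil => exact hl.elim
  | cons f K ih =>
    rcases f with ⟨F, _ | ⟨ls, l'⟩⟩
    · exact ih _ hl
    · rcases hl with rfl | hl
      · refine Stack.labels_tree τ K _ (F.labels_tree τ _ (labels_wrap ls _ ?_))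
        simp [LExp.labels]
      · exact ih _ hl

/-! ## Forests: the trees of all locations -/

/-- The trees `τ` of the locations in `D`, where `δ` is the store and the locations in `S` are under
evaluation. The tree of a location is labeled with that location, or the location contains another
location and shares its tree. -/
structure Forest (D : Set Loc) (δ : Loc → DExp) (τ : Loc → LExp) (S : Set Loc) : Prop where
  consistent : ∀ l ∈ D, Consistent τ D (τ l)
  labeled : ∀ l ∈ D, (τ l).IsLabeled
  closed : ∀ l ∈ D, (τ l).Closed
  inScope : ∀ l ∈ D, Scoped D (δ l)
  idle : ∀ l ∈ D, l ∉ S →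
    τ l = .lab l ((δ l).lift τ) ∨ ∃ l', δ l = .loc l' ∧ τ l = τ l'

/-! ## Synthesis -/

/-- For the entries that `forceAt` writes into the store: they contain no locations, so synthesizing
them again reproduces them. -/
theorem synthS_toDExp (x : Exp) : ∀ {k σ e σ'}, synthS k x.toDExp σ = some (e, σ') →
    e = x ∧ σ' = σ := by
  induction x with
  | app x₁ x₂ ih₁ ih₂ | prim2 p x₁ x₂ ih₁ ih₂ | cons x₁ x₂ ih₁ ih₂ =>
    intro k σ e σ' h
    cases k with
    | zero => simp [synthS] at h
    | succ k =>
      simp only [Exp.toDExp, synthS, Option.bind_eq_bind] at h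
      split_ifs at h
      all_goals
        simp only [Option.bind_eq_some_iff, Prod.exists, Option.some.injEq, Prod.mk.injEq] at h
        obtain ⟨a, σ₁, h₁, b, σ₂, h₂, rfl, rfl⟩ := h
      · obtain ⟨rfl, rfl⟩ := ih₂ h₁
        obtain ⟨rfl, rfl⟩ := ih₁ h₂
        exact ⟨rfl, rfl⟩
      · obtain ⟨rfl, rfl⟩ := ih₁ h₁
        obtain ⟨rfl, rfl⟩ := ih₂ h₂
        exact ⟨rfl, rfl⟩
  | lam x y ih =>
    intro k σ e σ' h
    cases k with
    | zero => simp [synthS] at h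
    | succ k =>
      simp only [Exp.toDExp, synthS, Option.bind_eq_bind, Option.bind_eq_some_iff, Prod.exists,
        Option.some.injEq, Prod.mk.injEq] at h
      obtain ⟨a, σ₁, h₁, rfl, rfl⟩ := h
      exact ⟨by rw [(ih h₁).1], rfl⟩
  | prim1 p y ih =>
    intro k σ e σ' h
    cases k with
    | zero => simp [synthS] at h
    | succ k =>
      simp only [Exp.toDExp, synthS, Option.bind_eq_bind, Option.bind_eq_some_iff, Prod.exists,
        Option.some.injEq, Prod.mk.injEq] at h
      obtain ⟨a, σ₁, h₁, rfl, rfl⟩ := h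
      obtain ⟨rfl, rfl⟩ := ih h₁
      exact ⟨rfl, rfl⟩
  | ite x₁ x₂ x₃ ih₁ ih₂ ih₃ =>
    intro k σ e σ' h
    cases k with
    | zero => simp [synthS] at h
    | succ k =>
      simp only [Exp.toDExp, synthS, Option.bind_eq_bind, Option.bind_eq_some_iff, Prod.exists,
        Option.some.injEq, Prod.mk.injEq] at h
      obtain ⟨a, σ₁, h₁, b, σ₂, h₂, c, σ₃, h₃, rfl, rfl⟩ := h
      obtain ⟨rfl, rfl⟩ := ih₁ h₁
      exact ⟨by rw [(ih₂ h₂).1, (ih₃ h₃).1], rfl⟩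
  | _ =>
    intro k σ e σ' h
    cases k <;> simp_all [synthS, Exp.toDExp]

/-- Outside `V`, the store contains the synthesized trees or, for locations not in `S`, the
expressions given by `δ`. -/
def Fits (D : Set Loc) (δ : Loc → DExp) (τ : Loc → LExp) (S V : Set Loc) (σ : DStore) : Prop :=
  ∀ l ∈ D, l ∉ V →
    σ.lookup l = some (τ l).unlabel.toDExp ∨ (l ∉ S ∧ σ.lookup l = some (δ l))

section
variable {D : Set Loc} {δ : Loc → DExp} {τ : Loc → LExp} {S V : Set Loc}

/-- `V` holds the locations whose entries are still stale. They are never looked up, since each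
would show its label in `d.lift τ`. The induction is on the level bound, because a lookup leaves the
structure of `d`. -/
theorem Forest.synthS_scoped (hF : Forest D δ τ S) (hV : ∀ l ∈ V, ∃ s, τ l = .lab l s) (k : ℕ) :
    ∀ {d σ e σ'}, Scoped D d → (∀ l ∈ V, l ∉ (d.lift τ).labels) → Fits D δ τ S V σ →
      synthS k d σ = some (e, σ') → e = (d.lift τ).unlabel ∧ σ' = σ := by
  induction k with
  | zero => intro d σ e σ' _ _ _ h; simp [synthS] at h
  | succ k ih =>
    intro d σ e σ' hd hdV hσ h
    cases d with
    | app d₁ d₂ | prim2 p d₁ d₂ | cons d₁ d₂ =>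
      simp only [DExp.lift, LExp.labels, Finset.mem_union, not_or] at hdV
      simp only [synthS, Option.bind_eq_bind] at h
      split_ifs at h
      all_goals
        simp only [Option.bind_eq_some_iff, Prod.exists, Option.some.injEq, Prod.mk.injEq] at h
        obtain ⟨a, σ₁, h₁, b, σ₂, h₂, rfl, rfl⟩ := h
      · obtain ⟨rfl, rfl⟩ := ih hd.2 (fun l hl => (hdV l hl).2) hσ h₁
        obtain ⟨rfl, rfl⟩ := ih hd.1 (fun l hl => (hdV l hl).1) hσ h₂
        exact ⟨rfl, rfl⟩
      · obtain ⟨rfl, rfl⟩ := ih hd.1 (fun l hl => (hdV l hl).1) hσ h₁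
        obtain ⟨rfl, rfl⟩ := ih hd.2 (fun l hl => (hdV l hl).2) hσ h₂
        exact ⟨rfl, rfl⟩
    | lam x d =>
      simp only [synthS, Option.bind_eq_bind, Option.bind_eq_some_iff, Prod.exists,
        Option.some.injEq, Prod.mk.injEq] at h
      obtain ⟨a, σ₁, h₁, rfl, rfl⟩ := h
      exact ⟨by rw [(ih (d := d) hd hdV hσ h₁).1]; rfl, rfl⟩
    | prim1 p d =>
      simp only [synthS, Option.bind_eq_bind, Option.bind_eq_some_iff, Prod.exists,
        Option.some.injEq, Prod.mk.injEq] at h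
      obtain ⟨a, σ₁, h₁, rfl, rfl⟩ := h
      obtain ⟨rfl, rfl⟩ := ih (d := d) hd hdV hσ h₁
      exact ⟨rfl, rfl⟩
    | ite d₁ d₂ d₃ =>
      simp only [DExp.lift, LExp.labels, Finset.mem_union, not_or] at hdV
      simp only [synthS, Option.bind_eq_bind, Option.bind_eq_some_iff, Prod.exists,
        Option.some.injEq, Prod.mk.injEq] at h
      obtain ⟨a, σ₁, h₁, b, σ₂, h₂, c, σ₃, h₃, rfl, rfl⟩ := h
      obtain ⟨rfl, rfl⟩ := ih hd.1 (fun l hl => (hdV l hl).1.1) hσ h₁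
      obtain ⟨rfl, -⟩ := ih hd.2.1 (fun l hl => (hdV l hl).1.2) hσ h₂
      obtain ⟨rfl, -⟩ := ih hd.2.2 (fun l hl => (hdV l hl).2) hσ h₃
      exact ⟨rfl, rfl⟩
    | delay d | force d =>
      simp only [synthS] at h
      exact ih (d := d) hd hdV hσ h
    | loc l =>
      simp only [synthS, Option.bind_eq_bind, Option.bind_eq_some_iff] at h
      obtain ⟨c, hc, h⟩ := h
      have hlV : l ∉ V := fun hl => by
        obtain ⟨s, hs⟩ := hV l hl
        exact hdV l hl (by simp [DExp.lift, hs, LExp.labels])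
      rcases hσ l hd hlV with h' | ⟨hlS, h'⟩
      · rw [h', Option.some.injEq] at hc
        subst hc
        exact synthS_toDExp _ h
      · rw [h', Option.some.injEq] at hc
        subst hc
        -- Either the tree of `l` is its own label, which erasure drops, around the lifted contents,
        -- or `l` holds a location with the same tree.
        rcases hF.idle l hd hlS with hl | ⟨l', hl', hl⟩
        · have := ih (hF.inScope l hd) (fun l' hl' => ?_) hσ h
          · simpa [DExp.lift, hl, LExp.unlabel] using this
          · have := hdV l' hl'
            simp only [DExp.lift, hl, LExp.labels, Finset.mem_insert, not_or] at this
            exact this.2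
        · have hd' := hF.inScope l hd
          rw [hl'] at h hd'
          have := ih hd' (fun l'' hl'' => ?_) hσ h
          · simpa [DExp.lift, hl] using this
          · simpa [DExp.lift, hl] using hdV l'' hl''
    | forceAt => exact hd.elim
    | _ => simp_all [synthS, DExp.lift, LExp.unlabel]

/-- `C` is not a value, and the left part of `prim2R` is one, so `synthS` always enters the part
with the hole first; the siblings then see a store that fits. `P` is the assumption on the store
before that. -/
theorem OpFrame.synthS_ctl (hF : Forest D δ τ S) (hV : ∀ l ∈ V, ∃ s, τ l = .lab l s)
    {F : OpFrame} (hFD : F.WF D) {C : DExp} (hC : C.isValue = false) {t : LExp}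
    (hFV : ∀ l ∈ V, l ∉ (F.tree τ t).labels) {P : DStore → Prop}
    (h : ∀ k σ e σ', P σ → synthS k C σ = some (e, σ') → e = t.unlabel ∧ Fits D δ τ S V σ')
    {k σ e σ'} (hσ : P σ) (hs : synthS k (F.ctl C) σ = some (e, σ')) :
    e = (F.tree τ t).unlabel ∧ Fits D δ τ S V σ' := by
  cases k with
  | zero => simp [synthS] at hs
  | succ k =>
    cases F with
    | app d | prim2L p d =>
      have hd : Scoped D d := Lazy.scoped hFD
      simp only [OpFrame.ctl, synthS, hC, Option.bind_eq_bind, Bool.false_eq_true, if_false,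
        Option.bind_eq_some_iff, Prod.exists, Option.some.injEq, Prod.mk.injEq] at hs
      obtain ⟨a, σ₁, h₁, b, σ₂, h₂, rfl, rfl⟩ := hs
      obtain ⟨rfl, hσ₁⟩ := h _ _ _ _ hσ h₁
      obtain ⟨rfl, rfl⟩ := hF.synthS_scoped hV k (by exact hd)
        (fun l hl hm => hFV l hl (by
          simp only [DExp.lift] at hm
          simp [OpFrame.tree, LExp.labels, hm])) hσ₁ h₂
      exact ⟨rfl, hσ₁⟩
    | prim2R p v ls =>
      simp only [OpFrame.ctl, synthS, hFD.1.isValue, Option.bind_eq_bind, if_true,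
        Option.bind_eq_some_iff, Prod.exists, Option.some.injEq, Prod.mk.injEq] at hs
      obtain ⟨a, σ₁, h₁, b, σ₂, h₂, rfl, rfl⟩ := hs
      obtain ⟨rfl, hσ₁⟩ := h _ _ _ _ hσ h₁
      obtain ⟨rfl, rfl⟩ := hF.synthS_scoped hV k hFD.1.scoped
        (fun l hl hm => hFV l hl (by
          simp [OpFrame.tree, LExp.labels, labels_wrap ls _ hm])) hσ₁ h₂
      exact ⟨by simp [OpFrame.tree, LExp.unlabel, unlabel_wrap], hσ₁⟩
    | prim1 p =>
      simp only [OpFrame.ctl, synthS, Option.bind_eq_bind, Option.bind_eq_some_iff, Prod.exists,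
        Option.some.injEq, Prod.mk.injEq] at hs
      obtain ⟨a, σ₁, h₁, rfl, rfl⟩ := hs
      obtain ⟨rfl, hσ₁⟩ := h _ _ _ _ hσ h₁
      exact ⟨rfl, hσ₁⟩
    | ite d₂ d₃ =>
      simp only [OpFrame.ctl, synthS, Option.bind_eq_bind, Option.bind_eq_some_iff, Prod.exists,
        Option.some.injEq, Prod.mk.injEq] at hs
      obtain ⟨a, σ₁, h₁, b, σ₂, h₂, c, σ₃, h₃, rfl, rfl⟩ := hs
      obtain ⟨rfl, hσ₁⟩ := h _ _ _ _ hσ h₁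
      obtain ⟨rfl, -⟩ := hF.synthS_scoped hV k hFD.1.scoped
        (fun l hl hm => hFV l hl (by simp [OpFrame.tree, LExp.labels, hm])) hσ₁ h₂
      obtain ⟨rfl, -⟩ := hF.synthS_scoped hV k hFD.2.scoped
        (fun l hl hm => hFV l hl (by simp [OpFrame.tree, LExp.labels, hm])) hσ₁ h₃
      exact ⟨rfl, hσ₁⟩

/-- The induction proceeds outward from the hole. Each `forceAt l` that is passed makes the entry of
`l` correct, so the set of stale locations shrinks to that of the remaining stack. -/
theorem Stack.synthS_ctl (hF : Forest D δ τ S) {P : DStore → Prop} {K : Stack} (hK : K.WF D)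
    {C : DExp} {t : LExp} (ht : Consistent τ D (K.tree τ t))
    (h : ∀ k σ e σ', P σ → synthS k C σ = some (e, σ') → e = t.unlabel ∧ Fits D δ τ S K.locs σ')
    {k σ e σ'} (hσ : P σ) (hs : synthS k (K.ctl C) σ = some (e, σ')) :
    e = (K.tree τ t).unlabel := by
  induction K generalizing C t with
  | nil => exact (h _ _ _ _ hσ hs).1
  | cons f K ih =>
    have hK' : Stack.WF D K := fun g hg => hK g (by simp [hg])
    have hf : f.1.WF D := hK f (by simp)
    rcases f with ⟨F, _ | ⟨ls, l⟩⟩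
    · refine ih hK' ht (fun k σ e σ' hσ hs => ?_) hs
      obtain ⟨h₁, h₂⟩ := Consistent.of_tree (K := K) ht
      refine OpFrame.synthS_ctl hF (fun l hl => (h₂ l hl).2) hf rfl (fun l hl => (h₂ l hl).1)
        (fun k σ e σ' hσ hs => ?_) hσ hs
      cases k with
      | zero => simp [synthS] at hs
      | succ k => exact h _ _ _ _ hσ hs
    · refine ih hK' ht (fun k σ e σ' hσ hs => ?_) hs
      obtain ⟨h₁, h₂⟩ := Consistent.of_tree (K := K) ht
      refine OpFrame.synthS_ctl hF (fun l hl => (h₂ l hl).2) hf rfl (fun l hl => (h₂ l hl).1)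
        (fun k σ e σ' hσ hs => ?_) hσ hs
      -- One level is spent on `force` and one on `forceAt l`; with fewer, synthesis fails.
      match k, hs with
      | k + 2, hs' =>
        simp only [synthS, Option.bind_eq_bind, Option.bind_eq_some_iff, Prod.exists,
          Option.some.injEq, Prod.mk.injEq] at hs'
        obtain ⟨a, σ₁, hs₁, rfl, rfl⟩ := hs'
        obtain ⟨rfl, hσ₁⟩ := h _ _ _ _ hσ hs₁
        refine ⟨by simp [unlabel_wrap, LExp.unlabel], fun l' hl' hn => ?_⟩
        by_cases hll : l' = l
        · subst hll
          -- The entry just written is the erasure of `t`, and consistency identifies `τ l` with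
          -- `.lab l t`.
          have := ((compositional_consistent τ D).of_frame h₁).of_wrap.1.2
          simp [this, LExp.unlabel]
        · have : (l' == l) = false := by simpa using hll
          simp only [List.lookup_cons, this]
          exact hσ₁ l' hl' (by rintro (h | h); exacts [hll h, hn h])

/-- Synthesis of a state whose control string is `C` in a stack. -/
theorem Forest.synth {K : Stack} (hF : Forest D δ τ K.locs) (hK : K.WF D) {C : DExp}
    (hC : Scoped D C) {t : LExp} (ht : Consistent τ D (K.tree τ t))
    (hCt : (C.lift τ).unlabel = t.unlabel) (hCK : ∀ l ∈ K.locs, l ∉ (C.lift τ).labels)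
    {σ : DStore} (hσ : ∀ l ∈ D, σ.lookup l = some (δ l)) {e : Exp} (h : Synth ⟨K.ctl C, σ⟩ e) :
    e = (K.tree τ t).unlabel := by
  obtain ⟨k, σ', h⟩ := h
  refine Stack.synthS_ctl hF hK ht (P := Fits D δ τ K.locs K.locs) (fun k σ e σ' hσ hs => ?_)
    (fun l hl hn => Or.inr ⟨hn, hσ l hl⟩) h
  obtain ⟨rfl, rfl⟩ := hF.synthS_scoped (fun l hl => (ht.of_tree.2 l hl).2) k hC hCK hσ hs
  exact ⟨hCt, hσ⟩

end

/-! ## Rewriting in a stack -/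

/-- Composition of contexts. -/
def LCtx.comp : LCtx → LCtx → LCtx
  | .hole, E' => E'
  | .app E e, E' => .app (E.comp E') e
  | .prim2L p E e, E' => .prim2L p (E.comp E') e
  | .prim2R p v hv E, E' => .prim2R p v hv (E.comp E')
  | .prim1 p E, E' => .prim1 p (E.comp E')
  | .ite E e₂ e₃, E' => .ite (E.comp E') e₂ e₃
  | .lab l E, E' => .lab l (E.comp E')

theorem LCtx.fill_comp (E E' : LCtx) (t : LExp) : (E.comp E').fill t = E.fill (E'.fill t) := by
  induction E <;> simp_all [comp, fill]

theorem LCtx.NotUnderLabel.comp {E E' : LCtx} (h : E.NotUnderLabel) (h' : E'.NotUnderLabel) :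
    (E.comp E').NotUnderLabel := by
  induction E <;> simp_all [LCtx.comp, NotUnderLabel]

section
variable {D : Set Loc} {δ : Loc → DExp} {τ : Loc → LExp} {S : Set Loc}

theorem OpFrame.exists_ctx (hτ : ∀ l ∈ D, (τ l).IsLabeled) {F : OpFrame} (hF : F.WF D) :
    ∃ E : LCtx, (∀ t, E.fill t = F.tree τ t) ∧ E.NotUnderLabel := by
  cases F with
  | app d => exact ⟨.app .hole _, fun _ => rfl, trivial⟩
  | prim2L p d => exact ⟨.prim2L p .hole _, fun _ => rfl, trivial⟩
  | prim2R p v ls =>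
    exact ⟨.prim2R p _ (isValue_wrap (hF.1.isValue_lift hτ hF.2) ls) .hole, fun _ => rfl, trivial⟩
  | prim1 p => exact ⟨.prim1 p .hole, fun _ => rfl, trivial⟩
  | ite d₂ d₃ => exact ⟨.ite .hole _ _, fun _ => rfl, trivial⟩

theorem exists_ctx_wrap (ls : List Label) : ∃ E : LCtx, ∀ t, E.fill t = LExp.wrap ls t := by
  induction ls with
  | nil => exact ⟨.hole, fun _ => rfl⟩
  | cons l ls ih =>
    obtain ⟨E, hE⟩ := ih
    exact ⟨.lab l E, fun t => by simp only [LCtx.fill, hE]; rfl⟩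

theorem Stack.exists_ctx (hτ : ∀ l ∈ D, (τ l).IsLabeled) {K : Stack} (hK : K.WF D) :
    ∃ E : LCtx, (∀ t, E.fill t = K.tree τ t) ∧ (K.Unlabeled → E.NotUnderLabel) := by
  induction K with
  | nil => exact ⟨.hole, fun _ => rfl, fun _ => trivial⟩
  | cons f K ih =>
    obtain ⟨E, hE, hE'⟩ := ih fun g hg => hK g (by simp [hg])
    obtain ⟨E₁, hE₁, hE₁'⟩ := OpFrame.exists_ctx hτ (hK f (by simp))
    rcases f with ⟨F, _ | ⟨ls, l⟩⟩
    · refine ⟨E.comp E₁, fun t => ?_, fun h => ?_⟩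
      · simp only [LCtx.fill_comp, hE, hE₁, tree]
      · exact (hE' fun g hg => h g (by simp [hg])).comp hE₁'
    · obtain ⟨E₂, hE₂⟩ := exists_ctx_wrap ls
      refine ⟨(E.comp E₁).comp (E₂.comp (.lab l .hole)), fun t => ?_, fun h => ?_⟩
      · simp only [LCtx.fill_comp, hE, hE₁, hE₂, tree, LCtx.fill]
      · have := h _ (List.mem_cons_self ..)
        cases this

-- Labels, values and parallel updates in a stack.

theorem Contract.labels {L : Finset Label} {r c : LExp} (h : Contract L r c) {l : Label}
    (hl : l ∈ c.labels) : l ∈ r.labels ∨ l ∉ L := by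
  cases h with
  | beta ls x e₁ e₂ l' hl' =>
    have := labels_subst _ _ _ hl
    simp only [Finset.mem_union, LExp.labels, Finset.mem_insert] at this
    rcases this with h | rfl | h
    · left
      have := labels_wrap ls (.lam x e₁) h
      simp [LExp.labels, this]
    · exact Or.inr hl'
    · left
      simp [LExp.labels, h]
  | prim => simp [LExp.labels] at hl
  | cons =>
    simp only [LExp.labels, Finset.mem_union, Finset.mem_insert] at hl ⊢
    grind
  | car ls _ e₂ =>
    left
    exact labels_wrap ls (.cons c e₂) (by simp [LExp.labels, hl])
  | cdr ls e₁ =>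
    left
    exact labels_wrap ls (.cons e₁ c) (by simp [LExp.labels, hl])
  | iteTrue | iteFalse => left; simp [LExp.labels, hl]

theorem Contract.not_isValue {L : Finset Label} {r c : LExp} (h : Contract L r c) :
    ¬ r.IsValue := by
  intro hr
  cases h with
  | cons e₁ e₂ l₁ l₂ h =>
    cases hr
    simp [LExp.IsLabeled] at h
  | _ => cases hr

theorem Stack.not_isValue_tree {K : Stack} (hK : K.Unlabeled) {r : LExp} (hr : ¬ r.IsValue) :
    ¬ (K.tree τ r).IsValue := by
  induction K generalizing r with
  | nil => exact hr
  | cons f K ih =>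
    have hf := hK f (by simp)
    rcases f with ⟨F, _ | _⟩
    · refine ih (fun g hg => hK g (by simp [hg])) fun h => ?_
      cases F <;> cases h
    · cases hf

theorem update_wrap {l : Label} {a : LExp} {ls : List Label} (hl : l ∉ ls) (t : LExp) :
    LExp.update l a (LExp.wrap ls t) = LExp.wrap ls (LExp.update l a t) := by
  induction ls with
  | nil => rfl
  | cons l' ls ih =>
    simp only [List.mem_cons, not_or] at hl
    have := ih hl.2
    simp only [LExp.wrap, List.foldr_cons, LExp.update] at this ⊢
    rw [if_neg (Ne.symm hl.1), this]

theorem Consistent.exists_of_mem_wrap {ls : List Label} {t : LExp}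
    (h : Consistent τ D (LExp.wrap ls t)) {l : Label} (hl : l ∈ ls) :
    ∃ ls', τ l = .lab l (LExp.wrap ls' t) := by
  induction ls with
  | nil => cases hl
  | cons l' ls ih =>
    rcases List.mem_cons.1 hl with rfl | hl
    · exact ⟨ls, h.1.2⟩
    · exact ih h.2 hl

/-- If `l` were also in `ls`, its tree would be strictly larger than `t`, although an occurrence of
`l` in `t` bounds it by the size of `t`. -/
theorem Consistent.notMem_of_mem_labels {ls : List Label} {t : LExp}
    (h : Consistent τ D (LExp.wrap ls t)) {l : Label} (hl : l ∈ t.labels) : l ∉ ls := fun hls => by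
  obtain ⟨ls', h'⟩ := h.exists_of_mem_wrap hls
  have h₁ := h.of_wrap.sizeOf_le hl
  have h₂ : sizeOf t ≤ sizeOf (LExp.wrap ls' t) := by
    clear h'
    induction ls' with
    | nil => rfl
    | cons l ls ih =>
      refine ih.trans ?_
      simp [LExp.wrap]
  rw [h'] at h₁
  simp only [LExp.lab.sizeOf_spec] at h₁
  omega

/-- The delicate point is the labels `ls` around the left operand of `prim2R`, which the update must
not hit. If `l` were one of them, the expression `b` under `l` would be a value. -/
theorem OpFrame.update_tree (hτ : ∀ l ∈ D, (τ l).IsLabeled) {l : Label} {a b : LExp}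
    (hl : τ l = .lab l b) (hb : ¬ b.IsValue) {F : OpFrame} (hF : F.WF D) {t : LExp}
    (ht : Consistent τ D (F.tree τ t)) :
    LExp.update l a (F.tree τ t) =
      F.tree (fun l' => LExp.update l a (τ l')) (LExp.update l a t) := by
  cases F with
  | prim2R p v ls =>
    simp only [OpFrame.tree, LExp.update, lift_update]
    rw [update_wrap]
    intro hls
    obtain ⟨ls', h⟩ := ht.1.exists_of_mem_wrap hls
    rw [hl, LExp.lab.injEq] at h
    rw [h.2] at hb
    exact hb (isValue_wrap (hF.1.isValue_lift hτ hF.2) ls')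
  | _ => simp [OpFrame.tree, LExp.update, lift_update]

/-- The update must not stop at a label of the stack itself. It does not if the stack has none, or
if `l` occurs further inside, because no tree contains its own label. -/
theorem Stack.update_tree (hτ : ∀ l ∈ D, (τ l).IsLabeled) {l : Label} {a b : LExp}
    (hl : τ l = .lab l b) (hb : ¬ b.IsValue) {K : Stack} (hK : K.WF D) {t : LExp}
    (ht : Consistent τ D (K.tree τ t)) (hlt : l ∈ t.labels ∨ K.Unlabeled) :
    LExp.update l a (K.tree τ t) =
      K.tree (fun l' => LExp.update l a (τ l')) (LExp.update l a t) := by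
  induction K generalizing t with
  | nil => rfl
  | cons f K ih =>
    have hK' : Stack.WF D K := fun g hg => hK g (by simp [hg])
    rcases f with ⟨F, _ | ⟨ls, l'⟩⟩
    · simp only [tree]
      rw [ih hK' ht, OpFrame.update_tree hτ hl hb (hK _ (List.mem_cons_self ..))
        (Consistent.of_tree (K := K) ht).1]
      exact hlt.imp (fun h => F.labels_tree τ t h) fun h g hg => h g (by simp [hg])
    · replace hlt : l ∈ t.labels := hlt.resolve_right fun h => by
        have := h _ (List.mem_cons_self ..)
        cases this
      have h₁ := (Consistent.of_tree (K := K) ht).1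
      have h₂ := (compositional_consistent τ D).of_frame h₁
      have hll : l ≠ l' := by
        rintro rfl
        exact h₂.of_wrap.notMem_labels hlt
      have hm : l ∈ (LExp.lab l' t).labels := by simp [LExp.labels, hlt]
      simp only [tree]
      rw [ih hK' ht (Or.inl (F.labels_tree τ _ (labels_wrap ls _ hm))),
        OpFrame.update_tree hτ hl hb (hK _ (List.mem_cons_self ..)) h₁,
        update_wrap (h₂.notMem_of_mem_labels hm)]
      simp [LExp.update, hll.symm]

/-- The two cases are the two rules of `LRStep`; `l` is the label nearest to the hole. -/
theorem Stack.unlabeled_or_split (K : Stack) : K.Unlabeled ∨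
    ∃ (K₂ : Stack) (F : OpFrame) (ls : List Label) (l : Loc) (K₁ : Stack),
      K = K₂ ++ (F, some (ls, l)) :: K₁ ∧ K₂.Unlabeled := by
  induction K with
  | nil => exact Or.inl fun _ h => by cases h
  | cons f K ih =>
    rcases f with ⟨F, _ | ⟨ls, l⟩⟩
    · rcases ih with h | ⟨K₂, F', ls, l, K₁, rfl, h⟩
      · left
        intro g hg
        rcases List.mem_cons.1 hg with rfl | hg
        exacts [rfl, h g hg]
      · refine Or.inr ⟨(F, none) :: K₂, F', ls, l, K₁, rfl, fun g hg => ?_⟩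
        rcases List.mem_cons.1 hg with rfl | hg
        exacts [rfl, h g hg]
    · exact Or.inr ⟨[], F, ls, l, K, rfl, fun _ h => by cases h⟩

/-- Because `l` is under evaluation, `idle` asks nothing of it, and the stale store entry `δ l` can
stay. -/
theorem Forest.update (hF : Forest D δ τ S) {l : Loc} (hl : l ∈ S) {a : LExp}
    (ha : Consistent (fun l' => LExp.update l a (τ l')) D a) (hac : a.Closed) :
    Forest D δ (fun l' => LExp.update l a (τ l')) S where
  consistent l' hl' := (hF.consistent l' hl').update ha
  labeled l' hl' := (hF.labeled l' hl').update
  closed l' hl' := (hF.closed l' hl').update hac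
  inScope := hF.inScope
  idle l' hl' hn := by
    have hne : l' ≠ l := by rintro rfl; exact hn hl
    rcases hF.idle l' hl' hn with h | ⟨l'', h, h'⟩
    · left
      rw [h, lift_update]
      simp [LExp.update, hne]
    · exact Or.inr ⟨l'', h, by simp only [h']⟩

/-- A contraction in a stack is a rewriting step, in which all trees are updated. -/
theorem Forest.lrStep {K : Stack} (hF : Forest D δ τ K.locs) (hK : K.WF D) {r : LExp}
    (hr : Consistent τ D (K.tree τ r)) {d : DExp} (hd : Scoped D d) (hdc : (d.lift τ).Closed)
    (hc : Contract (K.tree τ r).labels r (d.lift τ)) :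
    ∃ τ', Forest D δ τ' K.locs ∧ LRStep (K.tree τ r) (K.tree τ' (d.lift τ')) ∧
      Consistent τ' D (K.tree τ' (d.lift τ')) := by
  have hcd : Consistent τ D (d.lift τ) := Consistent.lift hF.consistent hd
  rcases K.unlabeled_or_split with hU | ⟨K₂, F, ls, l, K₁, rfl, hU⟩
  · refine ⟨τ, hF, ?_, (compositional_consistent τ D).stack hU hr hcd⟩
    obtain ⟨E, hE, hE'⟩ := Stack.exists_ctx hF.labeled hK
    rw [← hE, ← hE]
    rw [← hE] at hc
    exact .plain E _ _ (hE' hU) hc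
  · have hlK : l ∈ Stack.locs (K₂ ++ (F, some (ls, l)) :: K₁) := by
      clear hr hc hF hK
      induction K₂ with
      | nil => exact Set.mem_insert _ _
      | cons f K₂ ih =>
        have := ih fun g hg => hU g (by simp [hg])
        rcases f with ⟨F', _ | ⟨ls', l'⟩⟩
        exacts [this, Set.mem_insert_of_mem _ this]
    have hK₂ : Stack.WF D K₂ := fun g hg => hK g (by simp [hg])
    have hK₁ : Stack.WF D K₁ := fun g hg => hK g (by simp [hg])
    have hFD : F.WF D := hK (F, some (ls, l)) (by simp)
    have htree : ∀ τ t, Stack.tree τ (K₂ ++ (F, some (ls, l)) :: K₁) t =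
        K₁.tree τ (F.tree τ (LExp.wrap ls (.lab l (K₂.tree τ t)))) := fun τ t => by
      rw [Stack.tree_append]; rfl
    have hr₁ := hr
    rw [htree] at hr₁
    have hr₂ := ((compositional_consistent τ D).of_frame (Consistent.of_tree (K := K₁) hr₁).1).of_wrap
    have hlr := hr₂.notMem_labels
    have hτl := hr₂.1.2
    -- Labels of the contractum come from the redex, which lies below `l`, or are fresh for a
    -- program that contains `l`.
    have hlc : l ∉ (d.lift τ).labels := fun h => by
      rcases hc.labels h with h | h
      · exact hlr (Stack.labels_tree τ K₂ r h)
      · exact h (Stack.locs_subset_labels _ _ _ hlK)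
    have hnv : ¬ (K₂.tree τ r).IsValue := Stack.not_isValue_tree hU hc.not_isValue
    set a := K₂.tree τ (d.lift τ) with ha
    have hal : l ∉ a.labels := (compositional_notMem l).stack hU hlr hlc
    -- The siblings in `K₂` are closed because the whole tree of `l` is.
    have hac : a.Closed := by
      have h := hF.closed l hr₂.1.1
      rw [hτl] at h
      refine compositional_closed.stack hU (t := r) (fun x b => ?_) hdc
      have := h x b
      simpa [LExp.subst] using this
    have haC : Consistent τ D a := (compositional_consistent τ D).stack hU hr₂.2 hcd
    have haC' := haC.update_self (b := a) hal
    set τ' := fun l' => LExp.update l a (τ l') with hτ'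
    -- The new forest gives the same expression under `l` as the old one, since `a` does not contain
    -- `l`.
    have haτ : K₂.tree τ' (d.lift τ') = a := by
      rw [hτ', lift_update, ← Stack.update_tree hF.labeled hτl hnv hK₂ haC (Or.inr hU)]
      exact update_of_notMem hal
    have hnew : Stack.tree τ' (K₂ ++ (F, some (ls, l)) :: K₁) (d.lift τ') =
        LExp.update l a (Stack.tree τ (K₂ ++ (F, some (ls, l)) :: K₁) r) := by
      rw [htree, htree, haτ]
      have hm : l ∈ (LExp.lab l (K₂.tree τ r)).labels := by simp [LExp.labels]
      have h₁ := (Consistent.of_tree (K := K₁) hr₁).1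
      have h₂ := (compositional_consistent τ D).of_frame h₁
      rw [Stack.update_tree hF.labeled hτl hnv hK₁ hr₁
        (Or.inl (F.labels_tree τ _ (labels_wrap ls _ hm))),
        OpFrame.update_tree hF.labeled hτl hnv hFD h₁, update_wrap (h₂.notMem_of_mem_labels hm)]
      simp [LExp.update, hτ']
    refine ⟨τ', hF.update hlK haC' hac, ?_, ?_⟩
    · obtain ⟨E₁, hE₁, -⟩ := Stack.exists_ctx hF.labeled hK₁
      obtain ⟨E₂, hE₂, -⟩ := OpFrame.exists_ctx hF.labeled hFD
      obtain ⟨E₃, hE₃⟩ := exists_ctx_wrap ls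
      obtain ⟨E₄, hE₄, hE₄'⟩ := Stack.exists_ctx hF.labeled hK₂
      have hfill : ∀ t, ((E₁.comp E₂).comp E₃).fill (.lab l (E₄.fill t)) =
          Stack.tree τ (K₂ ++ (F, some (ls, l)) :: K₁) t := fun t => by
        rw [htree, LCtx.fill_comp, LCtx.fill_comp, hE₁, hE₂, hE₃, hE₄]
      rw [hnew, ← hfill, ha, ← hE₄]
      rw [← hfill] at hc
      exact .shared _ l E₄ r _ (hE₄' hU) hc
    · rw [hnew]
      exact hr.update haC'

end

/-! ## Explained outputs -/

/-- Whatever is displayed for the output of `a` with the marks `ms`, after the outputs `past`, is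
the labeled expression `t` without its labels. -/
def Explains (past : List CExp) (a ms : CExp) (t : LExp) : Prop :=
  ∀ C σ d, (reconC a).bind (reconE ms) = some C → reconS (past ++ [.cons a ms]) = some σ →
    Synth ⟨C, σ⟩ d → d = t.unlabel

/-- The outputs that follow `past` are explained by a sequence of rewritings that starts with the
given labeled expression. -/
inductive Explained : List CExp → LExp → List CExp → Prop
  | nil {past t} : Explained past t []
  | cons {past t t' a ms os} : LRSteps t t' → Explains past a ms t' →
      Explained (past ++ [.cons a ms]) t' os → Explained past t (.cons a ms :: os)

theorem Explained.of_steps {past t t' os} (h : LRSteps t t') (h' : Explained past t' os) :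
    Explained past t os := by
  cases h' with
  | nil => exact .nil
  | cons h₁ h₂ h₃ => exact .cons (h.trans h₁) h₂ h₃

theorem Explained.exists_chain {past t os} (h : Explained past t os) :
    ∀ {states es}, reconFrom past os = some states → List.Forall₂ Synth states es →
      ∃ ts : List LExp, es = ts.map LExp.unlabel ∧ List.IsChain LRSteps (t :: ts) := by
  induction h with
  | nil =>
    intro states es h hs
    simp only [reconFrom, Option.some.injEq] at h
    subst h
    cases hs
    exact ⟨[], rfl, by simp⟩
  | @cons past t t' a ms os h₁ h₂ h₃ ih =>
    intro states es h hs
    simp only [reconFrom, Option.bind_eq_bind, Option.bind_eq_some_iff, Option.some.injEq] at h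
    obtain ⟨C₀, hC₀, C, hC, σ, hσ, rest, hrest, rfl⟩ := h
    cases hs with
    | @cons _ e _ es he hes =>
      obtain ⟨ts, rfl, hts⟩ := ih hrest hes
      refine ⟨t' :: ts, ?_, ?_⟩
      · rw [h₂ C σ e (by simp [hC₀, hC]) hσ he]
        rfl
      · exact List.IsChain.cons_cons h₁ hts

/-- The outputs of the first `n` transitions are explained. -/
def Ok (new : CStore → Loc) (n : ℕ) (past : List CExp) (t : LExp) (s : Config) : Prop :=
  ∀ k ≤ n, Explained past t (trace new k s)

-- Transitions of the machine and their outputs.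

section
variable {new : CStore → Loc} {n : ℕ} {past : List CExp} {t t' : LExp} {s s' : Config}
  {σ : CStore} {K : Kont} {m m' : Mark} {a b c q v : CExp} {x : Name}

theorem Ok.mono (h : Ok new (n + 1) past t s) : Ok new n past t s :=
  fun k hk => h k (by omega)

theorem ok_zero : Ok new 0 past t s := fun k hk => by
  obtain rfl : k = 0 := by omega
  exact .nil

theorem Ok.of_steps (h : LRSteps t t') (h' : Ok new n past t' s) : Ok new n past t s :=
  fun k hk => (h' k hk).of_steps h

theorem ok_of_stuck (h : step new s = none) : Ok new n past t s := fun k _ => by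
  cases k with
  | zero => exact .nil
  | succ k => simpa [trace, h] using .nil

/-- The forms with `_succ` count one transition; the others discard it by `Ok.mono`. One counted
transition per case is enough for the induction on `n`. -/
theorem Ok.silent_succ (h : step new s = some (none, s')) (h' : Ok new n past t s') :
    Ok new (n + 1) past t s := fun k hk => by
  cases k with
  | zero => exact .nil
  | succ k => simpa [trace, h] using h' k (by omega)

theorem Ok.silent (h : step new s = some (none, s')) (h' : Ok new n past t s') :
    Ok new n past t s := (Ok.silent_succ h h').mono

theorem Ok.output (h : step new s = some (some (.cons a b), s')) (he : Explains past a b t)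
    (h' : Ok new n (past ++ [.cons a b]) t s') : Ok new n past t s := fun k hk => by
  cases k with
  | zero => exact .nil
  | succ k => simpa [trace, h] using .cons .refl he (h' k (by omega))

theorem step_value (hv : v.isValue = true) (f : Frame) :
    step new ⟨v, σ, (f, m) :: K, m'⟩ = ret v σ f K m m' := by
  simp [step, hv]

theorem Ok.ret_succ {f : Frame} (hv : v.isValue = true)
    (hr : ret v σ f K m m' = some (none, s')) (h : Ok new n past t s') :
    Ok new (n + 1) past t ⟨v, σ, (f, m) :: K, m'⟩ :=
  Ok.silent_succ ((step_value hv f).trans hr) h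

theorem Ok.ret {f : Frame} (hv : v.isValue = true)
    (hr : ret v σ f K m m' = some (none, s')) (h : Ok new n past t s') :
    Ok new n past t ⟨v, σ, (f, m) :: K, m'⟩ := (Ok.ret_succ hv hr h).mono

theorem Ok.beta_succ (hv : v.isValue = true) (h : Ok new n past t ⟨CExp.subst x v c, σ, K, m⟩) :
    Ok new (n + 1) past t ⟨v, σ, (.app₂ (.lam x c), m) :: K, m'⟩ := Ok.ret_succ hv rfl h

theorem Ok.beta (hv : v.isValue = true) (h : Ok new n past t ⟨CExp.subst x v c, σ, K, m⟩) :
    Ok new n past t ⟨v, σ, (.app₂ (.lam x c), m) :: K, m'⟩ := Ok.ret hv rfl h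

theorem Ok.letIn_succ (h : Ok new n past t ⟨a, σ, (.app₂ (.lam x b), m) :: K, none⟩) :
    Ok new (n + 1) past t ⟨CExp.letIn x a b, σ, K, m⟩ :=
  Ok.silent_succ rfl (Ok.ret rfl rfl h)

theorem Ok.letIn (h : Ok new n past t ⟨a, σ, (.app₂ (.lam x b), m) :: K, none⟩) :
    Ok new n past t ⟨CExp.letIn x a b, σ, K, m⟩ := (Ok.letIn_succ h).mono

theorem Ok.wcm (hq : q.isValue = true) (h : Ok new n past t ⟨c, σ, K, some q⟩) :
    Ok new n past t ⟨.wcm q c, σ, K, m⟩ :=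
  Ok.silent rfl (Ok.ret hq rfl h)

/-- Output of a value with all marks. -/
theorem Ok.emit_marks (hq : q.isValue = true) (hm : (marks K m).isValue = true)
    (he : Explains past q (marks K m) t)
    (h : Ok new n (past ++ [.cons q (marks K m)]) t
      ⟨CExp.subst (.tmp 9) (.num 42) b, σ, K, m⟩) :
    Ok new n past t ⟨emit q b, σ, K, m⟩ := by
  refine Ok.letIn (Ok.silent rfl ?_)
  refine Ok.silent (s' := ⟨q, σ, (.cons₁ .ccm, none) :: (.out, none) ::
    (.app₂ (.lam (.tmp 9) b), m) :: K, none⟩) (by simp [step, CExp.isValue]) ?_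
  refine Ok.ret hq rfl (Ok.silent rfl ?_)
  -- The frames of `cons` and `out` carry no mark and that of the `let` carries `m`, so `ccm` has
  -- returned exactly `marks K m`.
  refine Ok.ret hm rfl ?_
  refine Ok.output (s' := ⟨.num 42, σ, (.app₂ (.lam (.tmp 9) b), m) :: K, none⟩) ?_ he
    (Ok.beta rfl h)
  rw [step_value]
  · rfl
  · simp only [CExp.isValue, hq, Bool.true_and]
    exact hm

/-- Output of a value with all marks but the innermost one. -/
theorem Ok.emit_cdr (hq : q.isValue = true) (ha : a.isValue = true)
    (hm : (marks K none).isValue = true)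
    (he : Explains past q (marks K none) t)
    (h : Ok new n (past ++ [.cons q (marks K none)]) t
      ⟨CExp.subst (.tmp 9) (.num 42) b, σ, K, some a⟩) :
    Ok new n past t
      ⟨CExp.letIn (.tmp 9) (.out (.cons q (.prim1 .cdr .ccm))) b, σ, K, some a⟩ := by
  have hmarks : marks K (some a) = .cons a (marks K none) := by
    cases K <;> rfl
  refine Ok.letIn (Ok.silent rfl ?_)
  refine Ok.silent (s' := ⟨q, σ, (.cons₁ (.prim1 .cdr .ccm), none) :: (.out, none) ::
    (.app₂ (.lam (.tmp 9) b), some a) :: K, none⟩) (by simp [step, CExp.isValue]) ?_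
  refine Ok.ret hq rfl (Ok.silent rfl (Ok.silent rfl ?_))
  change Ok new n past t ⟨marks K (some a), σ, (.prim1 .cdr, none) :: (.cons₂ q, none) ::
    (.out, none) :: (.app₂ (.lam (.tmp 9) b), some a) :: K, none⟩
  rw [hmarks]
  refine Ok.ret (by simp [CExp.isValue, ha, hm]) rfl ?_
  refine Ok.ret hm rfl ?_
  refine Ok.output (s' := ⟨.num 42, σ, (.app₂ (.lam (.tmp 9) b), some a) :: K, none⟩) ?_ he
    (Ok.beta rfl h)
  rw [step_value]
  · rfl
  · simp [CExp.isValue, hq, hm]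

end

/-! ## The machine stack -/

/-- The mark of a frame `(force [])`. -/
def forceMark : CExp := list [Tag.force.exp]

/-- What the annotation of `force` does with the forced value. -/
def forceTail : CExp := emit (quoVar v1) (.var v1)

/-- What the annotation of `force` does with the value of its argument. -/
def forceHead : CExp :=
  letIn v1 (.ite (CExp.not (.isLoc (.var v0))) (.var v0) (.wcm forceMark (.force (.var v0))))
    forceTail

/-- What a delayed computation does with its value. -/
def thunkTail (l : Loc) : CExp :=
  letIn (.tmp 9) (.out (.cons (list [Tag.val.exp, .loc l, quoVar v2]) (.prim1 .cdr .ccm)))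
    (.var v2)

/-- The mark of a frame `(force_l [])`. -/
def forceAtMark (l : Loc) : CExp := list [Tag.force.exp, .loc l]

/-- The delayed computation at location `l`. -/
def thunk (l : Loc) (d : DExp) : CExp :=
  .wcm (forceAtMark l) (letIn v2 (anno d) (thunkTail l))

namespace OpFrame

/-- The mark of a frame. -/
def mark : OpFrame → CExp
  | .app d => list [Tag.app₁.exp, quo [] (.delay d)]
  | .prim2L p d => list [Tag.prim2₁.exp, (Tag.op2 p).exp, quo [] (.force d)]
  | .prim2R p v _ => list [Tag.prim2₂.exp, (Tag.op2 p).exp, list [Tag.value.exp, valC v]]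
  | .prim1 p => list [Tag.prim1.exp, (Tag.op1 p).exp]
  | .ite d₂ d₃ => list [Tag.ite.exp, quo [] d₂, quo [] d₃]

/-- The variable that is bound to the forced value. -/
def var : OpFrame → Name
  | .prim2R _ _ _ => v1
  | _ => v0

/-- What the annotated program does with the forced value. -/
def body : OpFrame → CExp
  | .app d =>
    letIn v1 (.wcm (list [Tag.app₂.exp, quoVar v0]) (anno (.delay d))) (.app (.var v0) (.var v1))
  | .prim2L p d =>
    letIn v1 (.wcm (list [Tag.prim2₂.exp, (Tag.op2 p).exp, quoVar v0]) (anno (.force d))) <|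
    letIn v2 (.prim2 p (.var v0) (.var v1)) <|
    emit (quoVar v2) (.var v2)
  | .prim2R p v _ =>
    letIn v2 (.prim2 p (valC v) (.var v1)) <|
    emit (quoVar v2) (.var v2)
  | .prim1 p =>
    letIn v1 (.prim1 p (.var v0)) <|
    emit (quoVar v1) (.var v1)
  | .ite d₂ d₃ => .ite (.var v0) (emit (quo [] d₂) (anno d₂)) (emit (quo [] d₃) (anno d₃))

end OpFrame

namespace Stack

/-- The mark register when an expression is evaluated in a stack. -/
def mark : Stack → Mark
  | [] => none
  | (_, none) :: _ => some forceMark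
  | (_, some _) :: _ => none

/-- The machine continuation of a stack. -/
def kont : Stack → Kont
  | [] => []
  | (F, none) :: K =>
    (.app₂ (.lam v0 forceHead), some F.mark) :: (.app₂ (.lam F.var F.body), mark K) :: kont K
  | (F, some (_, l)) :: K =>
    (.app₂ (.lam v2 (thunkTail l)), some (forceAtMark l)) :: (.forceAt l, none) ::
      (.force, some forceMark) :: (.app₂ (.lam v1 forceTail), some F.mark) ::
      (.app₂ (.lam F.var F.body), mark K) :: kont K

/-- The machine continuation of the frame of an operation. -/
def opKont (F : OpFrame) (K : Stack) : Kont := (.app₂ (.lam F.var F.body), mark K) :: kont K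

/-- The machine continuation in which an argument of an operation is being forced. -/
def forceKont (F : OpFrame) (K : Stack) : Kont :=
  (.force, some forceMark) :: (.app₂ (.lam v1 forceTail), some F.mark) :: opKont F K

end Stack

theorem unquo_quo_delay {D : Set Loc} {d} (h : Lazy D [] d) :
    unquo (quo [] (.delay d)) = some (.delay d) := by
  simp [quo, list, Tag.exp, unquo, h.unquo_quo]

theorem unquo_quo_force {D : Set Loc} {d} (h : Lazy D [] d) :
    unquo (quo [] (.force d)) = some (.force d) := by
  simp [quo, list, Tag.exp, unquo, h.unquo_quo]

theorem isValue_quo_delay {D : Set Loc} {d} (h : Lazy D [] d) :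
    (quo [] (.delay d)).isValue = true := by
  simp [quo, list, Tag.exp, CExp.isValue, h.isValue_quo]

theorem isValue_quo_force {D : Set Loc} {d} (h : Lazy D [] d) :
    (quo [] (.force d)).isValue = true := by
  simp [quo, list, Tag.exp, CExp.isValue, h.isValue_quo]

theorem Val.unquo_list {D : Set Loc} {v} (h : Val D v) :
    unquo (list [Tag.value.exp, valC v]) = some v := by
  simp [list, Tag.exp, unquo, h.unquoValue_valC]

theorem OpFrame.WF.isValue_mark {D : Set Loc} {F : OpFrame} (h : F.WF D) :
    F.mark.isValue = true := by
  cases F with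
  | app d => simp [mark, list, Tag.exp, CExp.isValue, isValue_quo_delay h]
  | prim2L p d => simp [mark, list, Tag.exp, CExp.isValue, isValue_quo_force h]
  | prim2R p v ls => simp [mark, list, Tag.exp, CExp.isValue, h.1.isValue_valC]
  | prim1 p => simp [mark, list, Tag.exp, CExp.isValue]
  | ite d₂ d₃ =>
    simp [mark, list, Tag.exp, CExp.isValue, h.1.isValue_quo, h.2.isValue_quo]

theorem OpFrame.WF.reconFrame {D : Set Loc} {F : OpFrame} (h : F.WF D) (C : DExp) :
    reconFrame F.mark C = some (F.ctl C) := by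
  cases F with
  | app d =>
    simp [mark, list, Tag.exp, LazyStepper.reconFrame, listElems, unquo_quo_delay h, ctl]
  | prim2L p d =>
    simp [mark, list, Tag.exp, LazyStepper.reconFrame, listElems, unquo_quo_force h, ctl]
  | prim2R p v ls =>
    have := h.1.unquo_list
    simp only [list, List.foldr_cons, List.foldr_nil, Tag.exp] at this
    simp [mark, list, Tag.exp, LazyStepper.reconFrame, listElems, this, ctl]
  | prim1 p => simp [mark, list, Tag.exp, LazyStepper.reconFrame, listElems, ctl]
  | ite d₂ d₃ =>
    simp [mark, list, Tag.exp, LazyStepper.reconFrame, listElems, h.1.unquo_quo, h.2.unquo_quo, ctl]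

theorem reconFrame_forceMark (C : DExp) : reconFrame forceMark C = some (.force C) := by
  simp [forceMark, list, Tag.exp, reconFrame, listElems]

theorem reconFrame_forceAtMark (l : Loc) (C : DExp) :
    reconFrame (forceAtMark l) C = some (.forceAt l C) := by
  simp [forceAtMark, list, Tag.exp, reconFrame, listElems]

theorem Stack.marks_none (F : OpFrame) (K : Stack) :
    marks (kont ((F, none) :: K)) (mark ((F, none) :: K)) =
      .cons forceMark (.cons F.mark (marks K.kont K.mark)) := rfl

theorem Stack.marks_some (F : OpFrame) (ls : List Label) (l : Loc) (K : Stack) :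
    marks (kont ((F, some (ls, l)) :: K)) (mark ((F, some (ls, l)) :: K)) =
      .cons (forceAtMark l) (.cons forceMark (.cons F.mark (marks K.kont K.mark))) := rfl

/-- A machine frame is stored with the mark of the continuation below it. Reading these off, every
frame of the stack contributes the mark of its operation and that of `force`, preceded by the mark
of `force_l` if a location is under evaluation. -/
theorem Stack.WF.reconE {D : Set Loc} {K : Stack} (hK : K.WF D) (C : DExp) :
    reconE (marks K.kont K.mark) C = some (K.ctl C) := by
  induction K generalizing C with
  | nil => rfl
  | cons f K ih =>
    have hf : f.1.WF D := hK f (by simp)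
    have ih := ih fun g hg => hK g (by simp [hg])
    rcases f with ⟨F, _ | ⟨ls, l⟩⟩
    · simp only [marks_none, LazyStepper.reconE, Option.bind_eq_bind, reconFrame_forceMark,
        Option.bind_some, hf.reconFrame, ih, ctl]
    · simp only [marks_some, LazyStepper.reconE, Option.bind_eq_bind, reconFrame_forceMark,
        reconFrame_forceAtMark, Option.bind_some, hf.reconFrame, ih, ctl]

theorem Stack.WF.isValue_marks {D : Set Loc} {K : Stack} (hK : K.WF D) :
    (marks K.kont K.mark).isValue = true := by
  induction K with
  | nil => rfl
  | cons f K ih =>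
    have hf : f.1.WF D := hK f (by simp)
    have ih := ih fun g hg => hK g (by simp [hg])
    have h₁ : forceMark.isValue = true := rfl
    have h₂ : ∀ l, (forceAtMark l).isValue = true := fun _ => rfl
    rcases f with ⟨F, _ | ⟨ls, l⟩⟩ <;>
      simp only [marks_none, marks_some, CExp.isValue, h₁, h₂, hf.isValue_mark, ih, Bool.and_self]

/-! ## The reconstructed store -/

theorem reconS_append_plain {a : CExp} (ha : storeEntry? a = none) (ms : CExp) (vs : List CExp) :
    reconS (vs ++ [.cons a ms]) = reconS vs := by
  induction vs with
  | nil => simp [reconS, ha]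
  | cons v vs ih => cases v <;> simp_all [reconS]

/-- `reconS` processes the outputs from the last to the first and adds an entry only for a location
that has none yet, so the appended entry takes precedence. -/
theorem reconS_append_entry {a : CExp} {tag : Tag} {l : Loc} {q : CExp} {d : DExp}
    (ha : storeEntry? a = some (tag, l, q)) (hq : unquo q = some d) (ms : CExp) (vs : List CExp) :
    ∀ {ρ}, reconS vs = some ρ → ∃ ρ', reconS (vs ++ [.cons a ms]) = some ρ' ∧
      ∀ l', ρ'.lookup l' = if l' = l then some d else ρ.lookup l' := by
  induction vs with
  | nil =>
    intro ρ h
    simp only [reconS, Option.some.injEq] at h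
    subst h
    refine ⟨[(l, d)], by simp [reconS, ha, hq], fun l' => ?_⟩
    by_cases hl : l' = l
    · simp [hl]
    · have : (l' == l) = false := by simpa using hl
      simp [List.lookup_cons, hl, this]
  | cons v vs ih =>
    intro ρ h
    cases v with
    | cons b ms' =>
      simp only [reconS, Option.bind_eq_bind, Option.bind_eq_some_iff] at h
      obtain ⟨ρ₀, h₀, h⟩ := h
      obtain ⟨ρ₀', h₀', hl₀⟩ := ih h₀
      cases hb : storeEntry? b with
      | none =>
        simp only [hb, Option.some.injEq] at h
        subst h
        exact ⟨ρ₀', by simp [reconS, h₀', hb], hl₀⟩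
      | some e =>
        obtain ⟨tag₁, l₁, q₁⟩ := e
        simp only [hb] at h
        by_cases hl₁ : l₁ = l
        -- An earlier entry for the same location: it may have counted before, but is now hidden by
        -- the appended one.
        · subst hl₁
          refine ⟨ρ₀', by simp [reconS, h₀', hb, hl₀], fun l' => ?_⟩
          by_cases hl : l' = l₁
          · simp [hl₀, hl]
          · have hll : (l' == l₁) = false := by simpa using hl
            cases hρ : ρ₀.lookup l₁ with
            | none =>
              simp only [hρ, Option.bind_eq_some_iff, Option.some.injEq] at h
              obtain ⟨d₁, -, rfl⟩ := h
              simp [hl₀, hl, List.lookup_cons, hll]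
            | some c =>
              simp only [hρ, Option.some.injEq] at h
              subst h
              simp [hl₀, hl]
        · cases hρ : ρ₀.lookup l₁ with
          | none =>
            simp only [hρ, Option.bind_eq_some_iff, Option.some.injEq] at h
            obtain ⟨d₁, hd₁, rfl⟩ := h
            refine ⟨(l₁, d₁) :: ρ₀', by simp [reconS, h₀', hb, hl₀, hl₁, hρ, hd₁], fun l' => ?_⟩
            by_cases hl' : l' = l₁
            · simp [hl', hl₁]
            · have hll : (l' == l₁) = false := by simpa using hl'
              simp [List.lookup_cons, hll, hl₀]
          | some c =>
            simp only [hρ, Option.some.injEq] at h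
            subst h
            exact ⟨ρ₀', by simp [reconS, h₀', hb, hl₀, hl₁, hρ], hl₀⟩
    | _ => simp [reconS] at h

/-! ## Agreement of the machine with the rewriting system -/

/-- The forest agrees with the store of the machine and with the reconstructed store. -/
structure Sync (D : Set Loc) (δ : Loc → DExp) (τ : Loc → LExp) (S : Set Loc) (past : List CExp)
    (σ : CStore) : Prop extends Forest D δ τ S where
  store : ∀ l ∈ D, (σ.lookup l = some (thunk l (δ l)) ∧ Lazy D [] (δ l)) ∨
    (σ.lookup l = some (valC (δ l)) ∧ Val D (δ l))
  recon : ∃ ρ, reconS past = some ρ ∧ ∀ l ∈ D, ρ.lookup l = some (δ l)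

theorem Lazy.storeEntry?_quo {D : Set Loc} {d} (h : Lazy D [] d) :
    storeEntry? (quo [] d) = none := by
  cases h <;> simp_all [quo, list, Tag.exp, storeEntry?]

theorem storeEntry?_quo_delay (d : DExp) : storeEntry? (quo [] (.delay d)) = none := by
  simp [quo, list, Tag.exp, storeEntry?]

theorem storeEntry?_value (v : CExp) : storeEntry? (list [Tag.value.exp, v]) = none := by
  simp [list, Tag.exp, storeEntry?]

section
variable {D : Set Loc} {δ : Loc → DExp} {τ : Loc → LExp} {S : Set Loc} {past : List CExp}
  {σ : CStore}

theorem Forest.mono (h : Forest D δ τ S) {S' : Set Loc} (hS : S ⊆ S') : Forest D δ τ S' :=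
  { h with idle := fun l hl hn => h.idle l hl fun hl' => hn (hS hl') }

theorem Sync.mono (h : Sync D δ τ S past σ) {S' : Set Loc} (hS : S ⊆ S') :
    Sync D δ τ S' past σ :=
  { h with toForest := h.toForest.mono hS }

theorem Sync.plain (h : Sync D δ τ S past σ) {a : CExp} (ha : storeEntry? a = none) (ms : CExp) :
    Sync D δ τ S (past ++ [.cons a ms]) σ :=
  { h with recon := by rw [reconS_append_plain ha]; exact h.recon }

/-- Old trees do not mention the new location and stay as they are. The new tree is made of old
ones: a fresh label around the delayed expression, or the tree of a location that is delayed again.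
-/
theorem Forest.alloc (h : Forest D δ τ S) {l : Loc} (hl : l ∉ D) {d : DExp} (hd : Lazy D [] d)
    {t : LExp} (ht : t = .lab l (d.lift τ) ∨ ∃ l', d = .loc l' ∧ t = τ l') :
    Forest (insert l D) (Function.update δ l d) (Function.update τ l t) S := by
  have hne : ∀ l' ∈ D, l' ≠ l := fun l' hl' he => hl (he ▸ hl')
  have hτ : ∀ l' ∈ D, Function.update τ l t l' = τ l' := fun l' hl' =>
    Function.update_of_ne (hne l' hl') _ _
  have hD : D ⊆ insert l D := Set.subset_insert _ _
  have hdc : Consistent (Function.update τ l t) (insert l D) (d.lift τ) :=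
    (Consistent.lift h.consistent hd.scoped).congr hτ hD
  constructor
  · rintro l' (rfl | hl')
    · rw [Function.update_self]
      rcases ht with rfl | ⟨l'', rfl, rfl⟩
      · exact ⟨⟨Set.mem_insert _ _, Function.update_self ..⟩, hdc⟩
      · exact hdc
    · rw [hτ l' hl']
      exact (h.consistent l' hl').congr hτ hD
  · rintro l' (rfl | hl')
    · rw [Function.update_self]
      rcases ht with rfl | ⟨l'', rfl, rfl⟩
      · trivial
      · exact h.labeled l'' hd.scoped
    · rw [hτ l' hl']
      exact h.labeled l' hl'
  · rintro l' (rfl | hl')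
    · rw [Function.update_self]
      have := hd.closed_lift h.closed
      rcases ht with rfl | ⟨l'', rfl, rfl⟩
      · intro x a
        simp [LExp.subst, this x a]
      · exact this
    · rw [hτ l' hl']
      exact h.closed l' hl'
  · rintro l' (rfl | hl')
    · rw [Function.update_self]
      exact (hd.mono hD).scoped
    · rw [Function.update_of_ne (hne l' hl')]
      have := h.inScope l' hl'
      clear hdc ht hτ
      generalize δ l' = c at this ⊢
      induction c with
      | loc => exact hD this
      | forceAt => exact this.elim
      | _ => simp_all [Scoped]
  · rintro l' (rfl | hl') hn
    · rw [Function.update_self, Function.update_self]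
      rcases ht with rfl | ⟨l'', rfl, rfl⟩
      · left
        rw [lift_congr hτ hd.scoped]
      · exact Or.inr ⟨l'', rfl, (hτ l'' hd.scoped).symm⟩
    · rw [hτ l' hl', Function.update_of_ne (hne l' hl')]
      rcases h.idle l' hl' hn with h' | ⟨l'', h', h''⟩
      · left
        rwa [lift_congr hτ (h.inScope l' hl')]
      · refine Or.inr ⟨l'', h', ?_⟩
        have := h.inScope l' hl'
        rw [h'] at this
        rw [hτ l'' this, h'']

theorem Sync.alloc (h : Sync D δ τ S past σ) {l : Loc} (hl : l ∉ D) {d : DExp} (hd : Lazy D [] d)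
    {t : LExp} (ht : t = .lab l (d.lift τ) ∨ ∃ l', d = .loc l' ∧ t = τ l') (ms : CExp) :
    Sync (insert l D) (Function.update δ l d) (Function.update τ l t) S
      (past ++ [.cons (list [Tag.loc.exp, .loc l, quo [] d]) ms]) ((l, thunk l d) :: σ) where
  toForest := h.toForest.alloc hl hd ht
  store := by
    have hD : D ⊆ insert l D := Set.subset_insert _ _
    rintro l' (rfl | hl')
    · left
      simp only [Function.update_self, List.lookup_cons_self, true_and]
      exact hd.mono hD
    · have hne : l' ≠ l := fun he => hl (he ▸ hl')
      have hll : (l' == l) = false := by simpa using hne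
      simp only [Function.update_of_ne hne, List.lookup_cons, hll]
      exact (h.store l' hl').imp (And.imp_right (Lazy.mono · hD)) (And.imp_right (Val.mono · hD))
  recon := by
    obtain ⟨ρ, hρ, hl₀⟩ := h.recon
    obtain ⟨ρ', hρ', hl₁⟩ := reconS_append_entry (a := list [Tag.loc.exp, .loc l, quo [] d])
      (tag := .loc) (l := l) (q := quo [] d) (by simp [list, Tag.exp, storeEntry?])
      hd.unquo_quo ms past hρ
    refine ⟨ρ', hρ', ?_⟩
    rintro l' (rfl | hl')
    · simp [hl₁]
    · have hne : l' ≠ l := fun he => hl (he ▸ hl')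
      rw [hl₁, if_neg hne, Function.update_of_ne hne, hl₀ l' hl']

/-- Completion changes the record of `l`, not its tree, which has followed every rewriting step. By
`ht` the record is up to date again, so `l` may leave the set under evaluation. -/
theorem Sync.complete (h : Sync D δ τ S past σ) {S' : Set Loc} {l : Loc} (hS : S ⊆ insert l S')
    {v : DExp} (hv : Val D v)
    (ht : τ l = .lab l (v.lift τ) ∨ ∃ l', v = .loc l' ∧ τ l = τ l') (ms : CExp) :
    Sync D (Function.update δ l v) τ S'
      (past ++ [.cons (list [Tag.val.exp, .loc l, list [Tag.value.exp, valC v]]) ms])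
      ((l, valC v) :: σ) where
  consistent := h.consistent
  labeled := h.labeled
  closed := h.closed
  inScope l' hl' := by
    by_cases hll : l' = l
    · rw [hll, Function.update_self]
      exact hv.scoped
    · rw [Function.update_of_ne hll]
      exact h.inScope l' hl'
  idle l' hl' hn := by
    by_cases hll : l' = l
    · subst hll
      rwa [Function.update_self]
    · rw [Function.update_of_ne hll]
      exact h.idle l' hl' fun hs => (hS hs).elim hll hn
  store l' hl' := by
    by_cases hll : l' = l
    · subst hll
      right
      simp [hv]
    · have hb : (l' == l) = false := by simpa using hll
      simp only [Function.update_of_ne hll, List.lookup_cons, hb]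
      exact h.store l' hl'
  recon := by
    obtain ⟨ρ, hρ, hl₀⟩ := h.recon
    obtain ⟨ρ', hρ', hl₁⟩ := reconS_append_entry
      (a := list [Tag.val.exp, .loc l, list [Tag.value.exp, valC v]])
      (tag := .val) (l := l) (q := list [Tag.value.exp, valC v])
      (by simp [list, Tag.exp, storeEntry?]) hv.unquo_list ms past hρ
    refine ⟨ρ', hρ', fun l' hl' => ?_⟩
    by_cases hll : l' = l
    · simp [hl₁, hll]
    · rw [hl₁, if_neg hll, Function.update_of_ne hll, hl₀ l' hl']

/-- Forcing a location that already holds a value makes the machine write this value once more,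
without output. -/
theorem Sync.restore (h : Sync D δ τ S past σ) {l : Loc} {c : CExp}
    (hl : σ.lookup l = some c) : Sync D δ τ S past ((l, c) :: σ) :=
  { h with
    store := fun l' hl' => by
      by_cases hll : l' = l
      · subst hll
        simpa [hl] using h.store l' hl'
      · have hb : (l' == l) = false := by simpa using hll
        simpa only [List.lookup_cons, hb] using h.store l' hl' }

/-- The control string `C` in a stack is displayed as the labeled expression `r` in that stack. -/
structure Shows (D : Set Loc) (τ : Loc → LExp) (K : Stack) (C : DExp) (r : LExp) : Prop where
  inScope : Scoped D C
  unlabel : (C.lift τ).unlabel = r.unlabel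
  disjoint : ∀ l ∈ K.locs, l ∉ (C.lift τ).labels

theorem Sync.explains {K : Stack} {a ms : CExp} (h : Sync D δ τ K.locs (past ++ [.cons a ms]) σ)
    (hK : K.WF D) {C C₀ : DExp} (ha : reconC a = some C₀) (hms : reconE ms C₀ = some (K.ctl C))
    {r : LExp} (hC : Shows D τ K C r) (hr : Consistent τ D (K.tree τ r)) :
    Explains past a ms (K.tree τ r) := by
  intro C' ρ d hC' hρ hs
  rw [ha, Option.bind_some, hms, Option.some.injEq] at hC'
  subst hC'
  obtain ⟨ρ', hρ', hl⟩ := h.recon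
  rw [hρ', Option.some.injEq] at hρ
  subst hρ
  exact h.toForest.synth hK hC.inScope hr hC.unlabel hC.disjoint hl hs

/-- The machine has displayed the labeled expression `t`, which rewrites to `r` in the stack `K`. -/
structure Inv (D : Set Loc) (δ : Loc → DExp) (τ : Loc → LExp) (K : Stack) (past : List CExp)
    (σ : CStore) (t r : LExp) : Prop where
  sync : Sync D δ τ K.locs past σ
  wf : K.WF D
  consistent : Consistent τ D (K.tree τ r)
  steps : LRSteps t (K.tree τ r)

variable {K : Stack} {t r : LExp} {new : CStore → Loc} {n : ℕ} {KK : Kont} {m : Mark}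
  {b q : CExp}

theorem Inv.shows (h : Inv D δ τ K past σ t r) {C : DExp} (hC : Scoped D C)
    (hu : (C.lift τ).unlabel = r.unlabel) (hl : (C.lift τ).labels ⊆ r.labels) :
    Shows D τ K C r :=
  ⟨hC, hu, fun l hl' hm => (h.consistent.of_tree.2 l hl').1 (hl hm)⟩

theorem Inv.output (h : Inv D δ τ K past σ t r) (hq : q.isValue = true)
    (hs : storeEntry? q = none) {C₀ C : DExp} (hu : unquo q = some C₀)
    (hm : (marks KK m).isValue = true) (hms : reconE (marks KK m) C₀ = some (K.ctl C))
    (hC : Shows D τ K C r)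
    (hnext : ∀ past' t', Inv D δ τ K past' σ t' r →
      Ok new n past' t' ⟨CExp.subst (.tmp 9) (.num 42) b, σ, KK, m⟩) :
    Ok new n past t ⟨emit q b, σ, KK, m⟩ := by
  have hsync := h.sync.plain hs (marks KK m)
  refine Ok.of_steps h.steps (Ok.emit_marks hq hm ?_ (hnext _ _ ⟨hsync, h.wf, h.consistent, .refl⟩))
  exact hsync.explains h.wf (by simp [reconC, hs, hu]) hms hC h.consistent

theorem Inv.lrStep (h : Inv D δ τ K past σ t r) {d : DExp} (hd : Scoped D d)
    (hdc : (d.lift τ).Closed) (hc : Contract (K.tree τ r).labels r (d.lift τ)) :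
    ∃ τ', Inv D δ τ' K past σ t (d.lift τ') := by
  obtain ⟨τ', hF, hstep, hcon⟩ := h.sync.toForest.lrStep h.wf h.consistent hd hdc hc
  exact ⟨τ', { h.sync with toForest := hF }, h.wf, hcon, h.steps.tail hstep⟩

theorem Inv.notMem_labels (h : Inv D δ τ K past σ t r) {l : Loc} (hl : l ∉ D) :
    l ∉ (K.tree τ r).labels := fun hm => hl (h.consistent.mem_dom hm)

/-- A `delay` causes two outputs, the expression and then the new location; both display the same
program, and λLR does not move. The caller chooses the tree `tl`, since a fresh label enters the
program only with a later contraction. `G` is the part of the control string around the `delay`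
inside its operation. -/
theorem Inv.delay (hnew : ∀ σ : CStore, σ.lookup (new σ) = none)
    (h : Inv D δ τ K past σ t r) {d : DExp} (hd : Lazy D [] d)
    (hm : (marks KK m).isValue = true) {G : DExp → DExp}
    (hG : ∀ C, reconE (marks KK m) C = some (K.ctl (G C)))
    (hC₁ : Shows D τ K (G (.delay d)) r) {tl : LExp}
    (htl : tl = .lab (new σ) (d.lift τ) ∨ ∃ l', d = .loc l' ∧ tl = τ l')
    (hC₂ : new σ ∉ D →
      Shows (insert (new σ) D) (Function.update τ (new σ) tl) K (G (.loc (new σ))) r)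
    (hnext : ∀ past' t', new σ ∉ D →
      Inv (insert (new σ) D) (Function.update δ (new σ) d) (Function.update τ (new σ) tl) K past'
        ((new σ, thunk (new σ) d) :: σ) t' r →
      Ok new n past' t' ⟨.loc (new σ), (new σ, thunk (new σ) d) :: σ, KK, m⟩) :
    Ok new n past t ⟨anno (.delay d), σ, KK, m⟩ := by
  -- All locations of `D` have entries in the store.
  have hl : new σ ∉ D := fun hl => by
    have := h.sync.store _ hl
    simp [hnew σ] at this
  set l := new σ with hlσ
  have hne : ∀ l' ∈ D, l' ≠ l := fun l' hl' he => hl (he ▸ hl')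
  have hτ : ∀ l' ∈ D, Function.update τ l tl l' = τ l' := fun l' hl' =>
    Function.update_of_ne (hne l' hl') _ _
  simp only [anno]
  refine h.output (isValue_quo_delay hd) (storeEntry?_quo_delay d) (unquo_quo_delay hd) hm (hG _) hC₁
    fun past' t' h' => ?_
  simp only [letIn, emit, list, CExp.subst, Tag.exp, quoVar, subst_tmp_quo,
    subst_tmp_anno, List.foldr_cons, List.foldr_nil]
  simp only [Name.tmp.injEq, Nat.reduceEqDiff, if_false,
    if_true]
  refine Ok.letIn (x := vl) (Ok.silent rfl (Ok.beta rfl ?_))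
  simp only [CExp.subst, subst_tmp_quo, subst_tmp_anno]
  simp only [Name.tmp.injEq, Nat.reduceEqDiff, if_false,
    if_true]
  have hsync := h'.sync.alloc hl hd htl (marks KK m)
  have htree := fun r => Stack.tree_congr hτ h'.wf r
  have hD : D ⊆ insert l D := Set.subset_insert _ _
  have hinv : Inv (insert l D) (Function.update δ l d) (Function.update τ l tl) K
      (past' ++ [.cons (list [Tag.loc.exp, .loc l, quo [] d]) (marks KK m)])
      ((l, thunk l d) :: σ) (K.tree τ r) r :=
    ⟨hsync, h'.wf.mono hD, by rw [htree]; exact h'.consistent.congr hτ hD,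
      by rw [htree]⟩
  refine Ok.of_steps h'.steps ?_
  refine Ok.emit_marks (q := list [Tag.loc.exp, .loc l, quo [] d]) ?_ hm ?_ ?_
  · simp [list, Tag.exp, CExp.isValue, hd.isValue_quo]
  · rw [← htree]
    exact hsync.explains hinv.wf (C₀ := .loc l) (by simp [reconC, list, Tag.exp, storeEntry?])
      (hG _) (hC₂ hl) hinv.consistent
  · simp only [CExp.subst, subst_tmp_anno]
    simp only [Name.tmp.injEq, Nat.reduceEqDiff, if_false,
      if_true]
    -- The output has not touched the store, so `delay` allocates the location that `alloc`
    -- announced.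
    refine Ok.silent rfl ?_
    exact hnext _ _ hl hinv

end

/-! ## The simulation -/

/-- All outputs are explained from configurations that evaluate an expression. -/
def EvalOk (new : CStore → Loc) (n : ℕ) : Prop :=
  ∀ {D δ τ K past σ t d}, Lazy D [] d → Inv D δ τ K past σ t (d.lift τ) →
    Ok new n past t ⟨anno d, σ, K.kont, K.mark⟩

/-- All outputs are explained from configurations that return a value. -/
def ReturnOk (new : CStore → Loc) (n : ℕ) : Prop :=
  ∀ {D δ τ K past σ t v}, Val D v → Inv D δ τ K past σ t (v.lift τ) →
    Ok new n past t ⟨valC v, σ, K.kont, K.mark⟩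

/-- All outputs are explained from configurations that force a value. -/
def ForceOk (new : CStore → Loc) (n : ℕ) : Prop :=
  ∀ {D δ τ F K past σ t v ls}, Val D v → F.WF D →
    Inv D δ τ K past σ t (F.tree τ (LExp.wrap ls (v.lift τ))) →
    Ok new n past t ⟨valC v, σ, Stack.forceKont F K, none⟩

section
variable {D : Set Loc} {δ : Loc → DExp} {τ : Loc → LExp} {past : List CExp} {σ : CStore}
  {K : Stack} {t r : LExp} {new : CStore → Loc} {n : ℕ} {F : OpFrame} {ls : List Label}

/-- Two nested `let`s with their marks are opened, one for the operand of the operation and one for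
the argument of `force`; together they form the continuation of the frame `(F, none)`. -/
theorem Inv.op_succ (hF : F.WF D) {d : DExp}
    (h : Ok new n past t ⟨anno d, σ, Stack.kont ((F, none) :: K), some forceMark⟩) :
    Ok new (n + 1) past t
      ⟨letIn F.var (.wcm F.mark (anno (.force d))) F.body, σ, K.kont, K.mark⟩ :=
  Ok.letIn_succ (Ok.wcm hF.isValue_mark (Ok.letIn (Ok.wcm rfl h)))

theorem Inv.push (h : Inv D δ τ K past σ t (F.tree τ r)) (hF : F.WF D) :
    Inv D δ τ ((F, none) :: K) past σ t r :=
  ⟨h.sync, fun f hf => by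
    rcases List.mem_cons.1 hf with rfl | hf
    exacts [hF, h.wf f hf], h.consistent, h.steps⟩

/-- Output of a value that results from a reduction. -/
theorem Inv.emit_value (hR : ReturnOk new n) {v : DExp} (hv : Val D v)
    (h : Inv D δ τ K past σ t (v.lift τ)) :
    Ok new n past t
      ⟨emit (list [Tag.value.exp, valC v]) (valC v), σ, K.kont, K.mark⟩ := by
  refine h.output ?_ (storeEntry?_value _) hv.unquo_list h.wf.isValue_marks (h.wf.reconE _)
    (h.shows hv.scoped rfl (Finset.Subset.refl _)) fun past' t' h' => ?_
  · simp [list, Tag.exp, CExp.isValue, hv.isValue_valC]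
  · rw [subst_tmp_valC]
    exact hR hv h'

/-- Output of an expression that results from a reduction. -/
theorem Inv.emit_lazy (hE : EvalOk new n) {d : DExp} (hd : Lazy D [] d)
    (h : Inv D δ τ K past σ t (d.lift τ)) :
    Ok new n past t ⟨emit (quo [] d) (anno d), σ, K.kont, K.mark⟩ := by
  refine h.output hd.isValue_quo hd.storeEntry?_quo hd.unquo_quo h.wf.isValue_marks (h.wf.reconE _)
    (h.shows hd.scoped rfl (Finset.Subset.refl _)) fun past' t' h' => ?_
  rw [subst_tmp_anno]
  exact hE hd h'

theorem closed_num (n : ℤ) : (LExp.num n).Closed := fun _ _ => rfl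

theorem reconE_app₂ {v : DExp} (hv : Val D v) (hK : K.WF D) (f : Frame) (C : DExp) :
    reconE (marks ((f, K.mark) :: K.kont)
      (some (list [Tag.app₂.exp, list [Tag.value.exp, valC v]]))) C = some (K.ctl (.app v C)) := by
  have := hv.unquo_list
  simp only [list, List.foldr_cons, List.foldr_nil, Tag.exp] at this
  simp [marks, reconE, list, Tag.exp, reconFrame, listElems, this, hK.reconE]

theorem reconE_cons₁ {d : DExp} (hd : Lazy D [] d) (hK : K.WF D) (f : Frame) (C : DExp) :
    reconE (marks ((f, K.mark) :: K.kont)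
      (some (list [Tag.cons₁.exp, quo [] (.delay d)]))) C = some (K.ctl (.cons C (.delay d))) := by
  simp [marks, reconE, list, Tag.exp, reconFrame, listElems, unquo_quo_delay hd, hK.reconE]

theorem reconE_cons₂ {v : DExp} (hv : Val D v) (hK : K.WF D) (f : Frame) (C : DExp) :
    reconE (marks ((f, K.mark) :: K.kont)
      (some (list [Tag.cons₂.exp, list [Tag.value.exp, valC v]]))) C = some (K.ctl (.cons v C)) := by
  have := hv.unquo_list
  simp only [list, List.foldr_cons, List.foldr_nil, Tag.exp] at this
  simp [marks, reconE, list, Tag.exp, reconFrame, listElems, this, hK.reconE]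

/-- Application of a forced value. -/
theorem Inv.app (hnew : ∀ σ : CStore, σ.lookup (new σ) = none) (hE : EvalOk new n)
    {v d : DExp} (hv : Val D v) (hd : Lazy D [] d)
    (h : Inv D δ τ K past σ t (.app (LExp.wrap ls (v.lift τ)) (d.lift τ))) :
    Ok new n past t ⟨letIn v1 (.wcm (list [Tag.app₂.exp, list [Tag.value.exp, valC v]])
      (anno (.delay d))) (.app (valC v) (.var v1)), σ, K.kont, K.mark⟩ := by
  have hM : (list [Tag.app₂.exp, list [Tag.value.exp, valC v]]).isValue = true := by
    simp [list, Tag.exp, CExp.isValue, hv.isValue_valC]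
  refine Ok.letIn (Ok.wcm hM ?_)
  have hsub : (v.lift τ).labels ⊆ (LExp.wrap ls (v.lift τ)).labels := labels_wrap _ _
  -- The operand receives a fresh label even if it is a location already, as β of λLR prescribes.
  refine h.delay hnew hd (G := DExp.app v) (tl := .lab (new σ) (d.lift τ)) ?_
    (reconE_app₂ hv h.wf _) ?_ (Or.inl rfl) ?_ ?_
  · simp only [marks, CExp.isValue, hM, h.wf.isValue_marks, Bool.and_self]
  · refine h.shows ⟨hv.scoped, hd.scoped⟩ (by simp [DExp.lift, LExp.unlabel, unlabel_wrap]) ?_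
    simp only [DExp.lift, LExp.labels]
    exact Finset.union_subset_union hsub (Finset.Subset.refl _)
  · intro hlD
    have hD : D ⊆ insert (new σ) D := Set.subset_insert _ _
    have hτ : ∀ l' ∈ D, Function.update τ (new σ) (.lab (new σ) (d.lift τ)) l' = τ l' := fun l' hl' =>
      Function.update_of_ne (by rintro rfl; exact hlD hl') _ _
    refine ⟨⟨(hv.mono hD).scoped, Set.mem_insert _ _⟩, ?_, ?_⟩
    · simp only [DExp.lift, lift_congr hτ hv.scoped, Function.update_self, LExp.unlabel,
        unlabel_wrap]
    · intro l' hl' hm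
      have hd' := h.consistent.of_tree.2 l' hl'
      simp only [DExp.lift, lift_congr hτ hv.scoped, Function.update_self, LExp.labels,
        Finset.mem_union, Finset.mem_insert] at hm
      rcases hm with hm | rfl | hm
      · exact hd'.1 (by simp [LExp.labels, hsub hm])
      · exact h.notMem_labels hlD (Stack.locs_subset_labels _ _ _ hl')
      · exact hd'.1 (by simp [LExp.labels, hm])
  · intro past' t' hlD h'
    have hD : D ⊆ insert (new σ) D := Set.subset_insert _ _
    have hτ : ∀ l' ∈ D, Function.update τ (new σ) (.lab (new σ) (d.lift τ)) l' = τ l' := fun l' hl' =>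
      Function.update_of_ne (by rintro rfl; exact hlD hl') _ _
    refine Ok.beta rfl ?_
    simp only [CExp.subst, subst_tmp_valC, if_true]
    refine Ok.silent rfl (Ok.ret hv.isValue_valC rfl ?_)
    cases hv with
    | @lam x b hb =>
      have hb' : Lazy (insert (new σ) D) [] (b.substLoc x (new σ)) :=
        (hb.mono hD).substLoc (by simp) (Set.mem_insert _ _)
      refine Ok.beta rfl ?_
      simp only [letIn, emit, CExp.subst, hb.subst_src_anno, subst_src_quo,
        List.not_mem_nil, if_false, reduceCtorEq, DExp.substLoc, if_true]
      -- The value of this `let` is the quoted source of the abstraction; it serves reconstruction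
      -- only and is discarded here.
      refine Ok.letIn (x := .tmp 9) (Ok.beta (Lazy.lam hb).isValue_quo ?_)
      simp only [CExp.subst, subst_tmp_quo, if_true]
      have hcl : ((b.substLoc x (new σ)).lift (Function.update τ (new σ) (.lab (new σ) (d.lift τ)))).Closed :=
        hb'.closed_lift h'.sync.closed
      have hlift := lift_substLoc h'.sync.closed (hb.mono hD).scoped x (new σ)
      obtain ⟨τ', h''⟩ := h'.lrStep hb'.scoped hcl (by
        rw [hlift, Function.update_self, lift_congr hτ hb.scoped]
        refine .beta _ _ _ _ _ ?_
        -- The allocation has not changed the trees of the program, so the new location is a fresh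
        -- label.
        rw [Stack.tree_congr hτ h.wf]
        exact h.notMem_labels hlD)
      exact h''.emit_lazy hE hb'
    | _ => exact ok_of_stuck rfl

/-- A binary operation on forced values. -/
theorem Inv.prim2 (hR : ReturnOk new n) {p : P2} {w v : DExp} {ls' : List Label}
    (hw : Val D w) (hv : Val D v)
    (h : Inv D δ τ K past σ t (.prim2 p (LExp.wrap ls' (w.lift τ)) (LExp.wrap ls (v.lift τ)))) :
    Ok new n past t ⟨letIn v2 (.prim2 p (valC w) (valC v)) (emit (quoVar v2) (.var v2)),
      σ, K.kont, K.mark⟩ := by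
  refine Ok.letIn (Ok.silent rfl (Ok.ret hw.isValue_valC rfl ?_))
  have hstep := fun m K' m' => step_value (new := new) (σ := σ) (m := m) (K := K') (m' := m')
    hv.isValue_valC (.prim2₂ p (valC w))
  cases hw with
  | num n₁ =>
    cases hv with
    | num n₂ =>
      cases hδ : delta p n₁ n₂ with
      -- Where `delta` is undefined the machine is stuck, and no further output needs an
      -- explanation.
      | none => exact ok_of_stuck (by rw [hstep]; simp [valC, anno, ret, hδ])
      | some n₃ =>
        refine Ok.silent (s' := ⟨.num n₃, σ,
          (.app₂ (.lam v2 (emit (quoVar v2) (.var v2))), K.mark) :: K.kont, none⟩)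
          (by rw [hstep]; simp only [valC, anno, ret, hδ, Option.map_some]) (Ok.beta rfl ?_)
        obtain ⟨τ', h'⟩ := h.lrStep (d := .num n₃) trivial (closed_num n₃) (.prim _ _ _ _ _ _ hδ)
        exact h'.emit_value hR (.num n₃)
    | _ => exact ok_of_stuck (by rw [hstep]; rfl)
  | _ => exact ok_of_stuck (by rw [hstep]; rfl)

/-- A projection of a forced value. -/
theorem Inv.prim1 (hR : ReturnOk new n) {p : P1} {v : DExp} (hv : Val D v)
    (h : Inv D δ τ K past σ t (.prim1 p (LExp.wrap ls (v.lift τ)))) :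
    Ok new n past t ⟨letIn v1 (.prim1 p (valC v)) (emit (quoVar v1) (.var v1)),
      σ, K.kont, K.mark⟩ := by
  refine Ok.letIn (Ok.silent rfl ?_)
  have hstep := fun m K' m' => step_value (new := new) (σ := σ) (m := m) (K := K') (m' := m')
    hv.isValue_valC (.prim1 p)
  cases hv with
  | @cons l₁ l₂ h₁ h₂ =>
    have hF := h.sync.toForest
    cases p with
    | car =>
      refine Ok.silent (s' := ⟨.loc l₁, σ,
        (.app₂ (.lam v1 (emit (quoVar v1) (.var v1))), K.mark) :: K.kont, none⟩) (by rw [hstep]; rfl) (Ok.beta rfl ?_)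
      obtain ⟨τ', h'⟩ := h.lrStep (d := .loc l₁) h₁ (hF.closed _ h₁)
        (.car _ _ _ (hF.labeled _ h₁) (hF.labeled _ h₂))
      exact h'.emit_value hR (.loc h₁)
    | cdr =>
      refine Ok.silent (s' := ⟨.loc l₂, σ,
        (.app₂ (.lam v1 (emit (quoVar v1) (.var v1))), K.mark) :: K.kont, none⟩) (by rw [hstep]; rfl) (Ok.beta rfl ?_)
      obtain ⟨τ', h'⟩ := h.lrStep (d := .loc l₂) h₂ (hF.closed _ h₂)
        (.cdr _ _ _ (hF.labeled _ h₁) (hF.labeled _ h₂))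
      exact h'.emit_value hR (.loc h₂)
  | _ => exact ok_of_stuck (by rw [hstep]; cases p <;> rfl)

/-- A conditional with a forced test. -/
theorem Inv.ite (hE : EvalOk new n) {v d₂ d₃ : DExp} (hv : Val D v) (hd₂ : Lazy D [] d₂)
    (hd₃ : Lazy D [] d₃)
    (h : Inv D δ τ K past σ t (.ite (LExp.wrap ls (v.lift τ)) (d₂.lift τ) (d₃.lift τ))) :
    Ok new n past t ⟨.ite (valC v) (emit (quo [] d₂) (anno d₂)) (emit (quo [] d₃) (anno d₃)),
      σ, K.kont, K.mark⟩ := by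
  refine Ok.silent rfl ?_
  have hstep := fun m K' m' => step_value (new := new) (σ := σ) (m := m) (K := K') (m' := m')
    hv.isValue_valC
    (.ite (emit (quo [] d₂) (anno d₂)) (emit (quo [] d₃) (anno d₃)))
  have hF := h.sync.toForest
  cases hv with
  | bool b =>
    cases b with
    | true =>
      refine Ok.silent (hstep _ _ _) ?_
      obtain ⟨τ', h'⟩ := h.lrStep hd₂.scoped (hd₂.closed_lift hF.closed) (.iteTrue _ _ _)
      exact h'.emit_lazy hE hd₂
    | false =>
      refine Ok.silent (hstep _ _ _) ?_
      obtain ⟨τ', h'⟩ := h.lrStep hd₃.scoped (hd₃.closed_lift hF.closed) (.iteFalse _ _ _)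
      exact h'.emit_lazy hE hd₃
  | _ => exact ok_of_stuck (by rw [hstep]; rfl)

/-- The machine does not keep the labels `ls` around the forced value. Erasure hides the difference,
and having fewer labels cannot bring in a location under evaluation. -/
theorem Inv.shows_ctl {v : DExp} (hv : Val D v) (hF : F.WF D)
    (h : Inv D δ τ K past σ t (F.tree τ (LExp.wrap ls (v.lift τ)))) :
    Shows D τ K (F.ctl v) (F.tree τ (LExp.wrap ls (v.lift τ))) := by
  have hsub : (v.lift τ).labels ⊆ (LExp.wrap ls (v.lift τ)).labels := labels_wrap _ _
  refine h.shows ?_ ?_ fun l hl => ?_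
  · cases F with
    | app d | prim2L p d =>
      have hd : Scoped D d := Lazy.scoped hF
      exact ⟨hv.scoped, hd⟩
    | prim2R p w ls' => exact ⟨hF.1.scoped, hv.scoped⟩
    | prim1 p => exact hv.scoped
    | ite d₂ d₃ => exact ⟨hv.scoped, hF.1.scoped, hF.2.scoped⟩
  · cases F <;> simp [OpFrame.ctl, OpFrame.tree, DExp.lift, LExp.unlabel, unlabel_wrap]
  · cases F with
    | prim2R p w ls' =>
      simp only [OpFrame.ctl, OpFrame.tree, DExp.lift, LExp.labels, Finset.mem_union] at hl ⊢
      exact hl.imp (fun h => labels_wrap _ _ h) fun h => hsub h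
    | _ =>
      simp only [OpFrame.ctl, OpFrame.tree, DExp.lift, LExp.labels, Finset.mem_union] at hl ⊢
      have := @hsub l
      tauto

/-- Return of a forced value. -/
theorem Inv.forced (hnew : ∀ σ : CStore, σ.lookup (new σ) = none) (hE : EvalOk new n)
    (hR : ReturnOk new n) {v : DExp} (hv : Val D v) (hvl : v.NotLoc) (hF : F.WF D)
    (h : Inv D δ τ K past σ t (F.tree τ (LExp.wrap ls (v.lift τ)))) {m : Mark} :
    Ok new n past t ⟨valC v, σ, (.app₂ (.lam v1 forceTail), some F.mark) :: Stack.opKont F K, m⟩ := by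
  refine Ok.beta hv.isValue_valC ?_
  have hsubst : CExp.subst v1 (valC v) forceTail =
      emit (list [Tag.value.exp, valC v]) (valC v) := by
    simp [forceTail, emit, letIn, list, quoVar, CExp.subst, Tag.exp]
  rw [hsubst]
  have hmarks : marks (Stack.opKont F K) (some F.mark) =
      .cons F.mark (marks K.kont K.mark) := rfl
  refine h.output (C₀ := v) (C := F.ctl v) ?_ (storeEntry?_value _) hv.unquo_list ?_ ?_ ?_
    fun past' t' h' => ?_
  · simp [list, Tag.exp, CExp.isValue, hv.isValue_valC]
  · simp only [hmarks, CExp.isValue, hF.isValue_mark, h.wf.isValue_marks, Bool.and_self]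
  · simp only [hmarks, reconE, Option.bind_eq_bind, hF.reconFrame, Option.bind_some, h.wf.reconE]
  · exact h.shows_ctl hv hF
  · rw [subst_tmp_valC]
    refine Ok.beta hv.isValue_valC ?_
    cases F with
    | app d =>
      have : CExp.subst (OpFrame.app d).var (valC v) (OpFrame.app d).body =
          letIn v1 (.wcm (list [Tag.app₂.exp, list [Tag.value.exp, valC v]])
            (anno (.delay d))) (.app (valC v) (.var v1)) := by
        simp [OpFrame.var, OpFrame.body, letIn, list, quoVar, CExp.subst, Tag.exp]
      rw [this]
      exact h'.app hnew hE hv hF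
    | prim2L p d =>
      -- The evaluated left operand moves into the frame of the right one, where `ls` is remembered.
      have hF' : (OpFrame.prim2R p v ls).WF D := ⟨hv, hvl⟩
      have : CExp.subst (OpFrame.prim2L p d).var (valC v) (OpFrame.prim2L p d).body =
          letIn (OpFrame.prim2R p v ls).var (.wcm (OpFrame.prim2R p v ls).mark (anno (.force d)))
            (OpFrame.prim2R p v ls).body := by
        simp [OpFrame.var, OpFrame.body, OpFrame.mark, emit, letIn, list, quoVar,
          CExp.subst, Tag.exp]
      rw [this]
      exact (Inv.op_succ hF' (hE hF (Inv.push (F := .prim2R p v ls) h' hF'))).mono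
    | prim2R p w ls' =>
      have : CExp.subst (OpFrame.prim2R p w ls').var (valC v) (OpFrame.prim2R p w ls').body =
          letIn v2 (.prim2 p (valC w) (valC v)) (emit (quoVar v2) (.var v2)) := by
        simp [OpFrame.var, OpFrame.body, emit, letIn, list, quoVar, CExp.subst, Tag.exp]
      rw [this]
      exact h'.prim2 hR hF.1 hv
    | prim1 p =>
      have : CExp.subst (OpFrame.prim1 p).var (valC v) (OpFrame.prim1 p).body =
          letIn v1 (.prim1 p (valC v)) (emit (quoVar v1) (.var v1)) := by
        simp [OpFrame.var, OpFrame.body, emit, letIn, list, quoVar, CExp.subst, Tag.exp]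
      rw [this]
      exact h'.prim1 hR hv
    | ite d₂ d₃ =>
      have : CExp.subst (OpFrame.ite d₂ d₃).var (valC v) (OpFrame.ite d₂ d₃).body =
          .ite (valC v) (emit (quo [] d₂) (anno d₂))
            (emit (quo [] d₃) (anno d₃)) := by
        simp [OpFrame.var, OpFrame.body, emit, letIn, CExp.subst]
      rw [this]
      exact h'.ite hE hv hF.1 hF.2

end

-- Evaluation of `cons`, completion of delayed computations, and the induction.

section
variable {D : Set Loc} {δ : Loc → DExp} {τ : Loc → LExp} {past : List CExp} {σ : CStore}
  {K : Stack} {t r : LExp} {new : CStore → Loc} {n : ℕ} {F : OpFrame} {ls : List Label}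

theorem Lazy.eq_loc_of_isLabeled {d : DExp} (hd : Lazy D [] d) (h : (d.lift τ).IsLabeled) :
    ∃ l, d = .loc l := by
  cases hd with
  | loc => exact ⟨_, rfl⟩
  | _ => exact h.elim

/-- Evaluation of `cons`, where `t₁` and `t₂` are the trees for the two new locations. -/
theorem Inv.cons_trees (hnew : ∀ σ : CStore, σ.lookup (new σ) = none) (hR : ReturnOk new n)
    {d₁ d₂ : DExp} (hd₁ : Lazy D [] d₁) (hd₂ : Lazy D [] d₂)
    (h : Inv D δ τ K past σ t (.cons (d₁.lift τ) (d₂.lift τ))) {t₁ : LExp} {t₂ : Loc → LExp}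
    (ht₁ : t₁ = .lab (new σ) (d₁.lift τ) ∨ ∃ l', d₁ = .loc l' ∧ t₁ = τ l')
    (ht₂ : ∀ l₂, t₂ l₂ = .lab l₂ (d₂.lift τ) ∨ ∃ l', d₂ = .loc l' ∧ t₂ l₂ = τ l')
    (hu₁ : t₁.unlabel = (d₁.lift τ).unlabel) (hu₂ : ∀ l₂, (t₂ l₂).unlabel = (d₂.lift τ).unlabel)
    (hc : ∀ (D' : Set Loc) (δ' : Loc → DExp) (τ' : Loc → LExp) (past' : List CExp) (σ' : CStore)
      (t' : LExp) (l₁ l₂ : Loc), Inv D' δ' τ' K past' σ' t' (.cons (d₁.lift τ) (d₂.lift τ)) →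
      l₁ = new σ → l₁ ∈ D' → l₂ ∈ D' → τ' l₁ = t₁ → τ' l₂ = t₂ l₂ → l₁ ≠ l₂ →
      l₁ ∉ (K.tree τ' (.cons (d₁.lift τ) (d₂.lift τ))).labels →
      l₂ ∉ (K.tree τ' (.cons (d₁.lift τ) (d₂.lift τ))).labels →
      ∃ τ'', Inv D' δ' τ'' K past' σ' t' (.cons (τ'' l₁) (τ'' l₂))) :
    Ok new (n + 1) past t ⟨anno (.cons (.delay d₁) (.delay d₂)), σ, K.kont, K.mark⟩ := by
  have hM₁ : (list [Tag.cons₁.exp, quo [] (.delay d₂)]).isValue = true := by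
    simp [list, Tag.exp, CExp.isValue, isValue_quo_delay hd₂]
  refine Ok.letIn_succ (Ok.wcm hM₁ ?_)
  generalize hl₁ : new σ = l₁ at ht₁ hc
  have hD : D ⊆ insert l₁ D := Set.subset_insert _ _
  have hτ : l₁ ∉ D → ∀ l' ∈ D, Function.update τ l₁ t₁ l' = τ l' := fun hlD l' hl' =>
    Function.update_of_ne (by rintro rfl; exact hlD hl') _ _
  have hlab : t₁.labels ⊆ insert l₁ (d₁.lift τ).labels := by
    rcases ht₁ with rfl | ⟨l', rfl, rfl⟩
    · exact Finset.Subset.refl _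
    · exact Finset.subset_insert _ _
  refine h.delay hnew hd₁ (G := fun C => .cons C (.delay d₂)) (tl := t₁) ?_
    (reconE_cons₁ hd₂ h.wf _) ?_ (by rwa [hl₁]) ?_ ?_
  · simp only [marks, CExp.isValue, hM₁, h.wf.isValue_marks, Bool.and_self]
  · exact h.shows ⟨hd₁.scoped, hd₂.scoped⟩ rfl (Finset.Subset.refl _)
  · rw [hl₁]
    intro hlD
    refine ⟨⟨Set.mem_insert _ _, (hd₂.mono hD).scoped⟩, ?_, ?_⟩
    · simp only [DExp.lift, lift_congr (hτ hlD) hd₂.scoped, Function.update_self, LExp.unlabel, hu₁]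
    · intro l' hl' hm
      have hd' := h.consistent.of_tree.2 l' hl'
      simp only [DExp.lift, lift_congr (hτ hlD) hd₂.scoped, Function.update_self, LExp.labels,
        Finset.mem_union] at hm
      rcases hm with hm | hm
      · rcases Finset.mem_insert.1 (hlab hm) with rfl | hm
        · exact h.notMem_labels hlD (Stack.locs_subset_labels _ _ _ hl')
        · exact hd'.1 (by simp [LExp.labels, hm])
      · exact hd'.1 (by simp [LExp.labels, hm])
  · rw [hl₁]
    intro past₁ u₁ hlD h₁
    replace hτ := hτ hlD
    set τ₁ := Function.update τ l₁ t₁ with hτ₁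
    have hτ₁l : τ₁ l₁ = t₁ := Function.update_self ..
    refine Ok.beta rfl ?_
    have hsubst : CExp.subst v0 (.loc l₁) (letIn v1 (.wcm (list [Tag.cons₂.exp, quoVar v0])
        (anno (.delay d₂))) (.cons (.var v0) (.var v1))) =
        letIn v1 (.wcm (list [Tag.cons₂.exp, list [Tag.value.exp, valC (.loc l₁)]])
          (anno (.delay d₂))) (.cons (.loc l₁) (.var v1)) := by
      have hval : valC (.loc l₁) = .loc l₁ := rfl
      simp [letIn, list, quoVar, CExp.subst, Tag.exp, hval]
    rw [hsubst]
    have hv : Val (insert l₁ D) (.loc l₁) := .loc (Set.mem_insert _ _)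
    have hM₂ : (list [Tag.cons₂.exp, list [Tag.value.exp, valC (.loc l₁)]]).isValue = true := rfl
    refine Ok.letIn (Ok.wcm hM₂ ?_)
    set σ₁ := (l₁, thunk l₁ d₁) :: σ
    have hd₂' : d₂.lift τ₁ = d₂.lift τ := lift_congr hτ hd₂.scoped
    have hτm : ∀ l', d₂ = .loc l' → τ₁ l' = τ l' := by
      rintro l' rfl
      exact hτ l' hd₂.scoped
    have hdisj : ∀ l' ∈ K.locs, l' ∉ t₁.labels ∧ l' ∉ (d₂.lift τ).labels := fun l' hl' => by
      have hd' := (h.consistent.of_tree.2 l' hl').1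
      refine ⟨fun hm => ?_, fun hm => hd' (by simp [LExp.labels, hm])⟩
      rcases Finset.mem_insert.1 (hlab hm) with rfl | hm
      · exact h.notMem_labels hlD (Stack.locs_subset_labels _ _ _ hl')
      · exact hd' (by simp [LExp.labels, hm])
    generalize hl₂ : new σ₁ = l₂
    have hlab₂ : (t₂ l₂).labels ⊆ insert l₂ (d₂.lift τ).labels := by
      rcases ht₂ l₂ with heq | ⟨l', hl', heq⟩ <;> rw [heq]
      · exact Finset.Subset.refl _
      · rw [hl']
        exact Finset.subset_insert _ _
    refine h₁.delay hnew (hd₂.mono hD) (G := .cons (.loc l₁)) (tl := t₂ l₂) ?_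
      (reconE_cons₂ hv h₁.wf _) ?_ ?_ ?_ ?_
    · simp only [marks, CExp.isValue, hM₂, h₁.wf.isValue_marks, Bool.and_self]
    · refine ⟨⟨Set.mem_insert _ _, (hd₂.mono hD).scoped⟩, ?_, fun l' hl' => ?_⟩
      · simp only [DExp.lift, hd₂', hτ₁l, LExp.unlabel, hu₁]
      · simp only [DExp.lift, hd₂', hτ₁l, LExp.labels, Finset.mem_union, not_or]
        exact hdisj l' hl'
    · rw [hl₂, hd₂']
      exact (ht₂ l₂).imp_right fun ⟨l', h, h'⟩ => ⟨l', h, h'.trans (hτm l' h).symm⟩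
    · rw [hl₂]
      intro hl₂D
      have hne : l₁ ≠ l₂ := by rintro rfl; exact hl₂D (Set.mem_insert _ _)
      refine ⟨⟨Set.mem_insert_of_mem _ (Set.mem_insert _ _), Set.mem_insert _ _⟩, ?_,
        fun l' hl' => ?_⟩
      · simp only [DExp.lift, Function.update_of_ne hne, Function.update_self, hτ₁l, LExp.unlabel,
          hu₁, hu₂]
      · simp only [DExp.lift, Function.update_of_ne hne, Function.update_self, hτ₁l, LExp.labels,
          Finset.mem_union, not_or]
        refine ⟨(hdisj l' hl').1, fun hm => ?_⟩
        rcases Finset.mem_insert.1 (hlab₂ hm) with rfl | hm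
        · exact h₁.notMem_labels hl₂D (Stack.locs_subset_labels _ _ _ hl')
        · exact (hdisj l' hl').2 hm
    · rw [hl₂]
      intro past₂ u₂ hl₂D h₂
      have hne : l₁ ≠ l₂ := by rintro rfl; exact hl₂D (Set.mem_insert _ _)
      have hτ₂ : ∀ l' ∈ insert l₁ D, Function.update τ₁ l₂ (t₂ l₂) l' = τ₁ l' := fun l' hl' =>
        Function.update_of_ne (by rintro rfl; exact hl₂D hl') _ _
      refine Ok.beta rfl ?_
      simp only [CExp.subst, if_true]
      have hl₁D' : l₁ ∈ insert l₂ (insert l₁ D) := Set.mem_insert_of_mem _ (Set.mem_insert _ _)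
      have hl₂D' : l₂ ∈ insert l₂ (insert l₁ D) := Set.mem_insert _ _
      -- λLR labels both components in a single contraction, so any rewriting waits until both
      -- locations exist; the outputs up to here display the original `cons`.
      obtain ⟨τ'', h₃⟩ := hc _ _ _ _ _ _ l₁ l₂ h₂ rfl hl₁D' hl₂D'
        (by rw [Function.update_of_ne hne, hτ₁l]) (Function.update_self ..) hne
        (by
          rw [Stack.tree_congr hτ₂ h₁.wf, Stack.tree_congr hτ h.wf]
          exact h.notMem_labels hlD)
        (by
          rw [Stack.tree_congr hτ₂ h₁.wf]
          exact h₁.notMem_labels hl₂D)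
      exact hR (.cons hl₁D' hl₂D') h₃

/-- Evaluation of `cons`. -/
theorem Inv.cons (hnew : ∀ σ : CStore, σ.lookup (new σ) = none) (hR : ReturnOk new n)
    {d₁ d₂ : DExp} (hd₁ : Lazy D [] d₁) (hd₂ : Lazy D [] d₂)
    (h : Inv D δ τ K past σ t (.cons (d₁.lift τ) (d₂.lift τ))) :
    Ok new (n + 1) past t ⟨anno (.cons (.delay d₁) (.delay d₂)), σ, K.kont, K.mark⟩ := by
  by_cases hl : (d₁.lift τ).IsLabeled ∧ (d₂.lift τ).IsLabeled
  · obtain ⟨l₁', rfl⟩ := hd₁.eq_loc_of_isLabeled hl.1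
    obtain ⟨l₂', rfl⟩ := hd₂.eq_loc_of_isLabeled hl.2
    -- The `cons` is already a value of λLR: no step is taken, and the two new locations share the
    -- trees of their contents.
    refine h.cons_trees hnew hR hd₁ hd₂ (t₁ := τ l₁') (t₂ := fun _ => τ l₂')
      (Or.inr ⟨_, rfl, rfl⟩) (fun _ => Or.inr ⟨_, rfl, rfl⟩) rfl (fun _ => rfl) ?_
    intro D' δ' τ' past' σ' t' l₁ l₂ h' _ _ _ h₁ h₂ _ _ _
    exact ⟨τ', by rw [h₁, h₂]; exact h'⟩
  -- If one component is unlabeled, the contraction puts fresh labels on both, including one that is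
  -- labeled already.
  · refine h.cons_trees hnew hR hd₁ hd₂ (t₁ := .lab (new σ) (d₁.lift τ))
      (t₂ := fun l₂ => .lab l₂ (d₂.lift τ))
      (Or.inl rfl) (fun _ => Or.inl rfl) rfl (fun _ => rfl) ?_
    rintro D' δ' τ' past' σ' t' _ l₂ h' rfl hl₁D hl₂D h₁ h₂ hne hm₁ hm₂
    have hF := h'.sync.toForest
    refine h'.lrStep (d := .cons (.loc (new σ)) (.loc l₂)) ⟨hl₁D, hl₂D⟩ ?_ ?_
    · intro x a
      simp only [DExp.lift, LExp.subst, hF.closed _ hl₁D x a, hF.closed _ hl₂D x a]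
    · simp only [DExp.lift, h₁, h₂]
      exact .cons _ _ _ _ (not_and_or.1 hl) hm₁ hm₂ hne

/-- Completion of a delayed computation. -/
theorem Inv.complete_succ (hFo : ForceOk new n) {S : Set Loc} {l : Loc}
    (hS : S ⊆ insert l K.locs) (h : Sync D δ τ S past σ) (hK : K.WF D) (hF : F.WF D) {v : DExp}
    (hv : Val D v) (hvl : τ l = .lab l (v.lift τ) ∨ ∃ l', v = .loc l' ∧ τ l = τ l')
    (hcon : Consistent τ D (K.tree τ (F.tree τ (LExp.wrap ls (v.lift τ)))))
    (hsteps : LRSteps t (K.tree τ (F.tree τ (LExp.wrap ls (v.lift τ))))) {m : Mark}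
    {ls' : List Label} :
    Ok new (n + 1) past t ⟨valC v, σ, Stack.kont ((F, some (ls', l)) :: K), m⟩ := by
  refine Ok.beta_succ hv.isValue_valC ?_
  have hsubst : CExp.subst v2 (valC v) (thunkTail l) =
      letIn (.tmp 9) (.out (.cons (list [Tag.val.exp, .loc l, list [Tag.value.exp, valC v]])
        (.prim1 .cdr .ccm))) (valC v) := by
    simp [thunkTail, letIn, list, quoVar, CExp.subst, Tag.exp]
  rw [hsubst]
  have hmarks : marks ((Frame.forceAt l, none) :: Stack.forceKont F K) none =
      .cons forceMark (.cons F.mark (marks K.kont K.mark)) := rfl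
  have hq : (list [Tag.val.exp, .loc l, list [Tag.value.exp, valC v]]).isValue = true := by
    simp [list, Tag.exp, CExp.isValue, hv.isValue_valC]
  have hsync := h.complete hS hv hvl (marks ((Frame.forceAt l, none) :: Stack.forceKont F K) none)
  have hinv : Inv D (Function.update δ l v) τ K _ ((l, valC v) :: σ) _ _ :=
    ⟨hsync, hK, hcon, .refl⟩
  refine Ok.of_steps hsteps
    (Ok.emit_cdr (K := (Frame.forceAt l, none) :: Stack.forceKont F K) hq rfl ?_ ?_ ?_)
  · have : forceMark.isValue = true := rfl
    simp only [hmarks, CExp.isValue, this, hF.isValue_mark, hK.isValue_marks, Bool.and_self]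
  -- The innermost mark, that of `force_l`, has been dropped, so the displayed string has `v`
  -- directly under `force`.
  · refine hsync.explains hK (C₀ := v) (C := F.ctl (.force v)) ?_ ?_ ?_ hcon
    · have hu := hv.unquo_list
      simp only [list, List.foldr_cons, List.foldr_nil, Tag.exp] at hu
      simp [reconC, list, Tag.exp, storeEntry?, hu]
    · simp only [hmarks, reconE, Option.bind_eq_bind, reconFrame_forceMark, hF.reconFrame,
        Option.bind_some, hK.reconE]
    -- `force v` and `v` have the same lift.
    · obtain ⟨h₁, h₂, h₃⟩ := hinv.shows_ctl hv hF
      cases F <;> exact ⟨h₁, h₂, h₃⟩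
  · rw [subst_tmp_valC]
    -- After the store update the value meets the frame `(force [])` again, which matters if it is
    -- itself a location.
    exact Ok.ret hv.isValue_valC rfl (hFo hv hF hinv)

theorem ret_force {v : DExp} (hv : Val D v) (hvl : v.NotLoc) (KK : Kont) (m m' : Mark) :
    ret (valC v) σ .force KK m m' = some (none, ⟨valC v, σ, KK, m⟩) := by
  cases hv with
  | loc => exact hvl.elim
  | _ => rfl

theorem ret_isLoc {v : DExp} (hv : Val D v) (hvl : v.NotLoc) (KK : Kont) (m m' : Mark) :
    ret (valC v) σ .isLoc KK m m' = some (none, ⟨.bool false, σ, KK, m⟩) := by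
  cases hv with
  | loc => exact hvl.elim
  | _ => rfl

theorem forceOk_succ (hnew : ∀ σ : CStore, σ.lookup (new σ) = none) (hE : EvalOk new n)
    (hR : ReturnOk new n) (hFo : ForceOk new n) : ForceOk new (n + 1) := by
  intro D δ τ F K past σ t v ls hv hF h
  by_cases hvl : v.NotLoc
  · exact Ok.ret_succ hv.isValue_valC (ret_force hv hvl _ _ _) (h.forced hnew hE hR hv hvl hF)
  · cases hv with
    | @loc l hl =>
      -- The hole would contain `τ l`, hence the label `l`, below that very label.
      have hlK : l ∉ K.locs := fun hlK => by
        obtain ⟨h₁, s, h₂⟩ := h.consistent.of_tree.2 l hlK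
        refine h₁ (F.labels_tree τ _ (labels_wrap ls _ ?_))
        simp [DExp.lift, h₂, LExp.labels]
      have hidle := h.sync.idle l hl hlK
      have hlift : DExp.lift τ (.loc l) = τ l := rfl
      rcases h.sync.store l hl with ⟨hσ, hd⟩ | ⟨hσ, hv⟩
      · refine Ok.ret_succ rfl (s' := ⟨thunk l (δ l), σ,
          (.forceAt l, none) :: Stack.forceKont F K, none⟩) ?_ ?_
        · simp [valC, anno, ret, hσ, Stack.forceKont]
        refine Ok.wcm rfl (Ok.letIn ?_)
        rcases hidle with hidle | ⟨l', hl', hidle⟩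
        -- The labels `ls` and `l` move from the expression into the stack; the program is the same,
        -- and `l` is now under evaluation.
        · refine hE (K := (F, some (ls, l)) :: K) hd
            ⟨h.sync.mono (Set.subset_insert _ _), fun f hf => ?_, ?_, ?_⟩
          · rcases List.mem_cons.1 hf with rfl | hf
            exacts [hF, h.wf f hf]
          · have := h.consistent
            rw [hlift, hidle] at this
            exact this
          · have := h.steps
            rw [hlift, hidle] at this
            exact this
        -- The delayed expression is itself a location, hence a value, and the computation completes
        -- at once. The shared tree need not be labeled with `l`, so `l` never joins the locations
        -- under evaluation.
        · rw [hl'] at hd ⊢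
          refine (Inv.complete_succ (ls := ls) (v := .loc l') (ls' := ls) hFo
            (Set.subset_insert _ _) h.sync h.wf hF
            (.loc hd.scoped) (Or.inr ⟨l', rfl, hidle⟩) ?_ ?_).mono
          · have := h.consistent
            rwa [hlift, hidle] at this
          · have := h.steps
            rwa [hlift, hidle] at this
      · refine Ok.ret_succ rfl (s' := ⟨valC (δ l), σ,
          (.forceAt l, none) :: Stack.forceKont F K, none⟩) ?_ (Ok.ret hv.isValue_valC rfl ?_)
        · simp [valC, anno, ret, hσ, Stack.forceKont]
        have hsync := h.sync.restore hσ
        rcases hidle with hidle | ⟨l', hl', hidle⟩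
        -- The label `l` joins those around the value.
        · refine hFo (ls := ls ++ [l]) hv hF ⟨hsync, h.wf, ?_, ?_⟩
          · have := h.consistent
            rw [hlift, hidle] at this
            rw [wrap_append]
            exact this
          · have := h.steps
            rw [hlift, hidle] at this
            rw [wrap_append]
            exact this
        · refine hFo (ls := ls) hv hF ⟨hsync, h.wf, ?_, ?_⟩
          · have := h.consistent
            rw [hlift, hidle] at this
            rwa [hl']
          · have := h.steps
            rw [hlift, hidle] at this
            rwa [hl']
    | _ => exact (hvl trivial).elim

theorem returnOk_succ (hnew : ∀ σ : CStore, σ.lookup (new σ) = none) (hE : EvalOk new n)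
    (hR : ReturnOk new n) (hFo : ForceOk new n) : ReturnOk new (n + 1) := by
  intro D δ τ K past σ t v hv h
  rcases K with _ | ⟨⟨F, _ | ⟨ls, l⟩⟩, K⟩
  · refine ok_of_stuck ?_
    simp [step, hv.isValue_valC, Stack.kont]
  · have hF : F.WF D := h.wf (F, none) (by simp)
    have hK : Stack.WF D K := fun f hf => h.wf f (by simp [hf])
    have h' : Inv D δ τ K past σ t (F.tree τ (LExp.wrap [] (v.lift τ))) :=
      ⟨h.sync, hK, h.consistent, h.steps⟩
    refine Ok.beta_succ hv.isValue_valC ?_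
    have hsubst : CExp.subst v0 (valC v) forceHead =
        letIn v1 (.ite (.ite (.isLoc (valC v)) (.bool false) (.bool true)) (valC v)
          (.wcm forceMark (.force (valC v)))) forceTail := by
      simp [forceHead, forceTail, forceMark, emit, letIn, list, quoVar, CExp.subst, Tag.exp,
        CExp.not]
    rw [hsubst]
    refine Ok.letIn (Ok.silent rfl (Ok.silent rfl (Ok.silent rfl ?_)))
    -- The annotation tests for a location and applies `force` only to one; any other value goes
    -- directly to the operation.
    by_cases hvl : v.NotLoc
    · refine Ok.ret hv.isValue_valC (ret_isLoc hv hvl _ _ _) (Ok.ret rfl rfl (Ok.ret rfl rfl ?_))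
      exact h'.forced hnew hE hR hv hvl hF
    · cases hv with
      | loc hl =>
        refine Ok.ret rfl rfl (Ok.ret rfl rfl (Ok.ret rfl rfl (Ok.wcm rfl (Ok.silent rfl ?_))))
        exact hFo (.loc hl) hF h'
      | _ => exact (hvl trivial).elim
  · have hF : F.WF D := h.wf (F, some (ls, l)) (by simp)
    have hK : Stack.WF D K := fun f hf => h.wf f (by simp [hf])
    have hcon := h.consistent
    have hsteps := h.steps
    simp only [Stack.tree] at hcon hsteps
    -- The program shows `v` under the label `l`, and by consistency this is all of `τ l`.
    have hl := ((compositional_consistent τ D).of_frame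
      (Consistent.of_tree (K := K) hcon).1).of_wrap.1.2
    refine Inv.complete_succ (ls := ls ++ [l]) hFo (Set.Subset.refl _) h.sync hK hF hv (Or.inl hl)
      ?_ ?_
    · rw [wrap_append]
      exact hcon
    · rw [wrap_append]
      exact hsteps

/-- An annotated value is a value, so its evaluation is a return with no transition spent; this is
why `ReturnOk` is needed at `n + 1` as well. -/
theorem evalOk_succ (hnew : ∀ σ : CStore, σ.lookup (new σ) = none) (hE : EvalOk new n)
    (hR : ReturnOk new n) (hR' : ReturnOk new (n + 1)) : EvalOk new (n + 1) := by
  intro D δ τ K past σ t d hd h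
  cases hd with
  | num k => exact hR' (.num k) h
  | str s => exact hR' (.str s) h
  | bool b => exact hR' (.bool b) h
  | null => exact hR' .null h
  | var hx => simp at hx
  | loc hl => exact hR' (.loc hl) h
  | lam hd => exact hR' (.lam hd) h
  | @app _ d₁ d₂ h₁ h₂ =>
    exact Inv.op_succ (F := .app d₂) h₂ (hE h₁ (Inv.push (F := .app d₂) h h₂))
  | @prim2 _ d₁ d₂ p h₁ h₂ =>
    exact Inv.op_succ (F := .prim2L p d₂) h₂ (hE h₁ (Inv.push (F := .prim2L p d₂) h h₂))
  | cons h₁ h₂ => exact h.cons hnew hR h₁ h₂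
  | @prim1 _ d₁ p h₁ =>
    exact Inv.op_succ (F := .prim1 p) (D := D) trivial
      (hE h₁ (Inv.push (F := .prim1 p) h trivial))
  | @ite _ d₁ d₂ d₃ h₁ h₂ h₃ =>
    exact Inv.op_succ (F := .ite d₂ d₃) ⟨h₂, h₃⟩
      (hE h₁ (Inv.push (F := .ite d₂ d₃) h ⟨h₂, h₃⟩))

/-- The index bounds the transitions observed, so programs that diverge need no separate treatment.
Each statement spends at least one transition before it appeals to the others at `n`. -/
theorem simulation (hnew : ∀ σ : CStore, σ.lookup (new σ) = none) (n : ℕ) :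
    EvalOk new n ∧ ReturnOk new n ∧ ForceOk new n := by
  induction n with
  | zero => exact ⟨fun _ _ => ok_zero, fun _ _ => ok_zero, fun _ _ _ => ok_zero⟩
  | succ n ih =>
    obtain ⟨hE, hR, hFo⟩ := ih
    have hR' : ReturnOk new (n + 1) := returnOk_succ hnew hE hR hFo
    exact ⟨evalOk_succ hnew hE hR hR', hR', forceOk_succ hnew hE hR hFo⟩

end

-- The initial configuration.

theorem lift_expand (τ : Loc → LExp) (e : Exp) : (expand e).lift τ = e.toLExp := by
  induction e <;> simp_all [expand, DExp.lift, Exp.toLExp]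

end LazyStepper

theorem theorem1 (new : LazyStepper.CStore → LazyStepper.Loc)
    (hnew : ∀ σ : LazyStepper.CStore, σ.lookup (new σ) = none)
    (e : LazyStepper.Exp) (he : e.IsProgram) (ds : List LazyStepper.Exp)
    (h : LazyStepper.Displays new e (e :: ds)) :
    ∃ es : List LazyStepper.LExp,
      ds = es.map LazyStepper.LExp.unlabel ∧
      List.IsChain LazyStepper.LRSteps (e.toLExp :: es) := by
  obtain ⟨k, states, es, hrecon, hsynth, hds⟩ := h
  rw [List.cons.injEq] at hds
  obtain ⟨-, rfl⟩ := hds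
  have hd : LazyStepper.Lazy ∅ [] (LazyStepper.expand e) :=
    LazyStepper.lazy_expand ∅ e [] fun x hx => by
      rw [he] at hx
      exact absurd hx (Finset.notMem_empty x)
  -- There are no locations yet, so the choice of the forest is immaterial.
  let τ : LazyStepper.Loc → LazyStepper.LExp := fun _ => .null
  have hinv : LazyStepper.Inv ∅ (fun _ => .null) τ [] [] [] e.toLExp
      ((LazyStepper.expand e).lift τ) :=
    { sync :=
        { consistent := fun _ h => h.elim
          labeled := fun _ h => h.elim
          closed := fun _ h => h.elim
          inScope := fun _ h => h.elim
          idle := fun _ h => h.elim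
          store := fun _ h => h.elim
          recon := ⟨[], rfl, fun _ h => h.elim⟩ }
      wf := fun _ h => by cases h
      consistent := LazyStepper.Consistent.lift (fun _ h => h.elim) hd.scoped
      steps := by rw [LazyStepper.lift_expand]; exact .refl }
  exact ((LazyStepper.simulation hnew k).1 hd hinv k le_rfl).exists_chain hrecon hsynth
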